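/- Let $\phi(x)=e^{-|x|}$ and $\phi'(x)=-\operatorname{sgn}(x)e^{-|x|}$, and let $b\in\mathbb{R}$. On the complex Hilbert space $L^2(\mathbb{R})$ (with inner product $\langle\cdot,\cdot\rangle$ conjugate-linear in the first argument) consider the operator $$L v=(1-\phi^2)v'+(4-b)\phi\phi' v+Qv,\qquad Qv=(b-3)\big[\phi*((\phi^2)'v)-2\,\phi'*(\phi^2 v)\big],$$ with domain $\mathrm{Dom}(L)=\{v\in L^2(\mathbb{R}):(1-\phi^2)v'\in L^2(\mathbb{R})\}$ (derivative in the sense of distributions) equipped with the graph norm, and let $L^*$ be its adjoint. Put $Y=C(\mathbb{R},\mathrm{Dom}(L))\cap C^1(\mathbb{R},L^2(\mathbb{R}))$. Consider the weak linearization of the $b$-Novikov equation at the peakon, $$\tilde v_t=L\tilde v-4(b-3)\langle\phi^2\phi',\tilde v\rangle\,\phi,\qquad(\mathrm{W})$$ the equation $\omega_t=L\omega$ (E), and, for given $\omega$, the system $$\alpha'=(4-b)\beta-4(b-3)\langle\phi^2\phi',\omega\rangle,\qquad \beta'=(4-b)\alpha.\qquad(\mathrm{M})$$ All solutions of (W)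 and (E) are understood in $Y$. The peakon is called linearly stable on $L^2(\mathbb{R})$ if for every $\tilde v_0\in\mathrm{Dom}(L)$ there are a constant $C>0$ and a unique solution $\tilde v$ of (W) with $\tilde v(0)=\tilde v_0$, and it satisfies $\|\tilde v(t)\|_{L^2}\le C\|\tilde v_0\|_{L^2}$ for all $t>0$; otherwise it is called linearly unstable. We say that $v$ grows at rate $\gamma$ if there is $c>0$ with $\|v(t)\|_{L^2}\ge c\,e^{\gamma t}$ for all $t\ge0$. Then the peakon is linearly unstable on $L^2(\mathbb{R})$ for every $b\in\mathbb{R}$. More precisely: 1. If $b\ne4$, there are $\alpha,\beta$ solving (M) with $\omega=0$ such that $\alpha\phi+\beta\phi'$ solves (W) and grows at rate $|b-4|$. 2. If $b<5$, every $\lambda_0\in\mathbb{C}$ with $0<\operatorname{Re}\lambda_0<5-b$ is an eigenvalue of $L$ on $L^2(\mathbb{R})$. If moreover $\lambda_0^2\neq(b-2)(4-b)$, then for every eigenfunction $w_0$ of $L$ for $\lambda_0$: $w_0\notin\operatorname{span}\{\phi,\phi'\}$, the function $\omega(t)=e^{\lambda_0t}w_0$ solves (E), and there are $\alpha,\beta$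 solving (M) such that $\tilde v=\omega+\alpha\phi+\beta\phi'$ solves (W) and grows at rate $\operatorname{Re}\lambda_0$. 3. If $b>5$, then for every real $\lambda_0\in(0,b-5)$ there is an eigenfunction $w_0\in L^2(\mathbb{R})$ of $L^*$ for $\lambda_0$. Every solution $\omega$ of (E) satisfies $\langle w_0,\omega(t)\rangle=e^{\lambda_0t}\langle w_0,\omega(0)\rangle$ for all $t\in\mathbb{R}$, and there is a solution of (E) of the form $\omega(t)=e^{\lambda_0t}w_0+\tilde w(t)$ with $\langle w_0,\tilde w(t)\rangle=0$ for all $t$, together with $\alpha,\beta$ solving (M), such that $\tilde v=\omega+\alpha\phi+\beta\phi'$ solves (W) and grows at rate $\lambda_0$. -/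

import Mathlib

open MeasureTheory
open scoped ContDiff Convolution

namespace BNovikov

/-- The complex Hilbert space `L²(ℝ)`. -/
abbrev L2R : Type := Lp ℂ 2 (volume : Measure ℝ)

/-- The peakon profile `φ(x) = e^{-|x|}`. -/
noncomputable def phi (x : ℝ) : ℝ := Real.exp (-|x|)

/-- The piecewise derivative `φ'(x) = -sgn(x) e^{-|x|}`. -/
noncomputable def dphi (x : ℝ) : ℝ := -Real.sign x * Real.exp (-|x|)

theorem phi_pos (x : ℝ) : 0 < phi x := Real.exp_pos _

theorem phi_le_one (x : ℝ) : phi x ≤ 1 := by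
  simp [phi]

theorem abs_dphi_le (x : ℝ) : |dphi x| ≤ phi x := by
  rcases lt_trichotomy x 0 with h | h | h
  · simp [dphi, phi, Real.sign_of_neg h]
  · subst h; simp [dphi, phi]
  · simp [dphi, phi, Real.sign_of_pos h]

theorem measurable_phi : Measurable phi := by
  unfold phi; fun_prop

theorem measurable_dphi : Measurable dphi := by
  have h : Measurable Real.sign := by
    unfold Real.sign
    exact Measurable.ite measurableSet_Iio measurable_const
      (Measurable.ite measurableSet_Ioi measurable_const measurable_const)
  unfold dphi
  fun_prop

theorem memLp_phi : MemLp phi 2 volume := by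
  rw [memLp_two_iff_integrable_sq measurable_phi.aestronglyMeasurable]
  have h1 : IntegrableOn (fun x : ℝ => phi x ^ 2) (Set.Iic 0) := by
    refine ((integrableOn_exp_mul_Iic (a := 2) (by norm_num) 0)).congr_fun ?_ measurableSet_Iic
    intro x hx
    simp only [Set.mem_Iic] at hx
    simp only [phi]
    rw [abs_of_nonpos hx, ← Real.exp_nat_mul]
    norm_num
  have h2 : IntegrableOn (fun x : ℝ => phi x ^ 2) (Set.Ioi 0) := by
    refine ((integrableOn_exp_mul_Ioi (a := -2) (by norm_num) 0)).congr_fun ?_ measurableSet_Ioi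
    intro x hx
    simp only [Set.mem_Ioi] at hx
    simp only [phi]
    rw [abs_of_pos hx, ← Real.exp_nat_mul]
    norm_num
  have := h1.union h2
  rwa [Set.Iic_union_Ioi, integrableOn_univ] at this

/-- A measurable real function bounded by `φ` defines an element of `L²(ℝ)`. -/
theorem memLp_of_le_phi {f : ℝ → ℝ} (hf : Measurable f) (h : ∀ x, |f x| ≤ phi x) :
    MemLp (fun x => (f x : ℂ)) 2 volume := by
  refine memLp_phi.mono (by fun_prop) (Filter.Eventually.of_forall fun x => ?_)
  simpa [abs_of_pos (phi_pos x)] using h x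

theorem abs_phi_sq_dphi_le (x : ℝ) : |phi x ^ 2 * dphi x| ≤ phi x := by
  have h0 := phi_pos x
  have h1 := phi_le_one x
  rw [abs_mul, abs_of_nonneg (by positivity)]
  calc phi x ^ 2 * |dphi x| ≤ 1 * phi x :=
        mul_le_mul (by nlinarith) (abs_dphi_le x) (abs_nonneg _) zero_le_one
    _ = phi x := one_mul _

/-- `φ` as an element of `L²(ℝ)`. -/
noncomputable def phiL : L2R :=
  (memLp_of_le_phi measurable_phi fun x => (abs_of_pos (phi_pos x)).le).toLp

/-- `φ'` as an element of `L²(ℝ)`. -/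
noncomputable def dphiL : L2R :=
  (memLp_of_le_phi measurable_dphi abs_dphi_le).toLp

/-- `φ² φ'` as an element of `L²(ℝ)`. -/
noncomputable def phiSqDphiL : L2R :=
  (memLp_of_le_phi ((measurable_phi.pow_const 2).mul measurable_dphi) abs_phi_sq_dphi_le).toLp

/-- `g = (1 - φ²) v'` in the sense of distributions. Pairing with a test function `ψ` gives
`∫ g ψ = -∫ v ((1 - φ²) ψ)'`, where `((1 - φ²) ψ)' = (1 - φ²) ψ' - 2 φ φ' ψ` almost everywhere. -/
def IsWeightedDeriv (v g : L2R) : Prop :=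
  ∀ ψ : ℝ → ℝ, ContDiff ℝ ∞ ψ → HasCompactSupport ψ →
    ∫ x, ψ x • g x =
      -∫ x, ((1 - phi x ^ 2) * deriv ψ x - 2 * phi x * dphi x * ψ x) • v x

theorem integrable_smul_of_compact {k : ℝ → ℝ} (hk : MemLp k 2 volume) (v : L2R) :
    Integrable (fun x => k x • v x) := by
  have := MemLp.integrable_mul (p := 2) (q := 2) (hk.ofReal (K := ℂ)) (Lp.memLp v)
  refine this.congr (Filter.Eventually.of_forall fun x => ?_)
  simp

theorem memLp_test {ψ : ℝ → ℝ} (h : ContDiff ℝ ∞ ψ) (hc : HasCompactSupport ψ) :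
    MemLp ψ 2 volume := h.continuous.memLp_of_hasCompactSupport hc

theorem memLp_weighted_test {ψ : ℝ → ℝ} (h : ContDiff ℝ ∞ ψ) (hc : HasCompactSupport ψ) :
    MemLp (fun x => (1 - phi x ^ 2) * deriv ψ x - 2 * phi x * dphi x * ψ x) 2 volume := by
  have h1 : MemLp (deriv ψ) 2 volume :=
    (h.continuous_deriv (by simp)).memLp_of_hasCompactSupport hc.deriv
  have h2 := memLp_test h hc
  refine MemLp.sub ?_ ?_
  · have hm : Measurable fun x => 1 - phi x ^ 2 := measurable_const.sub (measurable_phi.pow_const 2)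
    refine h1.mono (hm.aestronglyMeasurable.mul h1.1) (Filter.Eventually.of_forall fun x => ?_)
    have h0 := phi_pos x
    have h3 := phi_le_one x
    rw [norm_mul]
    refine mul_le_of_le_one_left (norm_nonneg _) ?_
    rw [Real.norm_eq_abs, abs_le]
    constructor <;> nlinarith
  · refine (h2.const_mul 2).mono ((((measurable_phi.const_mul 2).mul
      measurable_dphi).aestronglyMeasurable).mul h2.1) (Filter.Eventually.of_forall fun x => ?_)
    have h0 := phi_pos x
    have h3 := phi_le_one x
    have h4 := abs_dphi_le x
    rw [norm_mul _ (ψ x), norm_mul (2 : ℝ) (ψ x)]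
    refine mul_le_mul_of_nonneg_right ?_ (norm_nonneg (ψ x))
    rw [Real.norm_eq_abs, Real.norm_eq_abs, abs_mul, abs_of_pos (by positivity : 0 < 2 * phi x),
      abs_of_pos (by norm_num : (0 : ℝ) < 2)]
    nlinarith [abs_nonneg (dphi x)]

theorem IsWeightedDeriv.add {v g v' g' : L2R} (h : IsWeightedDeriv v g)
    (h' : IsWeightedDeriv v' g') : IsWeightedDeriv (v + v') (g + g') := by
  intro ψ hψ hc
  have e1 : ∫ x, ψ x • (g + g' : L2R) x = ∫ x, (ψ x • g x + ψ x • g' x) := by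
    refine integral_congr_ae ?_
    filter_upwards [Lp.coeFn_add g g'] with x hx
    simp only [hx, Pi.add_apply, smul_add]
  have e2 : ∫ x, ((1 - phi x ^ 2) * deriv ψ x - 2 * phi x * dphi x * ψ x) • (v + v' : L2R) x =
      ∫ x, (((1 - phi x ^ 2) * deriv ψ x - 2 * phi x * dphi x * ψ x) • v x +
        ((1 - phi x ^ 2) * deriv ψ x - 2 * phi x * dphi x * ψ x) • v' x) := by
    refine integral_congr_ae ?_
    filter_upwards [Lp.coeFn_add v v'] with x hx
    simp only [hx, Pi.add_apply, smul_add]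
  have i := memLp_test hψ hc
  have j := memLp_weighted_test hψ hc
  rw [e1, e2, integral_add (integrable_smul_of_compact i g) (integrable_smul_of_compact i g'),
    integral_add (integrable_smul_of_compact j v) (integrable_smul_of_compact j v'),
    h ψ hψ hc, h' ψ hψ hc]
  ring

theorem IsWeightedDeriv.smul {v g : L2R} (c : ℂ) (h : IsWeightedDeriv v g) :
    IsWeightedDeriv (c • v) (c • g) := by
  intro ψ hψ hc
  have e (k : ℝ → ℝ) (u : L2R) : ∫ x, k x • (c • u : L2R) x = c * ∫ x, k x • u x := by
    rw [← integral_const_mul]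
    refine integral_congr_ae ?_
    filter_upwards [Lp.coeFn_smul c u] with x hx
    simp only [hx, Pi.smul_apply, smul_eq_mul, Complex.real_smul]
    ring
  rw [e, e _ v, h ψ hψ hc]
  ring

theorem IsWeightedDeriv.unique {v g g' : L2R} (h : IsWeightedDeriv v g)
    (h' : IsWeightedDeriv v g') : g = g' := by
  have hloc (u : L2R) : LocallyIntegrable u volume :=
    (Lp.memLp u).locallyIntegrable (by norm_num)
  have key := ae_eq_zero_of_integral_contDiff_smul_eq_zero (μ := volume)
    (f := fun x => g x - g' x) ((hloc g).sub (hloc g')) (fun ψ hψ hc => by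
      have i := memLp_test hψ hc
      simp only [smul_sub]
      rw [integral_sub (integrable_smul_of_compact i g) (integrable_smul_of_compact i g'),
        h ψ hψ hc, h' ψ hψ hc, sub_self])
  refine Lp.ext ?_
  filter_upwards [key] with x hx
  exact sub_eq_zero.mp hx

theorem IsWeightedDeriv.zero : IsWeightedDeriv 0 0 := by
  intro ψ _ _
  have e (k : ℝ → ℝ) : ∫ x, k x • (0 : L2R) x = 0 := by
    refine integral_eq_zero_of_ae ?_
    filter_upwards [Lp.coeFn_zero ℂ 2 (volume : Measure ℝ)] with x hx
    rw [hx, Pi.zero_apply, smul_zero]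
  rw [e, e, neg_zero]

/-- `Dom(L) = {v ∈ L²(ℝ) : (1 - φ²) v' ∈ L²(ℝ)}`. -/
def domL : Submodule ℂ L2R where
  carrier := {v | ∃ g : L2R, IsWeightedDeriv v g}
  add_mem' := fun ⟨g, hg⟩ ⟨g', hg'⟩ => ⟨g + g', hg.add hg'⟩
  zero_mem' := ⟨0, IsWeightedDeriv.zero⟩
  smul_mem' := fun c _ ⟨g, hg⟩ => ⟨c • g, hg.smul c⟩

/-- The linear map `v ↦ (1 - φ²) v'` on `Dom(L)`. -/
noncomputable def weightedDeriv : domL →ₗ[ℂ] L2R where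
  toFun v := v.2.choose
  map_add' v w := ((v + w).2.choose_spec).unique (v.2.choose_spec.add w.2.choose_spec)
  map_smul' c v := ((c • v).2.choose_spec).unique (v.2.choose_spec.smul c)

theorem weightedDeriv_spec (v : domL) : IsWeightedDeriv v (weightedDeriv v) :=
  v.2.choose_spec

/-- The multiplication operator `v ↦ φ φ' v`, pointwise. -/
noncomputable def mulFun (v : ℝ → ℂ) (x : ℝ) : ℂ := (phi x * dphi x) • v x

theorem memLp_mulFun (v : L2R) : MemLp (mulFun v) 2 volume := by
  refine (Lp.memLp v).mono (((measurable_phi.mul measurable_dphi).aestronglyMeasurable).smul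
    (Lp.memLp v).1) (Filter.Eventually.of_forall fun x => ?_)
  have h0 := phi_pos x
  have h3 := phi_le_one x
  have h4 := abs_dphi_le x
  simp only [mulFun]
  rw [norm_smul]
  refine mul_le_of_le_one_left (norm_nonneg _) ?_
  rw [Real.norm_eq_abs, abs_mul, abs_of_pos h0]
  nlinarith [abs_nonneg (dphi x)]

/-- The multiplication operator `v ↦ φ φ' v` on `L²(ℝ)`. -/
noncomputable def mulOp : L2R →ₗ[ℂ] L2R where
  toFun v := (memLp_mulFun v).toLp
  map_add' v w := by
    refine Lp.ext ?_
    filter_upwards [(memLp_mulFun (v + w)).coeFn_toLp, (memLp_mulFun v).coeFn_toLp,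
      (memLp_mulFun w).coeFn_toLp, Lp.coeFn_add v w,
      Lp.coeFn_add ((memLp_mulFun v).toLp) ((memLp_mulFun w).toLp)] with x h1 h2 h3 h4 h5
    rw [h1, h5, Pi.add_apply, h2, h3]
    simp only [mulFun, h4, Pi.add_apply, smul_add]
  map_smul' c v := by
    refine Lp.ext ?_
    filter_upwards [(memLp_mulFun (c • v)).coeFn_toLp, (memLp_mulFun v).coeFn_toLp,
      Lp.coeFn_smul c v, Lp.coeFn_smul c ((memLp_mulFun v).toLp)] with x h1 h2 h3 h4
    simp only [RingHom.id_apply]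
    rw [h1, h4, Pi.smul_apply, h2]
    simp only [mulFun, h3, Pi.smul_apply, smul_eq_mul, Complex.real_smul]
    ring

/-- `Q(v) = (b - 3) [φ ∗ ((φ²)' v) - 2 φ' ∗ (φ² v)]`, pointwise, with `(φ²)' = 2 φ φ'`. -/
noncomputable def QFun (b : ℝ) (v : ℝ → ℂ) (x : ℝ) : ℂ :=
  (b - 3 : ℝ) • ((phi ⋆ fun y => (2 * phi y * dphi y) • v y) x
    - (2 : ℝ) • (dphi ⋆ fun y => (phi y ^ 2) • v y) x)

section Kernel

variable {k w : ℝ → ℝ}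

theorem integrable_phi_norm (v : L2R) : Integrable (fun y => phi y * ‖v y‖) :=
  MemLp.integrable_mul (p := 2) (q := 2) memLp_phi (Lp.memLp v).norm

theorem kernel_bound (hk : ∀ x, |k x| ≤ phi x) (hw : ∀ y, |w y| ≤ 2 * phi y ^ 2)
    (v : L2R) (x y : ℝ) : ‖k (x - y) • w y • v y‖ ≤ 2 * phi x * (phi y * ‖v y‖) := by
  rw [norm_smul, norm_smul, Real.norm_eq_abs, Real.norm_eq_abs, ← mul_assoc, ← mul_assoc]
  refine mul_le_mul_of_nonneg_right ?_ (norm_nonneg _)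
  have h1 : phi (x - y) * phi y ≤ phi x := by
    simp only [phi]
    rw [← Real.exp_add, Real.exp_le_exp]
    have := abs_sub_abs_le_abs_sub x y
    linarith
  calc |k (x - y)| * |w y| ≤ phi (x - y) * (2 * phi y ^ 2) :=
        mul_le_mul (hk _) (hw _) (abs_nonneg _) (phi_pos _).le
    _ = 2 * (phi (x - y) * phi y) * phi y := by ring
    _ ≤ 2 * phi x * phi y := by
        have := (phi_pos y).le
        gcongr

theorem integrable_kernel (mk : Measurable k) (mw : Measurable w)
    (hk : ∀ x, |k x| ≤ phi x) (hw : ∀ y, |w y| ≤ 2 * phi y ^ 2) (v : L2R) (x : ℝ) :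
    Integrable (fun y => k (x - y) • w y • v y) := by
  refine ((integrable_phi_norm v).const_mul (2 * phi x)).mono' ?_
    (Filter.Eventually.of_forall fun y => kernel_bound hk hw v x y)
  exact (mk.comp (measurable_const.sub measurable_id)).aestronglyMeasurable.smul
    (mw.aestronglyMeasurable.smul (Lp.memLp v).1)

theorem memLp_convolution (mk : Measurable k) (mw : Measurable w)
    (hk : ∀ x, |k x| ≤ phi x) (hw : ∀ y, |w y| ≤ 2 * phi y ^ 2) (v : L2R) :
    MemLp (k ⋆ fun y => w y • v y) 2 volume := by
  have hm : AEStronglyMeasurable (k ⋆ fun y => w y • v y) volume := by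
    have h : AEStronglyMeasurable (fun p : ℝ × ℝ => k (p.1 - p.2) • w p.2 • v p.2)
        ((volume : Measure ℝ).prod volume) :=
      (mk.comp (measurable_fst.sub measurable_snd)).aestronglyMeasurable.smul
        ((mw.comp measurable_snd).aestronglyMeasurable.smul ((Lp.memLp v).1.comp_snd))
    refine h.integral_prod_right'.congr (Filter.Eventually.of_forall fun x => ?_)
    exact (convolution_lsmul_swap).symm
  refine (memLp_phi.const_mul (2 * ∫ y, phi y * ‖v y‖)).mono hm
    (Filter.Eventually.of_forall fun x => ?_)
  rw [convolution_lsmul_swap]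
  refine (norm_integral_le_of_norm_le ((integrable_phi_norm v).const_mul (2 * phi x))
    (Filter.Eventually.of_forall fun y => kernel_bound hk hw v x y)).trans ?_
  rw [integral_const_mul, Real.norm_eq_abs]
  refine le_trans (le_of_eq ?_) (le_abs_self _)
  ring

theorem convolution_lin (mk : Measurable k) (mw : Measurable w)
    (hk : ∀ x, |k x| ≤ phi x) (hw : ∀ y, |w y| ≤ 2 * phi y ^ 2) (u v : L2R) (x : ℝ) :
    (k ⋆ fun y => w y • (u + v : L2R) y) x
      = (k ⋆ fun y => w y • u y) x + (k ⋆ fun y => w y • v y) x := by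
  simp only [convolution_lsmul_swap]
  rw [← integral_add (integrable_kernel mk mw hk hw u x) (integrable_kernel mk mw hk hw v x)]
  refine integral_congr_ae ?_
  filter_upwards [Lp.coeFn_add u v] with y hy
  simp only [hy, Pi.add_apply, smul_add]

theorem convolution_const_smul (c : ℂ) (v : L2R) (x : ℝ) :
    (k ⋆ fun y => w y • (c • v : L2R) y) x = c * (k ⋆ fun y => w y • v y) x := by
  simp only [convolution_lsmul_swap]
  rw [← integral_const_mul]
  refine integral_congr_ae ?_
  filter_upwards [Lp.coeFn_smul c v] with y hy
  simp only [hy, Pi.smul_apply, smul_eq_mul, Complex.real_smul]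
  ring

end Kernel

theorem abs_phi_le (x : ℝ) : |phi x| ≤ phi x := (abs_of_pos (phi_pos x)).le

theorem measurable_w1 : Measurable fun y => 2 * phi y * dphi y :=
  (measurable_phi.const_mul 2).mul measurable_dphi

theorem measurable_w2 : Measurable fun y => phi y ^ 2 := measurable_phi.pow_const 2

theorem abs_w1_le (y : ℝ) : |2 * phi y * dphi y| ≤ 2 * phi y ^ 2 := by
  have h0 := phi_pos y
  have h4 := abs_dphi_le y
  rw [abs_mul, abs_of_pos (by positivity : 0 < 2 * phi y)]
  nlinarith

theorem abs_w2_le (y : ℝ) : |phi y ^ 2| ≤ 2 * phi y ^ 2 := by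
  rw [abs_of_nonneg (by positivity)]
  nlinarith [sq_nonneg (phi y)]

theorem memLp_QFun (b : ℝ) (v : L2R) : MemLp (QFun b v) 2 volume :=
  ((memLp_convolution measurable_phi measurable_w1 abs_phi_le abs_w1_le v).sub
    ((memLp_convolution measurable_dphi measurable_w2 abs_dphi_le abs_w2_le v).const_smul
      (2 : ℝ))).const_smul (b - 3 : ℝ)

/-- The operator `Q` on `L²(ℝ)`. -/
noncomputable def Q (b : ℝ) : L2R →ₗ[ℂ] L2R where
  toFun v := (memLp_QFun b v).toLp
  map_add' v w := by
    refine Lp.ext ?_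
    filter_upwards [(memLp_QFun b (v + w)).coeFn_toLp, (memLp_QFun b v).coeFn_toLp,
      (memLp_QFun b w).coeFn_toLp,
      Lp.coeFn_add ((memLp_QFun b v).toLp) ((memLp_QFun b w).toLp)] with x h1 h2 h3 h5
    rw [h1, h5, Pi.add_apply, h2, h3]
    simp only [QFun,
      convolution_lin measurable_phi measurable_w1 abs_phi_le abs_w1_le,
      convolution_lin measurable_dphi measurable_w2 abs_dphi_le abs_w2_le]
    module
  map_smul' c v := by
    refine Lp.ext ?_
    filter_upwards [(memLp_QFun b (c • v)).coeFn_toLp, (memLp_QFun b v).coeFn_toLp,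
      Lp.coeFn_smul c ((memLp_QFun b v).toLp)] with x h1 h2 h4
    simp only [RingHom.id_apply]
    rw [h1, h4, Pi.smul_apply, h2]
    simp only [QFun]
    rw [convolution_const_smul, convolution_const_smul]
    simp only [smul_eq_mul, Complex.real_smul]
    ring

/-- The operator `L v = (1 - φ²) v' + (4 - b) φ φ' v + Q v` on `Dom(L) ⊂ L²(ℝ)`. -/
noncomputable def L (b : ℝ) : L2R →ₗ.[ℂ] L2R where
  domain := domL
  toFun := weightedDeriv + ((4 - b : ℝ) : ℂ) • (mulOp ∘ₗ domL.subtype) + Q b ∘ₗ domL.subtype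

/-- `w` is an eigenfunction of the unbounded operator `A` for the eigenvalue `μ`. -/
def IsEigenfunction (A : L2R →ₗ.[ℂ] L2R) (μ : ℂ) (w : L2R) : Prop :=
  w ≠ 0 ∧ ∃ h : w ∈ A.domain, A ⟨w, h⟩ = μ • w

/-- `v` belongs to `Y = C(ℝ, Dom(L)) ∩ C¹(ℝ, L²(ℝ))`, where `Dom(L)` carries the graph norm. -/
def InY (b : ℝ) (v : ℝ → L2R) : Prop :=
  (∃ h : ∀ t, v t ∈ (L b).domain, Continuous v ∧ Continuous fun t => L b ⟨v t, h t⟩) ∧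
    ContDiff ℝ 1 v

/-- `z ∈ Y` solves `dz/dt = L z`. -/
def SolvesEvolution (b : ℝ) (z : ℝ → L2R) : Prop :=
  InY b z ∧ ∀ t, ∃ h : z t ∈ (L b).domain, HasDerivAt z (L b ⟨z t, h⟩) t

/-- `v ∈ Y` solves the weak linearization `v_t = L v - 4 (b - 3) ⟨φ² φ', v⟩ φ`. -/
def SolvesLinearization (b : ℝ) (v : ℝ → L2R) : Prop :=
  InY b v ∧ ∀ t, ∃ h : v t ∈ (L b).domain,
    HasDerivAt v (L b ⟨v t, h⟩ - (4 * (b - 3) * inner ℂ phiSqDphiL (v t) : ℂ) • phiL) t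

/-- The system `α' = (4 - b) β - 4 (b - 3) ⟨φ² φ', z⟩`, `β' = (4 - b) α`. -/
def SolvesModulation (b : ℝ) (z : ℝ → L2R) (α β : ℝ → ℂ) : Prop :=
  (∀ t, HasDerivAt α ((4 - b) * β t - 4 * (b - 3) * inner ℂ phiSqDphiL (z t)) t) ∧
    ∀ t, HasDerivAt β ((4 - b) * α t) t

/-- Linear stability of the peakon on `L²(ℝ)`: every `v₀ ∈ Dom(L)` is the initial value of a unique
solution of the weak linearization, and this solution is bounded by `C ‖v₀‖` for `t > 0`. -/
def LinearlyStable (b : ℝ) : Prop :=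
  ∀ v₀ ∈ (L b).domain, ∃ C : ℝ, 0 < C ∧ ∃ v : ℝ → L2R,
    (SolvesLinearization b v ∧ v 0 = v₀) ∧
    (∀ u : ℝ → L2R, SolvesLinearization b u → u 0 = v₀ → u = v) ∧
    ∀ t : ℝ, 0 < t → ‖v t‖ ≤ C * ‖v₀‖

/-- Linear instability is the negation of linear stability. -/
def LinearlyUnstable (b : ℝ) : Prop := ¬ LinearlyStable b

/-- `‖v(t)‖` grows at least like `e^{γ t}` as `t → ∞`. -/
def GrowsExponentially (γ : ℝ) (v : ℝ → L2R) : Prop :=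
  ∃ c : ℝ, 0 < c ∧ ∀ t : ℝ, 0 ≤ t → c * Real.exp (γ * t) ≤ ‖v t‖

end BNovikov

open BNovikov

/-!
The argument rests on the way `L` acts on the two half-lines `x > 0` and `x < 0`. The weight
`1 - φ²` vanishes at the peak, so nothing is imposed on a function there, and the kernel of `Q` is
such that `Q v` at `x` involves the values of `v` beyond `x` on the same side, together with one
moment of `v` on the other side multiplied by `e^{-|x|}` (`QFun_eq`). Hence the halves `posExpL` and
`negExpL` of the peakon absorb the interaction between the two sides, and they span a space that is
invariant under `L`, with `L φ = (4 - b) φ'` and `L φ' = (b - 2) φ`. For a solution of `ω_t = L ω`,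
the modulation system makes `ω + α φ + β φ'` a solution of the weak linearization
(`SolvesEvolution.solvesLinearization`). With `ω = 0` this gives the mode of rate `|b - 4|`.

For `b < 5` eigenfunctions are explicit up to quadrature. On a half-line `m = f - f''` satisfies a
first-order local equation with solution `e^{-λ s} (1 - e^{-2 s})^{-(λ + b) / 2}`, and two
integrations recover `f`, which is square integrable near the peak if `Re λ < 5 - b` and at infinity
if `Re λ > 0`; the integration constants are such that `f` fails to be an eigenfunction only by a
multiple of `e^{-s}` (`exists_half_eigenfunction`). Adding multiples of the two halves of `φ`
removes this defect (`exists_isEigenfunction`). The corresponding solutions grow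
because an eigenfunction outside the span of `φ` and `φ'` has positive distance from it.

For `b > 5` the adjoint has the eigenfunction `Γ'' - Γ` on `x > 0`, where
`Γ = e^{-μ s} (1 - e^{-2 s})^k` and `k = (b - 2 - μ) / 2 > 3 / 2` (`adjointL_isEigenfunction`).
It is orthogonal to `φ` and `φ'`, and the pairing with any solution of `ω_t = L ω` is multiplied by
`e^{μ t}`. What remains is one solution with nonzero pairing. No semigroup theory is needed: the
functions equal to `sinh (y - x)` on `(0, y)` and to `0` elsewhere are mapped by `L` to a
combination of the function itself, of its derivative with respect to `y`, and of `φ + φ'`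
(`lMaps_bumpL`), so that moving `y` along an ordinary differential equation gives an explicit
solution (`exists_solvesEvolution_bump`), and the pairing of such a function with `Γ'' - Γ` is
`Γ(y) > 0` (`inner_adjointL_bumpL`). Growth then follows from the Cauchy–Schwarz inequality.

Linear stability would bound every solution by its initial value, so a growing solution contradicts
it. For `b = 4`, where the rate `|b - 4|` degenerates, an eigenvalue with `λ = 1/2` is used.
-/

namespace BNovikov

open Set Filter Topology

/-! ### The operator on concrete functions -/

/-- `v ∈ Dom(L)` and `L v = R`. -/
def LMaps (b : ℝ) (v R : L2R) : Prop := ∃ h : v ∈ (L b).domain, L b ⟨v, h⟩ = R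

theorem LMaps.add {b : ℝ} {v R v' R' : L2R} (h : LMaps b v R) (h' : LMaps b v' R') :
    LMaps b (v + v') (R + R') := by
  obtain ⟨hv, rfl⟩ := h
  obtain ⟨hv', rfl⟩ := h'
  exact ⟨add_mem hv hv', (L b).map_add ⟨v, hv⟩ ⟨v', hv'⟩⟩

theorem LMaps.smul {b : ℝ} {v R : L2R} (c : ℂ) (h : LMaps b v R) :
    LMaps b (c • v) (c • R) := by
  obtain ⟨hv, rfl⟩ := h
  exact ⟨Submodule.smul_mem _ c hv, (L b).map_smul c ⟨v, hv⟩⟩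

theorem LMaps.unique {b : ℝ} {v R R' : L2R} (h : LMaps b v R) (h' : LMaps b v R') : R = R' := by
  obtain ⟨hv, rfl⟩ := h
  obtain ⟨hv', rfl⟩ := h'
  rfl

theorem L_apply_ae (b : ℝ) (v : domL) :
    ∀ᵐ x, L b v x = weightedDeriv v x + ((4 - b) * (phi x * dphi x)) • (v : L2R) x
      + QFun b (v : L2R) x := by
  have e : L b v = weightedDeriv v + ((4 - b : ℝ) : ℂ) • mulOp (v : L2R) + Q b (v : L2R) := rfl
  rw [e]
  filter_upwards [Lp.coeFn_add (weightedDeriv v + ((4 - b : ℝ) : ℂ) • mulOp (v : L2R))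
      (Q b (v : L2R)), Lp.coeFn_add (weightedDeriv v) (((4 - b : ℝ) : ℂ) • mulOp (v : L2R)),
    Lp.coeFn_smul ((4 - b : ℝ) : ℂ) (mulOp (v : L2R)), (memLp_mulFun (v : L2R)).coeFn_toLp,
    (memLp_QFun b (v : L2R)).coeFn_toLp] with x h1 h2 h3 h4 h5
  have h4' : mulOp (v : L2R) x = mulFun (v : L2R) x := h4
  have h5' : Q b (v : L2R) x = QFun b (v : L2R) x := h5
  rw [h1, Pi.add_apply, h2, Pi.add_apply, h3, Pi.smul_apply, h4', h5']
  simp only [mulFun, Complex.real_smul, smul_eq_mul]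
  push_cast
  ring

theorem LMaps.of_ae {b : ℝ} {v g R : L2R} (h : IsWeightedDeriv v g)
    (hR : ∀ᵐ x, R x = g x + ((4 - b) * (phi x * dphi x)) • v x + QFun b v x) : LMaps b v R := by
  have hv : v ∈ domL := ⟨g, h⟩
  refine ⟨hv, Lp.ext ?_⟩
  have hg : weightedDeriv ⟨v, hv⟩ = g := (weightedDeriv_spec ⟨v, hv⟩).unique h
  filter_upwards [L_apply_ae b ⟨v, hv⟩, hR] with x h1 h2
  rw [hg, ← h2] at h1
  exact h1

theorem phi_of_nonneg {x : ℝ} (hx : 0 ≤ x) : phi x = Real.exp (-x) := by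
  rw [phi, abs_of_nonneg hx]

theorem phi_of_nonpos {x : ℝ} (hx : x ≤ 0) : phi x = Real.exp x := by
  rw [phi, abs_of_nonpos hx, neg_neg]

theorem dphi_of_pos {x : ℝ} (hx : 0 < x) : dphi x = -Real.exp (-x) := by
  rw [dphi, abs_of_pos hx, Real.sign_of_pos hx, neg_one_mul]

theorem dphi_of_neg {x : ℝ} (hx : x < 0) : dphi x = Real.exp x := by
  rw [dphi, abs_of_neg hx, Real.sign_of_neg hx, neg_neg, neg_neg, one_mul]

theorem continuous_phi : Continuous phi := by unfold phi; fun_prop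

theorem hasDerivAt_phi {x : ℝ} (hx : x ≠ 0) : HasDerivAt phi (dphi x) x := by
  rcases hx.lt_or_gt with h | h
  · rw [dphi_of_neg h]
    refine (Real.hasDerivAt_exp x).congr_of_eventuallyEq ?_
    filter_upwards [Iio_mem_nhds h] with y hy using phi_of_nonpos (le_of_lt hy)
  · rw [dphi_of_pos h]
    have : HasDerivAt (fun y : ℝ => Real.exp (-y)) (-Real.exp (-x)) x := by
      simpa using (hasDerivAt_neg x).exp
    refine this.congr_of_eventuallyEq ?_
    filter_upwards [Ioi_mem_nhds h] with y hy using phi_of_nonneg (le_of_lt hy)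

theorem hasDerivAt_one_sub_phi_sq {x : ℝ} (hx : x ≠ 0) :
    HasDerivAt (fun y => 1 - phi y ^ 2) (-(2 * phi x * dphi x)) x := by
  simpa using ((hasDerivAt_phi hx).pow 2).const_sub 1

/-- Integration by parts: a function that is differentiable off a countable set has the expected
weighted derivative as soon as `(1 - φ²) f` is continuous. No condition on `f` at the origin is
needed, as the weight vanishes there. -/
theorem isWeightedDeriv_toLp {f f' : ℝ → ℂ} {s : Set ℝ} (hs : s.Countable)
    (hf : MemLp f 2 volume) (hg : MemLp (fun x => (1 - phi x ^ 2) • f' x) 2 volume)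
    (hd : ∀ x ∉ s, HasDerivAt f (f' x) x) (hc : Continuous fun x => (1 - phi x ^ 2) • f x) :
    IsWeightedDeriv hf.toLp hg.toLp := by
  intro ψ hψ hψc
  have e1 : ∫ x, ψ x • (hg.toLp : L2R) x = ∫ x, ψ x • (1 - phi x ^ 2) • f' x := by
    refine integral_congr_ae ?_
    filter_upwards [hg.coeFn_toLp] with x hx
    rw [hx]
  have e2 : ∫ x, ((1 - phi x ^ 2) * deriv ψ x - 2 * phi x * dphi x * ψ x) • (hf.toLp : L2R) x =
      ∫ x, ((1 - phi x ^ 2) * deriv ψ x - 2 * phi x * dphi x * ψ x) • f x := by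
    refine integral_congr_ae ?_
    filter_upwards [hf.coeFn_toLp] with x hx
    rw [hx]
  have i1 : Integrable (fun x => ψ x • (1 - phi x ^ 2) • f' x) := by
    refine (integrable_smul_of_compact (memLp_test hψ hψc) hg.toLp).congr ?_
    filter_upwards [hg.coeFn_toLp] with x hx
    rw [hx]
  have i2 : Integrable
      (fun x => ((1 - phi x ^ 2) * deriv ψ x - 2 * phi x * dphi x * ψ x) • f x) := by
    refine (integrable_smul_of_compact (memLp_weighted_test hψ hψc) hf.toLp).congr ?_
    filter_upwards [hf.coeFn_toLp] with x hx
    rw [hx]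
  rw [e1, e2, ← add_eq_zero_iff_eq_neg, ← integral_add i1 i2]
  obtain ⟨r, hr0, hr⟩ := hψc.isCompact.isBounded.subset_ball_lt 0 (0 : ℝ)
  have hz : ∀ x, x ∉ Ioo (-r) r → ψ x = 0 := fun x hx => by
    refine image_eq_zero_of_notMem_tsupport fun h => hx ?_
    have := hr h
    rwa [Real.ball_eq_Ioo, zero_sub, zero_add] at this
  have hz' : ∀ x, x ∉ Ioo (-r) r → deriv ψ x = 0 := fun x hx => by
    refine image_eq_zero_of_notMem_tsupport fun h => hx ?_
    have := hr (tsupport_deriv_subset h)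
    rwa [Real.ball_eq_Ioo, zero_sub, zero_add] at this
  have hsub : Function.support (fun x => ψ x • (1 - phi x ^ 2) • f' x +
      ((1 - phi x ^ 2) * deriv ψ x - 2 * phi x * dphi x * ψ x) • f x) ⊆ Ioc (-r) r := by
    intro x hx
    by_contra h
    have h' : x ∉ Ioo (-r) r := fun h2 => h (Ioo_subset_Ioc_self h2)
    exact hx (by simp [hz x h', hz' x h'])
  rw [← intervalIntegral.integral_eq_integral_of_support_subset hsub,
    integral_eq_of_hasDerivAt_off_countable (fun x => ψ x • (1 - phi x ^ 2) • f x)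
      (fun x => ψ x • (1 - phi x ^ 2) • f' x +
        ((1 - phi x ^ 2) * deriv ψ x - 2 * phi x * dphi x * ψ x) • f x)
      (hs.union (countable_singleton 0)) (hψ.continuous.smul hc).continuousOn ?_
      (Integrable.intervalIntegrable (i1.add i2))]
  · simp [hz r (by simp), hz (-r) (by simp)]
  · rintro x ⟨-, hx⟩
    simp only [mem_union, mem_singleton_iff, not_or] at hx
    have h1 : HasDerivAt ψ (deriv ψ x) x :=
      ((hψ.differentiable (by simp)) x).hasDerivAt
    refine (h1.smul ((hasDerivAt_one_sub_phi_sq hx.2).smul (hd x hx.1))).congr_deriv ?_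
    simp only [Complex.real_smul, Pi.smul_apply']
    push_cast
    ring

/-- The two convolutions in `Q` cancel for `y` between `0` and `x`. Beyond the larger and below the
smaller of `0` and `x` they add up, and the exponentials separate. -/
theorem QFun_eq (b : ℝ) (v : L2R) (x : ℝ) :
    QFun b v x = (4 * (b - 3)) •
      (Real.exp (-x) • (∫ y in Iio (min x 0), Real.exp (3 * y) • v y)
        - Real.exp x • ∫ y in Ioi (max x 0), Real.exp (-3 * y) • v y) := by
  have i1 := integrable_kernel measurable_phi measurable_w1 abs_phi_le abs_w1_le v x
  have i2 := integrable_kernel measurable_dphi measurable_w2 abs_dphi_le abs_w2_le v x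
  have i3 : IntegrableOn (fun y => Real.exp (3 * y) • v y) (Iio (min x 0)) := by
    refine ((integrable_phi_norm v).integrableOn (s := Iio (min x 0))).mono'
      ((by fun_prop : Continuous fun y : ℝ => Real.exp (3 * y)).aestronglyMeasurable.smul
        (Lp.aestronglyMeasurable v).restrict) ?_
    refine (ae_restrict_iff' measurableSet_Iio).2 (Eventually.of_forall fun y hy => ?_)
    have hy0 : y < 0 := lt_of_lt_of_le hy (min_le_right _ _)
    rw [norm_smul, Real.norm_eq_abs, Real.abs_exp, phi_of_nonpos hy0.le]
    gcongr
    linarith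
  have i4 : IntegrableOn (fun y => Real.exp (-3 * y) • v y) (Ioi (max x 0)) := by
    refine ((integrable_phi_norm v).integrableOn (s := Ioi (max x 0))).mono'
      ((by fun_prop : Continuous fun y : ℝ => Real.exp (-3 * y)).aestronglyMeasurable.smul
        (Lp.aestronglyMeasurable v).restrict) ?_
    refine (ae_restrict_iff' measurableSet_Ioi).2 (Eventually.of_forall fun y hy => ?_)
    have hy0 : 0 < y := lt_of_le_of_lt (le_max_right _ _) hy
    rw [norm_smul, Real.norm_eq_abs, Real.abs_exp, phi_of_nonneg hy0.le]
    gcongr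
    linarith
  have i2' : Integrable (fun y => (2 : ℝ) • dphi (x - y) • phi y ^ 2 • v y) := i2.smul (2 : ℝ)
  rw [QFun, convolution_lsmul_swap, convolution_lsmul_swap, ← integral_smul (2 : ℝ),
    ← integral_sub i1 i2', mul_comm 4 (b - 3), mul_smul]
  congr 1
  have i3' : IntegrableOn (fun y => Real.exp (-x) • Real.exp (3 * y) • v y) (Iio (min x 0)) :=
    i3.smul (Real.exp (-x))
  have i4' : IntegrableOn (fun y => Real.exp x • Real.exp (-3 * y) • v y) (Ioi (max x 0)) :=
    i4.smul (Real.exp x)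
  rw [← integral_smul (Real.exp (-x)), ← integral_smul (Real.exp x),
    ← integral_indicator measurableSet_Iio, ← integral_indicator measurableSet_Ioi,
    ← integral_sub (i3'.integrable_indicator measurableSet_Iio)
      (i4'.integrable_indicator measurableSet_Ioi),
    ← integral_smul (4 : ℝ)]
  refine integral_congr_ae ?_
  filter_upwards [Measure.ae_ne volume 0, Measure.ae_ne volume x] with y hy0 hyx
  have key : ∀ c d e : ℝ, c * (2 * d) - 2 * (e * phi y ^ 2) =
      4 * ((Iio (min x 0)).indicator (fun y => Real.exp (-x) * Real.exp (3 * y)) y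
        - (Ioi (max x 0)).indicator (fun y => Real.exp x * Real.exp (-3 * y)) y) →
      c • (2 * d) • v y - (2 : ℝ) • e • phi y ^ 2 • v y = (4 : ℝ) •
        ((Iio (min x 0)).indicator (fun y => Real.exp (-x) • Real.exp (3 * y) • v y) y
        - (Ioi (max x 0)).indicator (fun y => Real.exp x • Real.exp (-3 * y) • v y) y) := by
    intro c d e h
    have e1 : (Iio (min x 0)).indicator (fun y => Real.exp (-x) • Real.exp (3 * y) • v y) y
        = (Iio (min x 0)).indicator (fun y => Real.exp (-x) * Real.exp (3 * y)) y • v y := by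
      by_cases hm : y ∈ Iio (min x 0) <;> simp [hm, mul_assoc]
    have e2 : (Ioi (max x 0)).indicator (fun y => Real.exp x • Real.exp (-3 * y) • v y) y
        = (Ioi (max x 0)).indicator (fun y => Real.exp x * Real.exp (-3 * y)) y • v y := by
      by_cases hm : y ∈ Ioi (max x 0) <;> simp [hm, mul_assoc]
    rw [e1, e2, ← sub_smul, smul_smul, smul_smul, smul_smul, smul_smul, ← sub_smul, ← h, mul_assoc]
  have key2 := key (phi (x - y)) (phi y * dphi y) (dphi (x - y))
  rw [← mul_assoc 2] at key2
  refine key2 ?_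
  have hE : ∀ p q : ℝ, Real.exp p * Real.exp q = Real.exp (p + q) := fun p q =>
    (Real.exp_add p q).symm
  have hE2 : ∀ p : ℝ, Real.exp p ^ 2 = Real.exp (2 * p) := fun p => by
    rw [sq, hE, two_mul]
  rcases hyx.lt_or_gt with h | h
  · rw [phi_of_nonneg (sub_pos.2 h).le, dphi_of_pos (sub_pos.2 h), indicator_of_notMem (s := Ioi _)
      (fun hm => absurd (lt_of_le_of_lt (le_max_left _ _) hm) h.le.not_gt)]
    rcases hy0.lt_or_gt with h0 | h0
    · rw [phi_of_nonpos h0.le, dphi_of_neg h0, indicator_of_mem (s := Iio (min x 0)) (lt_min h h0)]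
      have : Real.exp (-x) * Real.exp (3 * y) = Real.exp (-(x - y)) * Real.exp y ^ 2 := by
        rw [hE2, hE, hE]; ring_nf
      linear_combination -4 * this
    · rw [phi_of_nonneg h0.le, dphi_of_pos h0, indicator_of_notMem (s := Iio (min x 0))
        (fun hm => absurd (lt_of_lt_of_le hm (min_le_right _ _)) h0.le.not_gt)]
      ring
  · rw [phi_of_nonpos (sub_neg.2 h).le, dphi_of_neg (sub_neg.2 h), indicator_of_notMem (s := Iio _)
      (fun hm => absurd (lt_of_lt_of_le hm (min_le_left _ _)) h.le.not_gt)]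
    rcases hy0.lt_or_gt with h0 | h0
    · rw [phi_of_nonpos h0.le, dphi_of_neg h0, indicator_of_notMem (s := Ioi (max x 0))
        (fun hm => absurd (lt_of_le_of_lt (le_max_right _ _) hm) h0.le.not_gt)]
      ring
    · rw [phi_of_nonneg h0.le, dphi_of_pos h0, indicator_of_mem (s := Ioi (max x 0)) (max_lt h h0)]
      have : Real.exp x * Real.exp (-3 * y) = Real.exp (x - y) * Real.exp (-y) ^ 2 := by
        rw [hE2, hE, hE]; ring_nf
      linear_combination 4 * this

/-- `L` on a function that is differentiable off a countable set, in terms of pointwise data. -/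
theorem LMaps.of_hasDerivAt {b : ℝ} {v R : L2R} {f f' : ℝ → ℂ} {s : Set ℝ} (hs : s.Countable)
    (hv : v =ᵐ[volume] f) (hg : MemLp (fun x => (1 - phi x ^ 2) • f' x) 2 volume)
    (hd : ∀ x ∉ s, HasDerivAt f (f' x) x) (hc : Continuous fun x => (1 - phi x ^ 2) • f x)
    (h : ∀ᵐ x, R x = (1 - phi x ^ 2) • f' x + ((4 - b) * (phi x * dphi x)) • f x
      + (4 * (b - 3)) • (Real.exp (-x) • (∫ y in Iio (min x 0), Real.exp (3 * y) • f y)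
        - Real.exp x • ∫ y in Ioi (max x 0), Real.exp (-3 * y) • f y)) :
    LMaps b v R := by
  have hf : MemLp f 2 volume := (memLp_congr_ae hv).1 (Lp.memLp v)
  have hvf : v = hf.toLp := Lp.ext (hv.trans hf.coeFn_toLp.symm)
  refine LMaps.of_ae (g := hg.toLp) (hvf ▸ isWeightedDeriv_toLp hs hf hg hd hc) ?_
  filter_upwards [h, hv, hg.coeFn_toLp] with x h1 h2 h3
  have hi : ∀ (t : Set ℝ) (k : ℝ → ℝ), ∫ y in t, k y • v y = ∫ y in t, k y • f y := by
    intro t k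
    refine integral_congr_ae (ae_restrict_of_ae ?_)
    filter_upwards [hv] with y hy
    rw [hy]
  rw [h3, h2, h1, QFun_eq, hi, hi]

/-- Multiplication by the bounded weight `1 - φ²` preserves `L²`. -/
theorem memLp_weight_smul {f : ℝ → ℂ} (hf : MemLp f 2 volume) :
    MemLp (fun x => (1 - phi x ^ 2) • f x) 2 volume := by
  have hm : Measurable fun x => 1 - phi x ^ 2 := measurable_const.sub (measurable_phi.pow_const 2)
  refine hf.mono (hm.aestronglyMeasurable.smul hf.1) (Eventually.of_forall fun x => ?_)
  have h0 := phi_pos x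
  have h3 := phi_le_one x
  rw [norm_smul]
  refine mul_le_of_le_one_left (norm_nonneg _) ?_
  rw [Real.norm_eq_abs, abs_le]
  constructor <;> nlinarith

/-! ### The span of `φ` and `φ'` -/

/-- `e^{-x}` on the right half-line, `0` elsewhere. -/
noncomputable def posExp (x : ℝ) : ℝ := if 0 < x then Real.exp (-x) else 0

/-- `e^{x}` on the left half-line, `0` elsewhere. -/
noncomputable def negExp (x : ℝ) : ℝ := if x < 0 then Real.exp x else 0

theorem posExp_of_pos {x : ℝ} (hx : 0 < x) : posExp x = Real.exp (-x) := if_pos hx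

theorem posExp_of_nonpos {x : ℝ} (hx : x ≤ 0) : posExp x = 0 := if_neg hx.not_gt

theorem negExp_of_neg {x : ℝ} (hx : x < 0) : negExp x = Real.exp x := if_pos hx

theorem negExp_of_nonneg {x : ℝ} (hx : 0 ≤ x) : negExp x = 0 := if_neg hx.not_gt

theorem measurable_posExp : Measurable posExp :=
  Measurable.ite measurableSet_Ioi (by fun_prop) measurable_const

theorem measurable_negExp : Measurable negExp :=
  Measurable.ite measurableSet_Iio (by fun_prop) measurable_const

theorem abs_posExp_le (x : ℝ) : |posExp x| ≤ phi x := by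
  rcases lt_or_ge 0 x with h | h
  · rw [posExp_of_pos h, phi_of_nonneg h.le, Real.abs_exp]
  · rw [posExp_of_nonpos h, abs_zero]
    exact (phi_pos x).le

theorem abs_negExp_le (x : ℝ) : |negExp x| ≤ phi x := by
  rcases lt_or_ge x 0 with h | h
  · rw [negExp_of_neg h, phi_of_nonpos h.le, Real.abs_exp]
  · rw [negExp_of_nonneg h, abs_zero]
    exact (phi_pos x).le

/-- The right half of `φ` as an element of `L²(ℝ)`. -/
noncomputable def posExpL : L2R := (memLp_of_le_phi measurable_posExp abs_posExp_le).toLp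

/-- The left half of `φ` as an element of `L²(ℝ)`. -/
noncomputable def negExpL : L2R := (memLp_of_le_phi measurable_negExp abs_negExp_le).toLp

theorem coeFn_posExpL : posExpL =ᵐ[volume] fun x => (posExp x : ℂ) := MemLp.coeFn_toLp _

theorem coeFn_negExpL : negExpL =ᵐ[volume] fun x => (negExp x : ℂ) := MemLp.coeFn_toLp _

theorem phiL_eq : phiL = posExpL + negExpL := by
  refine Lp.ext ?_
  filter_upwards [Lp.coeFn_add posExpL negExpL, coeFn_posExpL, coeFn_negExpL,
    (memLp_of_le_phi measurable_phi fun x => (abs_of_pos (phi_pos x)).le).coeFn_toLp,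
    Measure.ae_ne volume 0] with x h1 h2 h3 h4 h5
  have h4' : phiL x = (phi x : ℂ) := h4
  rw [h1, Pi.add_apply, h2, h3, h4', ← Complex.ofReal_add]
  rcases h5.lt_or_gt with h | h
  · rw [posExp_of_nonpos h.le, negExp_of_neg h, phi_of_nonpos h.le, zero_add]
  · rw [posExp_of_pos h, negExp_of_nonneg h.le, phi_of_nonneg h.le, add_zero]

theorem dphiL_eq : dphiL = negExpL - posExpL := by
  refine Lp.ext ?_
  filter_upwards [Lp.coeFn_sub negExpL posExpL, coeFn_posExpL, coeFn_negExpL,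
    (memLp_of_le_phi measurable_dphi abs_dphi_le).coeFn_toLp,
    Measure.ae_ne volume 0] with x h1 h2 h3 h4 h5
  have h4' : dphiL x = (dphi x : ℂ) := h4
  rw [h1, Pi.sub_apply, h2, h3, h4', ← Complex.ofReal_sub]
  rcases h5.lt_or_gt with h | h
  · rw [posExp_of_nonpos h.le, negExp_of_neg h, dphi_of_neg h, sub_zero]
  · rw [posExp_of_pos h, negExp_of_nonneg h.le, dphi_of_pos h, zero_sub]

theorem integral_exp_smul_posExp {a : ℝ} (ha : 0 ≤ a) :
    ∫ y in Ioi a, Real.exp (-3 * y) • (posExp y : ℂ) = ((Real.exp (-4 * a) / 4 : ℝ) : ℂ) := by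
  have : ∫ y in Ioi a, Real.exp (-3 * y) • (posExp y : ℂ) =
      ∫ y in Ioi a, ((Real.exp (-4 * y) : ℝ) : ℂ) := by
    refine setIntegral_congr_fun measurableSet_Ioi fun y hy => ?_
    rw [posExp_of_pos (ha.trans_lt hy), Complex.real_smul, ← Complex.ofReal_mul, ← Real.exp_add]
    ring_nf
  rw [this, integral_complex_ofReal, integral_exp_mul_Ioi (by norm_num)]
  congr 1
  ring

theorem integral_exp_smul_negExp {a : ℝ} (ha : a ≤ 0) :
    ∫ y in Iio a, Real.exp (3 * y) • (negExp y : ℂ) = ((Real.exp (4 * a) / 4 : ℝ) : ℂ) := by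
  have : ∫ y in Iio a, Real.exp (3 * y) • (negExp y : ℂ) =
      ∫ y in Iio a, ((Real.exp (4 * y) : ℝ) : ℂ) := by
    refine setIntegral_congr_fun measurableSet_Iio fun y hy => ?_
    rw [negExp_of_neg (lt_of_lt_of_le hy ha), Complex.real_smul, ← Complex.ofReal_mul,
      ← Real.exp_add]
    ring_nf
  rw [this, integral_complex_ofReal, ← integral_Iic_eq_integral_Iio,
    integral_exp_mul_Iic (by norm_num)]

theorem setIntegral_smul_eq_zero {t : Set ℝ} {f : ℝ → ℂ} (k : ℝ → ℝ)
    (h : ∀ y ∈ t, f y = 0) : ∫ y in t, k y • f y = 0 :=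
  setIntegral_eq_zero_of_forall_eq_zero fun y hy => by rw [h y hy, smul_zero]

theorem lMaps_posExpL (b : ℝ) :
    LMaps b posExpL (-posExpL - ((b - 3 : ℝ) : ℂ) • negExpL) := by
  refine LMaps.of_hasDerivAt (f' := fun x => -(posExp x : ℂ)) (countable_singleton 0)
    coeFn_posExpL
    (memLp_weight_smul (memLp_of_le_phi measurable_posExp abs_posExp_le).neg) ?_ ?_ ?_
  · intro x hx
    rcases (show x ≠ 0 from hx).lt_or_gt with h | h
    · rw [posExp_of_nonpos h.le, Complex.ofReal_zero, neg_zero]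
      refine (hasDerivAt_const x (0 : ℂ)).congr_of_eventuallyEq ?_
      filter_upwards [Iio_mem_nhds h] with y hy
      rw [posExp_of_nonpos (le_of_lt hy), Complex.ofReal_zero]
    · rw [posExp_of_pos h, ← Complex.ofReal_neg]
      have : HasDerivAt (fun y : ℝ => Real.exp (-y)) (-Real.exp (-x)) x := by
        simpa using (hasDerivAt_neg x).exp
      refine this.ofReal_comp.congr_of_eventuallyEq ?_
      filter_upwards [Ioi_mem_nhds h] with y hy
      rw [posExp_of_pos hy]
  · have : (fun x => (1 - phi x ^ 2) • (posExp x : ℂ)) =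
        fun x => (((1 - phi (max x 0) ^ 2) * phi (max x 0) : ℝ) : ℂ) := by
      funext x
      rcases lt_or_ge 0 x with h | h
      · rw [max_eq_left h.le, posExp_of_pos h, ← phi_of_nonneg h.le, Complex.real_smul,
          Complex.ofReal_mul]
      · rw [max_eq_right h, posExp_of_nonpos h]
        simp [phi]
    rw [this]
    have := continuous_phi
    fun_prop
  · filter_upwards [Lp.coeFn_sub (-posExpL) (((b - 3 : ℝ) : ℂ) • negExpL),
      Lp.coeFn_neg posExpL, Lp.coeFn_smul ((b - 3 : ℝ) : ℂ) negExpL, coeFn_posExpL,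
      coeFn_negExpL, Measure.ae_ne volume 0] with x h1 h2 h3 h4 h5 h0
    rw [h1, Pi.sub_apply, h2, h3, Pi.neg_apply, Pi.smul_apply, h4, h5,
      integral_exp_smul_posExp (le_max_right x 0), setIntegral_smul_eq_zero _
        fun y hy => by
          rw [posExp_of_nonpos ((le_of_lt hy).trans (min_le_right _ _)), Complex.ofReal_zero]]
    simp only [Complex.real_smul, smul_eq_mul, smul_zero, zero_sub, ← Complex.ofReal_mul,
      ← Complex.ofReal_neg, ← Complex.ofReal_add, ← Complex.ofReal_sub, Complex.ofReal_inj]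
    rcases h0.lt_or_gt with h | h
    · rw [posExp_of_nonpos h.le, negExp_of_neg h, max_eq_right h.le]
      simp
      ring
    · rw [posExp_of_pos h, negExp_of_nonneg h.le, max_eq_left h.le, phi_of_nonneg h.le,
        dphi_of_pos h]
      have : Real.exp x * Real.exp (-4 * x) = Real.exp (-x) ^ 3 := by
        rw [← Real.exp_add, ← Real.exp_nat_mul]; push_cast; ring_nf
      linear_combination ((b - 3)) * this

theorem lMaps_negExpL (b : ℝ) :
    LMaps b negExpL (negExpL + ((b - 3 : ℝ) : ℂ) • posExpL) := by
  refine LMaps.of_hasDerivAt (f' := fun x => (negExp x : ℂ)) (countable_singleton 0)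
    coeFn_negExpL
    (memLp_weight_smul (memLp_of_le_phi measurable_negExp abs_negExp_le)) ?_ ?_ ?_
  · intro x hx
    rcases (show x ≠ 0 from hx).lt_or_gt with h | h
    · rw [negExp_of_neg h]
      refine (Real.hasDerivAt_exp x).ofReal_comp.congr_of_eventuallyEq ?_
      filter_upwards [Iio_mem_nhds h] with y hy
      rw [negExp_of_neg hy]
    · rw [negExp_of_nonneg h.le, Complex.ofReal_zero]
      refine (hasDerivAt_const x (0 : ℂ)).congr_of_eventuallyEq ?_
      filter_upwards [Ioi_mem_nhds h] with y hy
      rw [negExp_of_nonneg (le_of_lt hy), Complex.ofReal_zero]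
  · have : (fun x => (1 - phi x ^ 2) • (negExp x : ℂ)) =
        fun x => (((1 - phi (min x 0) ^ 2) * phi (min x 0) : ℝ) : ℂ) := by
      funext x
      rcases lt_or_ge x 0 with h | h
      · rw [min_eq_left h.le, negExp_of_neg h, ← phi_of_nonpos h.le, Complex.real_smul,
          Complex.ofReal_mul]
      · rw [min_eq_right h, negExp_of_nonneg h]
        simp [phi]
    rw [this]
    have := continuous_phi
    fun_prop
  · filter_upwards [Lp.coeFn_add (negExpL) (((b - 3 : ℝ) : ℂ) • posExpL),
      Lp.coeFn_smul ((b - 3 : ℝ) : ℂ) posExpL, coeFn_posExpL,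
      coeFn_negExpL, Measure.ae_ne volume 0] with x h1 h3 h4 h5 h0
    rw [h1, Pi.add_apply, h3, Pi.smul_apply, h4, h5,
      integral_exp_smul_negExp (min_le_right x 0), setIntegral_smul_eq_zero _
        fun y hy => by
          rw [negExp_of_nonneg ((le_max_right _ _).trans (le_of_lt hy)), Complex.ofReal_zero]]
    simp only [Complex.real_smul, smul_eq_mul, smul_zero, sub_zero, ← Complex.ofReal_mul,
      ← Complex.ofReal_add, Complex.ofReal_inj]
    rcases h0.lt_or_gt with h | h
    · rw [posExp_of_nonpos h.le, negExp_of_neg h, min_eq_left h.le, phi_of_nonpos h.le,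
        dphi_of_neg h]
      have : Real.exp (-x) * Real.exp (4 * x) = Real.exp x ^ 3 := by
        rw [← Real.exp_add, ← Real.exp_nat_mul]; push_cast; ring_nf
      linear_combination (-(b - 3)) * this
    · rw [posExp_of_pos h, negExp_of_nonneg h.le, min_eq_right h.le]
      simp
      ring

theorem lMaps_phiL (b : ℝ) : LMaps b phiL ((4 - b : ℂ) • dphiL) := by
  convert (lMaps_posExpL b).add (lMaps_negExpL b) using 1
  · exact phiL_eq
  · rw [dphiL_eq]
    push_cast
    module

theorem lMaps_dphiL (b : ℝ) : LMaps b dphiL ((b - 2 : ℂ) • phiL) := by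
  convert (lMaps_negExpL b).add ((lMaps_posExpL b).smul (-1)) using 1
  · rw [dphiL_eq]; module
  · rw [phiL_eq]
    push_cast
    module

/-- The two halves of `φ` are linearly independent. -/
theorem halves_eq_zero {c d : ℂ} (h : c • posExpL + d • negExpL = 0) : c = 0 ∧ d = 0 := by
  have h' : ∀ᵐ x, c * posExp x + d * negExp x = 0 := by
    filter_upwards [Lp.coeFn_add (c • posExpL) (d • negExpL), Lp.coeFn_smul c posExpL,
      Lp.coeFn_smul d negExpL, coeFn_posExpL, coeFn_negExpL,
      Lp.coeFn_zero ℂ 2 (volume : Measure ℝ)] with x h1 h2 h3 h4 h5 h6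
    rw [h, h6, Pi.add_apply, h2, h3, Pi.smul_apply, Pi.smul_apply, h4, h5] at h1
    exact h1.symm
  constructor
  · have : (volume.restrict (Ioi (0 : ℝ))) ≠ 0 := by simp
    have : NeBot (ae (volume.restrict (Ioi (0 : ℝ)))) := ae_neBot.2 this
    obtain ⟨x, h1, h2⟩ := ((ae_restrict_of_ae (s := Ioi (0 : ℝ)) h').and
      (ae_restrict_mem measurableSet_Ioi)).exists
    rw [posExp_of_pos h2, negExp_of_nonneg (le_of_lt h2)] at h1
    simpa using h1
  · have : (volume.restrict (Iio (0 : ℝ))) ≠ 0 := by simp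
    have : NeBot (ae (volume.restrict (Iio (0 : ℝ)))) := ae_neBot.2 this
    obtain ⟨x, h1, h2⟩ := ((ae_restrict_of_ae (s := Iio (0 : ℝ)) h').and
      (ae_restrict_mem measurableSet_Iio)).exists
    rw [negExp_of_neg h2, posExp_of_nonpos (le_of_lt h2)] at h1
    simpa using h1

theorem phi_dphi_eq_zero {α β : ℂ} (h : α • phiL + β • dphiL = 0) : α = 0 ∧ β = 0 := by
  have h1 : (α - β) • posExpL + (α + β) • negExpL = 0 := by
    rw [← h, phiL_eq, dphiL_eq]; module
  obtain ⟨h2, h3⟩ := halves_eq_zero h1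
  constructor
  · linear_combination (h2 + h3) / 2
  · linear_combination (h3 - h2) / 2

theorem inner_toLp_ofReal {f g : ℝ → ℝ} (hf : MemLp (fun x => (f x : ℂ)) 2 volume)
    (hg : MemLp (fun x => (g x : ℂ)) 2 volume) :
    inner ℂ (hf.toLp : L2R) (hg.toLp : L2R) = ((∫ x, f x * g x : ℝ) : ℂ) := by
  rw [L2.inner_def, ← integral_complex_ofReal]
  refine integral_congr_ae ?_
  filter_upwards [hf.coeFn_toLp, hg.coeFn_toLp] with x h1 h2
  rw [h1, h2]
  simp [mul_comm]

theorem inner_phiSqDphi_phi : inner ℂ phiSqDphiL phiL = 0 := by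
  rw [phiSqDphiL, phiL, inner_toLp_ofReal, Complex.ofReal_eq_zero]
  change ∫ x, phi x ^ 2 * dphi x * phi x = 0
  have h : ∀ x, phi (-x) ^ 2 * dphi (-x) * phi (-x) = -(phi x ^ 2 * dphi x * phi x) := by
    intro x
    have h1 : phi (-x) = phi x := by simp [phi]
    have h2 : dphi (-x) = -dphi x := by simp [dphi, Real.sign_neg]
    rw [h1, h2]
    ring
  have := integral_neg_eq_self (fun x => phi x ^ 2 * dphi x * phi x) volume
  simp only [h] at this
  rw [integral_neg] at this
  linarith

theorem inner_phiSqDphi_dphi : inner ℂ phiSqDphiL dphiL = 1 / 2 := by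
  rw [phiSqDphiL, dphiL, inner_toLp_ofReal]
  change ((∫ x, phi x ^ 2 * dphi x * dphi x : ℝ) : ℂ) = 1 / 2
  have h : ∫ x, phi x ^ 2 * dphi x * dphi x = ∫ x, Real.exp (-4 * |x|) := by
    refine integral_congr_ae ?_
    filter_upwards [Measure.ae_ne volume 0] with x h0
    have : Real.exp (-4 * |x|) = phi x ^ 4 := by
      rw [phi, ← Real.exp_nat_mul]; push_cast; ring_nf
    rw [this]
    have h1 : dphi x = phi x ∨ dphi x = -phi x := by
      rcases h0.lt_or_gt with h | h
      · left; rw [dphi_of_neg h, phi_of_nonpos h.le]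
      · right; rw [dphi_of_pos h, phi_of_nonneg h.le]
    rcases h1 with h1 | h1 <;> rw [h1] <;> ring
  rw [h, integral_comp_abs (f := fun y => Real.exp (-4 * y)), integral_exp_mul_Ioi (by norm_num)]
  norm_num

/-! ### Modulation and growth -/

/-- Variation of constants for a linear equation with constant coefficients. -/
theorem exists_hasDerivAt_linear {E : Type*} [NormedAddCommGroup E] [NormedSpace ℂ E]
    [CompleteSpace E] (A : E →L[ℂ] E) {f : ℝ → E} (hf : Continuous f) :
    ∃ u : ℝ → E, ∀ t, HasDerivAt u (A (u t) + f t) t := by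
  have hd : ∀ t : ℝ, HasDerivAt (fun s : ℝ => NormedSpace.exp (s • A))
      (A * NormedSpace.exp (t • A)) t := fun t => hasDerivAt_exp_smul_const' A t
  have hcont : Continuous fun s : ℝ => NormedSpace.exp ((-s) • A) := by
    have : Continuous fun s : ℝ => NormedSpace.exp (s • A) :=
      continuous_iff_continuousAt.2 fun t => (hd t).continuousAt
    exact this.comp continuous_neg
  have hinv : ∀ t : ℝ, NormedSpace.exp (t • A) * NormedSpace.exp ((-t) • A) = 1 := fun t => by
    let : NormedAlgebra ℚ (E →L[ℂ] E) := NormedAlgebra.restrictScalars ℚ ℂ _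
    rw [← NormedSpace.exp_add_of_commute]
    · rw [← add_smul, add_neg_cancel, zero_smul, NormedSpace.exp_zero]
    · exact ((Commute.refl A).smul_left t).smul_right (-t)
  refine ⟨fun t => NormedSpace.exp (t • A) (∫ s in (0 : ℝ)..t, NormedSpace.exp ((-s) • A) (f s)),
    fun t => ?_⟩
  have h1 : HasDerivAt (fun t => ∫ s in (0 : ℝ)..t, NormedSpace.exp ((-s) • A) (f s))
      (NormedSpace.exp ((-t) • A) (f t)) t := (hcont.clm_apply hf).integral_hasStrictDerivAt 0 t
      |>.hasDerivAt
  have h2 : HasDerivAt (fun s : ℝ => (NormedSpace.exp (s • A)).restrictScalars ℝ)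
      ((A * NormedSpace.exp (t • A)).restrictScalars ℝ) t :=
    (ContinuousLinearMap.restrictScalarsL ℂ E E ℝ ℝ).hasFDerivAt.comp_hasDerivAt t (hd t)
  refine (h2.clm_apply h1).congr_deriv ?_
  have h3 := congrArg (fun B : E →L[ℂ] E => B (f t)) (hinv t)
  simp only [mul_apply_eq_comp, one_apply_eq_self] at h3
  simp only [ContinuousLinearMap.coe_restrictScalars', mul_apply_eq_comp, h3]

theorem exists_hasDerivAt_system (p q : ℂ) {f g : ℝ → ℂ} (hf : Continuous f) (hg : Continuous g) :
    ∃ α β : ℝ → ℂ, (∀ t, HasDerivAt α (p * β t + f t) t) ∧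
      ∀ t, HasDerivAt β (q * α t + g t) t := by
  obtain ⟨u, hu⟩ := exists_hasDerivAt_linear
    ((p • ContinuousLinearMap.snd ℂ ℂ ℂ).prod (q • ContinuousLinearMap.fst ℂ ℂ ℂ))
    (hf.prodMk hg)
  refine ⟨fun t => (u t).1, fun t => (u t).2, fun t => ?_, fun t => ?_⟩
  · exact (ContinuousLinearMap.fst ℝ ℂ ℂ).hasFDerivAt.comp_hasDerivAt t (hu t)
  · exact (ContinuousLinearMap.snd ℝ ℂ ℂ).hasFDerivAt.comp_hasDerivAt t (hu t)

theorem exists_solvesModulation (b : ℝ) {z : ℝ → L2R} (hz : Continuous z) :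
    ∃ α β : ℝ → ℂ, SolvesModulation b z α β := by
  obtain ⟨α, β, h1, h2⟩ := exists_hasDerivAt_system (4 - b) (4 - b)
    (f := fun t => -(4 * (b - 3) * inner ℂ phiSqDphiL (z t))) (g := fun _ => 0)
    (by fun_prop) continuous_const
  refine ⟨α, β, fun t => ?_, fun t => ?_⟩
  · simpa only [sub_eq_add_neg] using h1 t
  · simpa only [add_zero] using h2 t

/-- A curve that is continuous together with its image under `L`, and that is differentiable with
continuous derivative, belongs to `Y`. -/
theorem inY_of_lMaps {b : ℝ} {v v' R : ℝ → L2R} (hL : ∀ t, LMaps b (v t) (R t))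
    (hR : Continuous R) (hv : ∀ t, HasDerivAt v (v' t) t) (hv' : Continuous v') : InY b v := by
  refine ⟨⟨fun t => (hL t).1, continuous_iff_continuousAt.2 fun t => (hv t).continuousAt, ?_⟩, ?_⟩
  · exact hR.congr fun t => ((hL t).2).symm
  · rw [contDiff_one_iff_deriv]
    refine ⟨fun t => (hv t).differentiableAt, ?_⟩
    rw [show deriv v = v' from funext fun t => (hv t).deriv]
    exact hv'

theorem SolvesEvolution.lMaps {b : ℝ} {z : ℝ → L2R} (h : SolvesEvolution b z) :
    ∃ R : ℝ → L2R, Continuous R ∧ ∀ t, LMaps b (z t) (R t) ∧ HasDerivAt z (R t) t := by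
  obtain ⟨⟨⟨hd, hc, hcL⟩, -⟩, hz⟩ := h
  refine ⟨_, hcL, fun t => ⟨⟨hd t, rfl⟩, ?_⟩⟩
  obtain ⟨_, h⟩ := hz t
  exact h

theorem solvesEvolution_of_lMaps {b : ℝ} {z R : ℝ → L2R} (hR : Continuous R)
    (h : ∀ t, LMaps b (z t) (R t) ∧ HasDerivAt z (R t) t) : SolvesEvolution b z := by
  refine ⟨inY_of_lMaps (fun t => (h t).1) hR (fun t => (h t).2) hR, fun t => ?_⟩
  obtain ⟨⟨hd, e⟩, h2⟩ := h t
  exact ⟨hd, by rw [e]; exact h2⟩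

/-- A solution of the evolution equation, corrected by a solution of the modulation system, solves
the weak linearization. This rests on `L φ = (4 - b) φ'`, `L φ' = (b - 2) φ`, `⟨φ² φ', φ⟩ = 0` and
`⟨φ² φ', φ'⟩ = 1/2`. -/
theorem SolvesEvolution.solvesLinearization {b : ℝ} {z : ℝ → L2R} {α β : ℝ → ℂ}
    (hz : SolvesEvolution b z) (hm : SolvesModulation b z α β) :
    SolvesLinearization b (fun t => z t + α t • phiL + β t • dphiL) := by
  obtain ⟨R, hR, h⟩ := hz.lMaps
  have hzc : Continuous z := continuous_iff_continuousAt.2 fun t => (h t).2.continuousAt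
  have hα : Continuous α := continuous_iff_continuousAt.2 fun t => (hm.1 t).continuousAt
  have hβ : Continuous β := continuous_iff_continuousAt.2 fun t => (hm.2 t).continuousAt
  have hL : ∀ t, LMaps b (z t + α t • phiL + β t • dphiL)
      (R t + α t • (4 - b : ℂ) • dphiL + β t • (b - 2 : ℂ) • phiL) := fun t =>
    ((h t).1.add ((lMaps_phiL b).smul (α t))).add ((lMaps_dphiL b).smul (β t))
  have hd : ∀ t, HasDerivAt (fun t => z t + α t • phiL + β t • dphiL)
      (R t + ((4 - b) * β t - 4 * (b - 3) * inner ℂ phiSqDphiL (z t)) • phiL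
        + ((4 - b) * α t) • dphiL) t := fun t =>
    (((h t).2).add ((hm.1 t).smul_const phiL)).add ((hm.2 t).smul_const dphiL)
  refine ⟨inY_of_lMaps hL (by fun_prop) hd (by fun_prop), fun t => ?_⟩
  obtain ⟨hd', e⟩ := hL t
  refine ⟨hd', (hd t).congr_deriv ?_⟩
  rw [e, inner_add_right, inner_add_right, inner_smul_right, inner_smul_right,
    inner_phiSqDphi_phi, inner_phiSqDphi_dphi]
  module

/-- The uniqueness clause in linear stability makes the bound apply to the given solution. -/
theorem linearlyUnstable_of_growth {b γ : ℝ} {v : ℝ → L2R} (hγ : 0 < γ)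
    (hv : SolvesLinearization b v) (hg : GrowsExponentially γ v) : LinearlyUnstable b := by
  intro hs
  obtain ⟨C, -, u, -, huniq, hbd⟩ := hs (v 0) (hv.1.1.1 0)
  have hvu : v = u := huniq v hv rfl
  subst hvu
  obtain ⟨c, hc, hgr⟩ := hg
  have h1 : Tendsto (fun t : ℝ => c * Real.exp (γ * t)) atTop atTop :=
    (Real.tendsto_exp_atTop.comp (tendsto_id.const_mul_atTop hγ)).const_mul_atTop hc
  obtain ⟨t, ht, ht0⟩ := ((h1.eventually_gt_atTop (C * ‖v 0‖)).and (eventually_gt_atTop 0)).exists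
  exact absurd (hbd t ht0) (not_le.2 (ht.trans_le (hgr t ht0.le)))

/-- The mode `e^{|b - 4| t} (φ + s φ')`, where `s` is the sign of `4 - b`. -/
theorem exists_growing_modulation (b : ℝ) :
    ∃ α β : ℝ → ℂ, SolvesModulation b (fun _ => 0) α β ∧
      SolvesLinearization b (fun t => α t • phiL + β t • dphiL) ∧
      GrowsExponentially |b - 4| (fun t => α t • phiL + β t • dphiL) := by
  obtain ⟨s, hs, hs2⟩ : ∃ s : ℝ, s * (4 - b) = |b - 4| ∧ s * s = 1 := by
    rcases abs_choice (b - 4) with h | h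
    · exact ⟨-1, by rw [h]; ring, by ring⟩
    · exact ⟨1, by rw [h]; ring, by ring⟩
  have hs' : s * |b - 4| = 4 - b := by rw [← hs, ← mul_assoc, hs2, one_mul]
  have hexp : ∀ t : ℝ, HasDerivAt (fun t : ℝ => ((Real.exp (|b - 4| * t) : ℝ) : ℂ))
      ((|b - 4| : ℝ) * (Real.exp (|b - 4| * t) : ℝ) : ℂ) t := fun t => by
    have h1 : HasDerivAt (fun t => |b - 4| * t) |b - 4| t := by
      simpa using (hasDerivAt_id t).const_mul |b - 4|
    refine h1.exp.ofReal_comp.congr_deriv ?_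
    push_cast
    ring
  have hsC : (s : ℂ) * (4 - b) = (|b - 4| : ℝ) := by rw [← hs]; push_cast; ring
  have hsC' : (s : ℂ) * (|b - 4| : ℝ) = 4 - b := by rw [← Complex.ofReal_mul, hs']; push_cast; ring
  have hm : SolvesModulation b (fun _ => 0) (fun t : ℝ => (Real.exp (|b - 4| * t) : ℂ))
      (fun t : ℝ => s * (Real.exp (|b - 4| * t) : ℝ)) := by
    refine ⟨fun t => (hexp t).congr_deriv ?_, fun t => ((hexp t).const_mul (s : ℂ)).congr_deriv ?_⟩
    · rw [inner_zero_right, ← hsC]; ring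
    · rw [← mul_assoc, hsC']
  have h0 : SolvesEvolution b (fun _ => 0) :=
    solvesEvolution_of_lMaps (R := fun _ => 0) continuous_const fun t =>
      ⟨by simpa using (lMaps_phiL b).smul 0, hasDerivAt_const t _⟩
  refine ⟨_, _, hm, ?_, ?_⟩
  · simpa only [zero_add] using h0.solvesLinearization hm
  · refine ⟨‖phiL + (s : ℂ) • dphiL‖, norm_pos_iff.2 fun h => ?_, fun t _ => ?_⟩
    · have := (phi_dphi_eq_zero (α := 1) (β := s) (by rwa [one_smul])).1
      exact one_ne_zero this
    · have : ((Real.exp (|b - 4| * t) : ℝ) : ℂ) • phiL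
          + ((s : ℂ) * (Real.exp (|b - 4| * t) : ℝ)) • dphiL
          = ((Real.exp (|b - 4| * t) : ℝ) : ℂ) • (phiL + (s : ℂ) • dphiL) := by module
      simp only [this, norm_smul, Complex.norm_real, Real.norm_eq_abs, Real.abs_exp]
      rw [mul_comm]

/-! ### Functions on a half-line -/

/-- The value of `1 - φ²` at distance `s ≥ 0` from the peak. -/
noncomputable def gap (s : ℝ) : ℝ := 1 - Real.exp (-2 * s)

theorem gap_pos {s : ℝ} (hs : 0 < s) : 0 < gap s := by
  rw [gap, sub_pos, Real.exp_lt_one_iff]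
  linarith

theorem gap_zero : gap 0 = 0 := by simp [gap]

theorem gap_le_one (s : ℝ) : gap s ≤ 1 := by
  have := Real.exp_pos (-2 * s)
  rw [gap]
  linarith

theorem continuous_gap : Continuous gap := by unfold gap; fun_prop

theorem hasDerivAt_exp_const_mul (c s : ℝ) :
    HasDerivAt (fun s => Real.exp (c * s)) (c * Real.exp (c * s)) s := by
  have h1 : HasDerivAt (fun s => c * s) c s := by simpa using (hasDerivAt_id s).const_mul c
  exact h1.exp.congr_deriv (mul_comm _ _)

theorem hasDerivAt_gap (s : ℝ) : HasDerivAt gap (2 * Real.exp (-2 * s)) s :=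
  ((hasDerivAt_exp_const_mul (-2) s).const_sub 1).congr_deriv (by ring)

theorem tendsto_exp_neg_mul {c : ℝ} (hc : 0 < c) :
    Tendsto (fun s : ℝ => Real.exp (-c * s)) atTop (𝓝 0) :=
  Real.tendsto_exp_atBot.comp (tendsto_id.const_mul_atTop_of_neg (neg_lt_zero.2 hc))

theorem tendsto_gap : Tendsto gap atTop (𝓝 1) := by
  have := (tendsto_exp_neg_mul two_pos).const_sub 1
  rwa [sub_zero] at this

theorem one_sub_phi_sq (x : ℝ) : 1 - phi x ^ 2 = gap |x| := by
  rw [phi, gap, ← Real.exp_nat_mul]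
  push_cast
  ring_nf

theorem one_le_gap_rpow {s r : ℝ} (hs : 0 < s) (hr : r ≤ 0) : 1 ≤ gap s ^ r :=
  Real.one_le_rpow_of_pos_of_le_one_of_nonpos (gap_pos hs) (gap_le_one s) hr

theorem gap_rpow_le_one {s r : ℝ} (hs : 0 < s) (hr : 0 ≤ r) : gap s ^ r ≤ 1 :=
  Real.rpow_le_one (gap_pos hs).le (gap_le_one s) hr

theorem gap_rpow_anti {s p r : ℝ} (hs : 0 < s) (hr : p ≤ r) : gap s ^ r ≤ gap s ^ p :=
  Real.rpow_le_rpow_of_exponent_ge (gap_pos hs) (gap_le_one s) hr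

theorem gap_rpow_add_one {s : ℝ} (hs : 0 < s) (r : ℝ) : gap s ^ (r + 1) = gap s * gap s ^ r := by
  rw [Real.rpow_add_one (gap_pos hs).ne', mul_comm]

theorem hasDerivAt_gap_rpow {s : ℝ} (hs : 0 < s) (r : ℝ) :
    HasDerivAt (fun s => gap s ^ r) (2 * r * Real.exp (-2 * s) * gap s ^ (r - 1)) s := by
  refine ((hasDerivAt_gap s).rpow_const (p := r) (Or.inl (gap_pos hs).ne')).congr_deriv ?_
  ring

/-- Writing `1 = gap + e^{-2 s}` splits the integrand into a part bounded by `e^{-a s}` and a part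
bounded by the derivative of `gap^{r + 1} / (2 (r + 1))`. -/
theorem integrableOn_exp_mul_gap_rpow {a r : ℝ} (ha : 0 < a) (hr : -1 < r) :
    IntegrableOn (fun s => Real.exp (-a * s) * gap s ^ r) (Ioi 0) := by
  have hr1 : 0 < r + 1 := by linarith
  have h1 : IntegrableOn (fun s => Real.exp (-2 * s) * gap s ^ r) (Ioi 0) := by
    refine integrableOn_Ioi_deriv_of_nonneg (g := fun s => gap s ^ (r + 1) / (2 * (r + 1)))
      (l := 1 / (2 * (r + 1))) ?_ ?_ ?_ ?_
    · exact ((continuous_gap.rpow_const fun _ => Or.inr hr1.le).div_const _).continuousWithinAt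
    · intro s hs
      refine ((hasDerivAt_gap_rpow hs (r + 1)).div_const _).congr_deriv ?_
      rw [add_sub_cancel_right]
      field_simp
    · intro s hs
      have := gap_pos hs
      positivity
    · have := (tendsto_gap.rpow_const (p := r + 1) (Or.inl one_ne_zero)).div_const (2 * (r + 1))
      rwa [Real.one_rpow] at this
  have h2 : IntegrableOn (fun s => Real.exp (-a * s)) (Ioi 0) :=
    integrableOn_exp_mul_Ioi (neg_lt_zero.2 ha) 0
  refine (h2.add h1).mono' ?_ ?_
  · have hm : Measurable gap := continuous_gap.measurable
    have : Measurable fun s => Real.exp (-a * s) * gap s ^ r := by fun_prop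
    exact this.aestronglyMeasurable
  · refine (ae_restrict_iff' measurableSet_Ioi).2 (Eventually.of_forall fun s hs => ?_)
    have h0 : 0 < gap s := gap_pos hs
    have h3 : 0 ≤ gap s ^ r := Real.rpow_nonneg h0.le _
    have h4 : Real.exp (-a * s) ≤ 1 := Real.exp_le_one_iff.2 (by nlinarith [show 0 < s from hs])
    have h5 := gap_rpow_le_one hs hr1.le
    have h6 := gap_rpow_add_one hs r
    have h7 : gap s ^ r = gap s ^ (r + 1) + Real.exp (-2 * s) * gap s ^ r := by
      rw [h6, gap]; ring
    rw [Real.norm_eq_abs, abs_of_nonneg (by positivity)]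
    simp only [Pi.add_apply]
    have h8 : 0 ≤ Real.exp (-2 * s) * gap s ^ r := by positivity
    calc Real.exp (-a * s) * gap s ^ r
        = Real.exp (-a * s) * gap s ^ (r + 1)
          + Real.exp (-a * s) * (Real.exp (-2 * s) * gap s ^ r) := by
          rw [← mul_add, ← h7]
      _ ≤ _ := add_le_add (mul_le_of_le_one_right (Real.exp_pos _).le h5)
          (mul_le_of_le_one_left h8 h4)

theorem memLp_indicator_Ioi {f : ℝ → ℂ} {C a r : ℝ} (hf : ContinuousOn f (Ioi 0)) (ha : 0 < a)
    (hr : -(1 / 2) < r) (hb : ∀ s, 0 < s → ‖f s‖ ≤ C * (Real.exp (-a * s) * gap s ^ r)) :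
    MemLp ((Ioi 0).indicator f) 2 volume := by
  have hm : AEStronglyMeasurable ((Ioi 0).indicator f) volume :=
    (aestronglyMeasurable_indicator_iff measurableSet_Ioi).2
      (hf.aestronglyMeasurable measurableSet_Ioi)
  rw [memLp_two_iff_integrable_sq_norm hm]
  have h1 : IntegrableOn (fun s => C ^ 2 * (Real.exp (-(2 * a) * s) * gap s ^ (r + r))) (Ioi 0) :=
    (integrableOn_exp_mul_gap_rpow (by linarith) (by linarith)).const_mul _
  refine (h1.integrable_indicator measurableSet_Ioi).mono' (hm.norm.pow 2)
    (Eventually.of_forall fun s => ?_)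
  by_cases hs : s ∈ Ioi (0 : ℝ)
  · rw [indicator_of_mem hs, indicator_of_mem hs, Real.norm_eq_abs, abs_of_nonneg (by positivity),
      Real.rpow_add (gap_pos hs),
      show -(2 * a) * s = -a * s + -a * s by ring, Real.exp_add]
    calc ‖f s‖ ^ 2 ≤ (C * (Real.exp (-a * s) * gap s ^ r)) ^ 2 :=
          pow_le_pow_left₀ (norm_nonneg _) (hb s hs) 2
      _ = _ := by ring
  · rw [indicator_of_notMem hs, indicator_of_notMem hs]
    simp

theorem hasDerivAt_integral_Ioi {f : ℝ → ℂ} (hf : ContinuousOn f (Ioi 0))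
    (hi : ∀ s, 0 < s → IntegrableOn f (Ioi s)) {s : ℝ} (hs : 0 < s) :
    HasDerivAt (fun s => ∫ y in Ioi s, f y) (-f s) s := by
  have h1 : HasDerivAt (fun t => ∫ y in (1 : ℝ)..t, f y) (f s) s := by
    refine intervalIntegral.integral_hasDerivAt_right ?_ ?_ (hf.continuousAt (Ioi_mem_nhds hs))
    · exact (hf.mono fun y hy => (lt_min one_pos hs).trans_le hy.1).intervalIntegrable
    · exact hf.stronglyMeasurableAtFilter isOpen_Ioi s hs
  have h2 := h1.const_sub (∫ y in Ioi (1 : ℝ), f y)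
  refine h2.congr_of_eventuallyEq ?_
  filter_upwards [Ioi_mem_nhds hs] with t ht
  rw [← intervalIntegral.integral_interval_add_Ioi (hi 1 one_pos) (hi t ht)]
  ring

/-! ### Eigenfunctions of `L` -/

/-- The function `e^{-λ s} (1 - e^{-2 s})^{-(λ + b) / 2}`, which solves the local equation
`(1 - e^{-2 s}) m' + b e^{-2 s} m = -λ m` satisfied by `m = f - f''` when `f` is an eigenfunction
of the half-line part of `L`. -/
noncomputable def momentum (b : ℝ) (l : ℂ) (s : ℝ) : ℂ :=
  Complex.exp (-l * s - (l + b) / 2 * (Real.log (gap s) : ℝ))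

theorem momentum_ne_zero (b : ℝ) (l : ℂ) (s : ℝ) : momentum b l s ≠ 0 := Complex.exp_ne_zero _

theorem hasDerivAt_momentum (b : ℝ) (l : ℂ) {s : ℝ} (hs : 0 < s) :
    HasDerivAt (momentum b l)
      (momentum b l s * (-l - (l + b) * (Real.exp (-2 * s) : ℝ) / (gap s : ℝ))) s := by
  have h1 : HasDerivAt (fun s => ((Real.log (gap s) : ℝ) : ℂ))
      ((2 * Real.exp (-2 * s) / gap s : ℝ) : ℂ) s :=
    ((hasDerivAt_gap s).log (gap_pos hs).ne').ofReal_comp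
  have h2 : HasDerivAt (fun s : ℝ => (-l * s : ℂ)) (-l) s := by
    simpa using (Complex.ofRealCLM.hasDerivAt (x := s)).const_mul (-l)
  refine ((h2.sub (h1.const_mul ((l + b) / 2))).cexp).congr_deriv ?_
  simp only [momentum, Pi.sub_apply]
  push_cast
  ring

theorem norm_momentum (b : ℝ) (l : ℂ) {s : ℝ} (hs : 0 < s) :
    ‖momentum b l s‖ = Real.exp (-l.re * s) * gap s ^ (-((l.re + b) / 2)) := by
  rw [momentum, Complex.norm_exp, Real.rpow_def_of_pos (gap_pos hs), ← Real.exp_add]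
  congr 1
  simp [Complex.mul_re]
  ring

theorem norm_momentum_le {b : ℝ} {l : ℂ} {a τ : ℝ} (ha : a ≤ l.re) (hτ : (l.re + b) / 2 ≤ τ)
    {s : ℝ} (hs : 0 < s) : ‖momentum b l s‖ ≤ Real.exp (-a * s) * gap s ^ (-τ) := by
  rw [norm_momentum b l hs]
  have := gap_rpow_anti hs (neg_le_neg hτ)
  have h0 := gap_pos hs
  gcongr

theorem continuousOn_momentum (b : ℝ) (l : ℂ) : ContinuousOn (momentum b l) (Ioi 0) :=
  fun _ hs => (hasDerivAt_momentum b l hs).continuousAt.continuousWithinAt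

theorem tendsto_exp_mul_gap_rpow {a : ℝ} (ha : 0 < a) (r : ℝ) :
    Tendsto (fun s => Real.exp (-a * s) * gap s ^ r) atTop (𝓝 0) := by
  have := (tendsto_exp_neg_mul ha).mul (tendsto_gap.rpow_const (p := r) (Or.inl one_ne_zero))
  rwa [zero_mul] at this

/-- A decaying primitive `K` of `-e^{-s} m`, with a bound whose derivative
dominates `e^{-s} |m|` in absolute value. -/
theorem exists_primitive_momentum {b : ℝ} {l : ℂ} {a τ : ℝ} (ha0 : 0 < a) (ha : a ≤ l.re)
    (hτ : (l.re + b) / 2 ≤ τ) (hτ2 : 2 < τ) :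
    ∃ K : ℝ → ℂ, (∀ s, 0 < s → HasDerivAt K (-((Real.exp (-s) : ℝ) * momentum b l s)) s) ∧
      ∀ s, 0 < s → ‖K s‖ ≤ Real.exp (-(1 + a) * s) * gap s ^ (1 - τ) := by
  set B : ℝ → ℝ := fun s => Real.exp (-(1 + a) * s) * gap s ^ (1 - τ) with hB
  set B' : ℝ → ℝ := fun s => -(Real.exp (-(1 + a) * s) * gap s ^ (-τ) *
    ((1 + a) * gap s + 2 * (τ - 1) * Real.exp (-2 * s))) with hB'
  have hBd : ∀ s, 0 < s → HasDerivAt B (B' s) s := fun s hs => by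
    refine ((hasDerivAt_exp_const_mul (-(1 + a)) s).mul
      (hasDerivAt_gap_rpow hs (1 - τ))).congr_deriv ?_
    have h1 := gap_rpow_add_one hs (-τ)
    rw [show -τ + 1 = 1 - τ by ring] at h1
    rw [h1, show 1 - τ - 1 = -τ by ring, hB']
    ring
  have hle : ∀ s, 0 < s → ‖((Real.exp (-s) : ℝ) : ℂ) * momentum b l s‖ ≤ -B' s := fun s hs => by
    have h0 := gap_pos hs
    have h1 := Real.exp_pos (-2 * s)
    have h2 : 1 ≤ (1 + a) * gap s + 2 * (τ - 1) * Real.exp (-2 * s) := by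
      have : gap s + Real.exp (-2 * s) = 1 := by rw [gap]; ring
      nlinarith
    rw [norm_mul, Complex.norm_real, Real.norm_eq_abs, Real.abs_exp]
    calc Real.exp (-s) * ‖momentum b l s‖
        ≤ Real.exp (-s) * (Real.exp (-a * s) * gap s ^ (-τ)) := by
          gcongr
          exact norm_momentum_le ha hτ hs
      _ = Real.exp (-(1 + a) * s) * gap s ^ (-τ) * 1 := by
          rw [← mul_assoc, ← Real.exp_add, mul_one]; ring_nf
      _ ≤ _ := by
          rw [hB', neg_neg]
          gcongr
  have hB0 : Tendsto B atTop (𝓝 0) := tendsto_exp_mul_gap_rpow (by linarith) _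
  have hneg : ∀ s, 0 < s → B' s ≤ 0 := fun s hs => by
    have := (norm_nonneg _).trans (hle s hs)
    linarith
  have hint : ∀ s, 0 < s → IntegrableOn B' (Ioi s) := fun s hs =>
    integrableOn_Ioi_deriv_of_nonpos' (fun x hx => hBd x (hs.trans_le hx))
      (fun x hx => hneg x (hs.trans hx)) hB0
  have hc : ContinuousOn (fun s => ((Real.exp (-s) : ℝ) : ℂ) * momentum b l s) (Ioi 0) :=
    (by fun_prop : Continuous fun s : ℝ => ((Real.exp (-s) : ℝ) : ℂ)).continuousOn.mul
      (continuousOn_momentum b l)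
  have hbd : ∀ s, 0 < s → ∀ᵐ y ∂(volume.restrict (Ioi s)),
      ‖((Real.exp (-y) : ℝ) : ℂ) * momentum b l y‖ ≤ -B' y := fun s hs =>
    (ae_restrict_iff' measurableSet_Ioi).2 (Eventually.of_forall fun y hy => hle y (hs.trans hy))
  have hi : ∀ s, 0 < s → IntegrableOn (fun s => ((Real.exp (-s) : ℝ) : ℂ) * momentum b l s)
      (Ioi s) := fun s hs =>
    (hint s hs).neg.mono' ((hc.mono (Ioi_subset_Ioi hs.le)).aestronglyMeasurable measurableSet_Ioi)
      (hbd s hs)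
  refine ⟨fun s => ∫ y in Ioi s, ((Real.exp (-y) : ℝ) : ℂ) * momentum b l y,
    fun s hs => hasDerivAt_integral_Ioi hc hi hs, fun s hs => ?_⟩
  refine (norm_integral_le_of_norm_le (hint s hs).neg (hbd s hs)).trans (le_of_eq ?_)
  have := integral_Ioi_of_hasDerivAt_of_nonpos' (fun x hx => hBd x (hs.trans_le hx))
      (fun x hx => hneg x (hs.trans hx)) hB0
  simp only [Pi.neg_apply]
  rw [integral_neg, this]
  ring

/-- A function with derivative `e^{2 s} K` has the growth `e^{(1 - a) s} gap^{2 - τ}`. -/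
theorem exists_primitive_bound {K : ℝ → ℂ} {a τ : ℝ} (ha1 : a < 1) (ha0 : 0 < a) (hτ2 : 2 < τ)
    (hτ3 : τ ≤ 3) (hK : ContinuousOn K (Ioi 0))
    (hKb : ∀ s, 0 < s → ‖K s‖ ≤ Real.exp (-(1 + a) * s) * gap s ^ (1 - τ)) :
    ∃ (h : ℝ → ℂ) (C : ℝ), 0 ≤ C ∧
      (∀ s, 0 < s → HasDerivAt h ((Real.exp (2 * s) : ℝ) * K s) s) ∧
      ∀ s, 0 < s → ‖h s‖ ≤ C * (Real.exp ((1 - a) * s) * gap s ^ (2 - τ)) := by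
  have hβ : 0 < 1 - a := by linarith
  -- `V'` dominates `e^{2 s} |K|` and has the explicit antiderivative `V`.
  set V : ℝ → ℝ := fun s => 3 / (1 - a) * Real.exp ((1 - a) * s) - 2 / (τ - 2) * gap s ^ (2 - τ)
    with hV
  set V' : ℝ → ℝ := fun s => 3 * Real.exp ((1 - a) * s)
    + 4 * (Real.exp (-2 * s) * gap s ^ (1 - τ)) with hV'
  have hVd : ∀ s, 0 < s → HasDerivAt V (V' s) s := fun s hs => by
    refine (((hasDerivAt_exp_const_mul (1 - a) s).const_mul (3 / (1 - a))).sub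
      ((hasDerivAt_gap_rpow hs (2 - τ)).const_mul (2 / (τ - 2)))).congr_deriv ?_
    rw [show 2 - τ - 1 = 1 - τ by ring, hV']
    have : τ - 2 ≠ 0 := by linarith
    field_simp
    ring
  have hc : ContinuousOn (fun s => ((Real.exp (2 * s) : ℝ) : ℂ) * K s) (Ioi 0) :=
    (by fun_prop : Continuous fun s : ℝ => ((Real.exp (2 * s) : ℝ) : ℂ)).continuousOn.mul hK
  have hle : ∀ s, 0 < s → ‖((Real.exp (2 * s) : ℝ) : ℂ) * K s‖ ≤ V' s := fun s hs => by
    have h0 := gap_pos hs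
    set E := Real.exp (-2 * s) with hE
    set X := gap s ^ (1 - τ) with hX
    set W := Real.exp ((1 - a) * s) with hW
    have hE0 : 0 < E := Real.exp_pos _
    have hW0 : 0 < W := Real.exp_pos _
    have hX0 : 0 ≤ X := Real.rpow_nonneg h0.le _
    have hgE : gap s = 1 - E := rfl
    have hE1 : E ≤ 1 := by linarith
    have hWE : W * E ≤ 1 := by
      rw [hW, hE, ← Real.exp_add, Real.exp_le_one_iff]
      nlinarith
    have h3 : gap s * (gap s * X) ≤ 1 := by
      rw [hX, ← gap_rpow_add_one hs, ← gap_rpow_add_one hs]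
      exact gap_rpow_le_one hs (by linarith)
    have hX1 : X ≤ 1 + 2 * (E * X) := by
      rw [hgE] at h3
      nlinarith [mul_nonneg hE0.le (mul_nonneg hE0.le hX0)]
    have h4 : ‖((Real.exp (2 * s) : ℝ) : ℂ) * K s‖ ≤ W * X := by
      rw [norm_mul, Complex.norm_real, Real.norm_eq_abs, Real.abs_exp]
      calc Real.exp (2 * s) * ‖K s‖
          ≤ Real.exp (2 * s) * (Real.exp (-(1 + a) * s) * X) := by gcongr; exact hKb s hs
        _ = W * X := by rw [← mul_assoc, ← Real.exp_add, hW]; ring_nf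
    refine h4.trans ?_
    have h5 : W * X ≤ W + 2 * (W * E * X) := by nlinarith
    have h6 : W * E * X ≤ W * E * (1 + 2 * (E * X)) := by gcongr
    have h7 : W * E * (E * X) ≤ 1 * (E * X) := by gcongr
    have h8 : W * E ≤ W * 1 := by gcongr
    rw [hV']
    nlinarith
  have hVc : ContinuousOn V' (Ioi 0) := by
    have h1 : ContinuousOn (fun s => gap s ^ (1 - τ)) (Ioi 0) := fun s hs =>
      (hasDerivAt_gap_rpow hs _).continuousAt.continuousWithinAt
    exact (by fun_prop : Continuous fun s : ℝ => 3 * Real.exp ((1 - a) * s)).continuousOn.add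
      (((by fun_prop : Continuous fun s : ℝ => Real.exp (-2 * s)).continuousOn.mul h1).const_smul
        (4 : ℝ))
  have hsub : ∀ s : ℝ, 0 < s → uIcc 1 s ⊆ Ioi 0 := fun s hs y hy =>
    (lt_min one_pos hs).trans_le hy.1
  refine ⟨fun s => ∫ y in (1 : ℝ)..s, ((Real.exp (2 * y) : ℝ) : ℂ) * K y,
    3 / (1 - a) + 2 / (τ - 2) + |V 1|, ?_, fun s hs => ?_, fun s hs => ?_⟩
  · have : 0 < τ - 2 := by linarith
    positivity
  · refine intervalIntegral.integral_hasDerivAt_right ?_ ?_ (hc.continuousAt (Ioi_mem_nhds hs))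
    · exact (hc.mono (hsub s hs)).intervalIntegrable
    · exact hc.stronglyMeasurableAtFilter isOpen_Ioi s hs
  · have hVi : IntervalIntegrable V' volume 1 s := (hVc.mono (hsub s hs)).intervalIntegrable
    have h1 : ‖∫ y in (1 : ℝ)..s, ((Real.exp (2 * y) : ℝ) : ℂ) * K y‖ ≤ |∫ y in (1 : ℝ)..s, V' y| :=
      intervalIntegral.norm_integral_le_abs_of_norm_le
        ((ae_restrict_iff' measurableSet_uIoc).2 (Eventually.of_forall fun y hy =>
          hle y (hsub s hs (uIoc_subset_uIcc hy)))) hVi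
    rw [intervalIntegral.integral_eq_sub_of_hasDerivAt (fun y hy => hVd y (hsub s hs hy)) hVi] at h1
    refine h1.trans ?_
    have hτ0 : 0 < τ - 2 := by linarith
    have hg1 : 1 ≤ gap s ^ (2 - τ) := one_le_gap_rpow hs (by linarith)
    have hW1 : 1 ≤ Real.exp ((1 - a) * s) := Real.one_le_exp (by positivity)
    have hp : 1 ≤ Real.exp ((1 - a) * s) * gap s ^ (2 - τ) := by nlinarith
    have e1 : 3 / (1 - a) * Real.exp ((1 - a) * s)
        ≤ 3 / (1 - a) * (Real.exp ((1 - a) * s) * gap s ^ (2 - τ)) := by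
      gcongr; nlinarith
    have e2 : 2 / (τ - 2) * gap s ^ (2 - τ)
        ≤ 2 / (τ - 2) * (Real.exp ((1 - a) * s) * gap s ^ (2 - τ)) := by
      gcongr; nlinarith
    have e3 : |V 1| ≤ |V 1| * (Real.exp ((1 - a) * s) * gap s ^ (2 - τ)) :=
      le_mul_of_one_le_right (abs_nonneg _) hp
    have e4 : |V s| ≤ 3 / (1 - a) * Real.exp ((1 - a) * s) + 2 / (τ - 2) * gap s ^ (2 - τ) := by
      refine (abs_sub _ _).trans (le_of_eq ?_)
      have := gap_pos hs
      rw [abs_of_nonneg (by positivity), abs_of_nonneg (by positivity)]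
    have e5 := abs_sub (V s) (V 1)
    linarith

theorem hasDerivAt_cast_exp (c s : ℝ) :
    HasDerivAt (fun s => ((Real.exp (c * s) : ℝ) : ℂ)) (c * (Real.exp (c * s) : ℝ)) s :=
  (hasDerivAt_exp_const_mul c s).ofReal_comp.congr_deriv (by push_cast; ring)

/-- For `0 < Re λ < 5 - b` the half-line part of `L` has an approximate eigenfunction `f` for the
value `-λ`, whose defect is a multiple of `e^{-s}` and which is not itself a multiple of `e^{-s}`.
The reflection to `x < 0` changes `-λ` into `λ`. The function is `f = e^{-s} h` with `f - f''` equal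
to `momentum b λ`; the nonlocal term is evaluated by exhibiting a primitive of `e^{-3 s} f`, and the
defect is seen to be constant by differentiating it. -/
theorem exists_half_eigenfunction {b : ℝ} {l : ℂ} (h0 : 0 < l.re) (h1 : l.re < 5 - b) :
    ∃ (f f' : ℝ → ℂ) (R : ℂ) (C a r : ℝ), 0 < a ∧ -(1 / 2) < r ∧
      (∀ s, 0 < s → HasDerivAt f (f' s) s) ∧ ContinuousOn f' (Ioi 0) ∧
      (∀ s, 0 < s → ‖f s‖ ≤ C * (Real.exp (-a * s) * gap s ^ r)) ∧
      (∀ s, 0 < s → ‖gap s • f' s‖ ≤ C * (Real.exp (-a * s) * gap s ^ r)) ∧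
      (∀ s, 0 < s → gap s • f' s - ((4 - b) * Real.exp (-2 * s)) • f s
        - (4 * (b - 3)) • Real.exp s • (∫ y in Ioi s, Real.exp (-3 * y) • f y)
        = -l * f s + R * (Real.exp (-s) : ℝ)) ∧
      ∀ d : ℂ, ∃ s, 0 < s ∧ f s ≠ d * (Real.exp (-s) : ℝ) := by
  -- The exponents are relaxed so that the integrations produce pure powers: `a < 1` keeps the
  -- primitive of `e^{(1 - a) s}` growing, and `τ > 2` keeps `gap^{2 - τ}` singular, while
  -- `τ < 5 / 2` still gives square integrability.
  obtain ⟨a, ha0, ha1, hal⟩ : ∃ a : ℝ, 0 < a ∧ a < 1 ∧ a ≤ l.re :=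
    ⟨min l.re (1 / 2), lt_min h0 (by norm_num), (min_le_right _ _).trans_lt (by norm_num),
      min_le_left _ _⟩
  obtain ⟨τ, hτ, hτ2, hτ3⟩ : ∃ τ : ℝ, (l.re + b) / 2 ≤ τ ∧ 2 < τ ∧ τ < 5 / 2 :=
    ⟨max ((l.re + b) / 2) (9 / 4), le_max_left _ _, lt_of_lt_of_le (by norm_num) (le_max_right _ _),
      max_lt (by linarith) (by norm_num)⟩
  -- Complex-valued real exponentials, kept opaque so that products are only combined by `e_add`.
  obtain ⟨e, he⟩ : ∃ e : ℝ → ℝ → ℂ, ∀ c s, ((Real.exp (c * s) : ℝ) : ℂ) = e c s :=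
    ⟨_, fun _ _ => rfl⟩
  have hE1 : ∀ s, ((Real.exp (-s) : ℝ) : ℂ) = e (-1) s := fun s => by rw [← he, neg_one_mul]
  obtain ⟨K, hK, hKb⟩ := exists_primitive_momentum ha0 hal hτ hτ2
  have hKc : ContinuousOn K (Ioi 0) := fun s hs => (hK s hs).continuousAt.continuousWithinAt
  obtain ⟨h, C, hC, hh, hhb⟩ := exists_primitive_bound ha1 ha0 hτ2 (by linarith) hKc hKb
  simp only [he] at hh
  simp only [hE1] at hK
  have hhc : ContinuousOn h (Ioi 0) := fun s hs => (hh s hs).continuousAt.continuousWithinAt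
  set m := momentum b l with hm_def
  have he0 : ∀ c s, e c s ≠ 0 := fun c s => by
    rw [← he]; exact Complex.ofReal_ne_zero.2 (Real.exp_pos _).ne'
  have hen : ∀ c s, ‖e c s‖ = Real.exp (c * s) := fun c s => by
    rw [← he, Complex.norm_real, Real.norm_eq_abs, Real.abs_exp]
  have hed : ∀ c s, HasDerivAt (e c) (c * e c s) s := fun c s => by
    have := hasDerivAt_cast_exp c s
    simpa only [he] using this
  have hec : ∀ c, Continuous (e c) := fun c =>
    continuous_iff_continuousAt.2 fun s => (hed c s).continuousAt
  have hgd : ∀ s, HasDerivAt (fun s => ((gap s : ℝ) : ℂ)) (2 * e (-2) s) s := fun s =>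
    (hasDerivAt_gap s).ofReal_comp.congr_deriv (by rw [Complex.ofReal_mul, he]; simp)
  have hge : ∀ s, ((gap s : ℝ) : ℂ) = 1 - e (-2) s := fun s => by
    rw [gap, Complex.ofReal_sub, he, Complex.ofReal_one]
  have e_add : ∀ c d s, e c s * e d s = e (c + d) s := fun c d s => by
    rw [← he, ← he, ← he, ← Complex.ofReal_mul, ← Real.exp_add, add_mul]
  set f : ℝ → ℂ := fun s => e (-1) s * h s with hf
  set f' : ℝ → ℂ := fun s => e 1 s * K s - e (-1) s * h s with hf'
  set r := 2 - τ with hr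
  have hfd : ∀ s, 0 < s → HasDerivAt f (f' s) s := fun s hs => by
    refine ((hed (-1) s).mul (hh s hs)).congr_deriv ?_
    have := e_add (-1) 2 s
    norm_num at this
    rw [hf']
    simp only
    rw [← this]
    push_cast
    ring
  have hfc : ContinuousOn f (Ioi 0) := (hec _).continuousOn.mul hhc
  have hfb : ∀ s, 0 < s → ‖f s‖ ≤ C * (Real.exp (-a * s) * gap s ^ r) := fun s hs => by
    rw [hf]
    simp only [norm_mul, hen]
    calc Real.exp (-1 * s) * ‖h s‖
        ≤ Real.exp (-1 * s) * (C * (Real.exp ((1 - a) * s) * gap s ^ (2 - τ))) := by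
          gcongr; exact hhb s hs
      _ = C * (Real.exp (-1 * s) * Real.exp ((1 - a) * s) * gap s ^ (2 - τ)) := by ring
      _ = _ := by rw [← Real.exp_add, hr]; ring_nf
  have hfi : ∀ s, 0 ≤ s → IntegrableOn (fun y => Real.exp (-3 * y) • f y) (Ioi s) := fun s hs => by
    have h2 : IntegrableOn (fun y => C * (Real.exp (-(a + 3) * y) * gap y ^ r)) (Ioi 0) :=
      (integrableOn_exp_mul_gap_rpow (by linarith) (by rw [hr]; linarith)).const_mul C
    refine IntegrableOn.mono_set (h2.mono' ?_ ?_) (Ioi_subset_Ioi hs)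
    · exact ((by fun_prop : Continuous fun y : ℝ => Real.exp (-3 * y)).continuousOn.smul
        hfc).aestronglyMeasurable measurableSet_Ioi
    · refine (ae_restrict_iff' measurableSet_Ioi).2 (Eventually.of_forall fun y hy => ?_)
      rw [norm_smul, Real.norm_eq_abs, Real.abs_exp]
      calc Real.exp (-3 * y) * ‖f y‖
          ≤ Real.exp (-3 * y) * (C * (Real.exp (-a * y) * gap y ^ r)) := by
            gcongr; exact hfb y hy
        _ = C * (Real.exp (-3 * y) * Real.exp (-a * y) * gap y ^ r) := by ring
        _ = _ := by rw [← Real.exp_add]; ring_nf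
  have hmd : ∀ s, 0 < s → ∃ m', HasDerivAt m m' s ∧ (gap s : ℂ) * m' = -(l + b * e (-2) s) * m s :=
    fun s hs => by
      refine ⟨_, hasDerivAt_momentum b l hs, ?_⟩
      rw [he]
      have hg : ((gap s : ℝ) : ℂ) ≠ 0 := Complex.ofReal_ne_zero.2 (gap_pos hs).ne'
      have h3 : (gap s : ℂ) * (-l - (l + b) * e (-2) s / (gap s : ℂ))
          = -l * gap s - (l + b) * e (-2) s := by field_simp
      calc (gap s : ℂ) * (m s * (-l - (l + b) * e (-2) s / (gap s : ℂ)))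
          = ((gap s : ℂ) * (-l - (l + b) * e (-2) s / (gap s : ℂ))) * m s := by ring
        _ = _ := by rw [h3, hge]; ring
  -- The function `G` is `(b - 3)` times the integral of `e^{-2 y} K` over `(s, ∞)`.
  set G : ℝ → ℂ := fun s => ((b - 3) * (e (-2) s * K s) + (1 + l) * K s
    - e (-1) s * (gap s * m s)) / 2 with hG
  have hGd : ∀ s, 0 < s → HasDerivAt G (-(b - 3) * (e (-2) s * K s)) s := fun s hs => by
    obtain ⟨m', hm', hm2⟩ := hmd s hs
    refine ((((((hed (-2) s).mul (hK s hs)).const_mul ((b : ℂ) - 3)).add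
      ((hK s hs).const_mul (1 + l))).sub
      ((hed (-1) s).mul ((hgd s).mul hm'))).div_const 2).congr_deriv ?_
    simp only [Pi.mul_apply]
    rw [hm2, hge]
    push_cast
    ring
  -- A decaying primitive of `-4 (b - 3) e^{-3 s} f`, found by integrating by parts with
  -- `h' = e^{2 s} K`.
  set Φ : ℝ → ℂ := fun s => (b - 3) * (e (-4) s * h s) + G s with hΦ
  have hΦd : ∀ s, 0 < s → HasDerivAt Φ (-(4 * (b - 3)) * (Real.exp (-3 * s) • f s)) s :=
    fun s hs => by
      refine ((((hed (-4) s).mul (hh s hs)).const_mul ((b : ℂ) - 3)).add (hGd s hs)).congr_deriv ?_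
      have e1 := e_add (-4) 2 s
      have e2 := e_add (-3) (-1) s
      norm_num at e1 e2
      have e3 : Real.exp (-3 * s) • f s = e (-4) s * h s := by
        rw [Complex.real_smul, he]
        simp only [hf]
        rw [← mul_assoc, ← e2]
      rw [e3, ← e1]
      push_cast
      ring
  have h_e0 : ∀ c : ℝ, c < 0 → Tendsto (e c) atTop (𝓝 0) := fun c hc => by
    have := tendsto_exp_neg_mul (c := -c) (by linarith)
    rw [neg_neg] at this
    have h2 := (Complex.continuous_ofReal.tendsto 0).comp this
    rw [Complex.ofReal_zero] at h2
    exact h2.congr fun s => he c s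
  have hΦ0 : Tendsto Φ atTop (𝓝 0) := by
    have hK0 : Tendsto K atTop (𝓝 0) := squeeze_zero_norm'
      (eventually_gt_atTop 0 |>.mono fun s hs => hKb s hs)
      (tendsto_exp_mul_gap_rpow (by linarith) _)
    have hm0 : Tendsto m atTop (𝓝 0) := squeeze_zero_norm'
      (eventually_gt_atTop 0 |>.mono fun s hs => norm_momentum_le hal hτ hs)
      (tendsto_exp_mul_gap_rpow ha0 _)
    have hg1 : Tendsto (fun s => ((gap s : ℝ) : ℂ)) atTop (𝓝 1) := by
      have h2 := (Complex.continuous_ofReal.tendsto 1).comp tendsto_gap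
      rwa [Complex.ofReal_one] at h2
    have hf0 : Tendsto f atTop (𝓝 0) := by
      have h2 := (tendsto_exp_mul_gap_rpow ha0 r).const_mul C
      rw [mul_zero] at h2
      exact squeeze_zero_norm' (eventually_gt_atTop 0 |>.mono fun s hs => hfb s hs) h2
    have hh0 : Tendsto (fun s => e (-4) s * h s) atTop (𝓝 0) := by
      have h2 := (h_e0 (-3) (by norm_num)).mul hf0
      rw [mul_zero] at h2
      refine h2.congr fun s => ?_
      rw [hf]
      simp only
      rw [← mul_assoc, e_add]
      norm_num
    have h3 := (hh0.const_mul ((b : ℂ) - 3)).add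
      (((((((h_e0 (-2) (by norm_num)).mul hK0).const_mul ((b : ℂ) - 3)).add
        (hK0.const_mul (1 + l))).sub
        ((h_e0 (-1) (by norm_num)).mul (hg1.mul hm0))).div_const 2))
    simpa using h3
  have hF : ∀ s, 0 < s → (4 * (b - 3) : ℂ) * ∫ y in Ioi s, Real.exp (-3 * y) • f y = Φ s :=
    fun s hs => by
      have h2 := integral_Ioi_of_hasDerivAt_of_tendsto' (a := s)
        (fun y hy => hΦd y (hs.trans_le hy)) ((hfi s hs.le).const_mul _) hΦ0
      rw [integral_const_mul] at h2
      linear_combination -h2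
  -- The coefficient of `e^{-s}` in the defect.
  set Rf : ℝ → ℂ := fun s => e 2 s * K s - K s + (l - 1) * h s
    - e 2 s * G s with hRf
  have hRd : ∀ s, 0 < s → HasDerivAt Rf 0 s := fun s hs => by
    refine (((((hed 2 s).mul (hK s hs)).sub (hK s hs)).add ((hh s hs).const_mul (l - 1))).sub
      ((hed 2 s).mul (hGd s hs))).congr_deriv ?_
    have e2 := e_add 2 (-2) s
    have e3 : e 0 s = 1 := by simp [← he]
    norm_num [e3] at e2
    simp only [hG, hge]
    push_cast
    linear_combination (-m s * e (-1) s) * e2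
  obtain ⟨R, hR⟩ := isOpen_Ioi.exists_is_const_of_deriv_eq_zero (isPreconnected_Ioi (a := (0 : ℝ)))
    (f := Rf) (fun s hs => (hRd s hs).differentiableAt.differentiableWithinAt)
    (fun s hs => (hRd s hs).deriv)
  refine ⟨f, f', R, C + 1, a, r, ha0, by rw [hr]; linarith, hfd, ?_, fun s hs => ?_,
    fun s hs => ?_, fun s hs => ?_, fun d => ?_⟩
  · exact ((hec _).continuousOn.mul hKc).sub ((hec _).continuousOn.mul hhc)
  · have := gap_pos hs
    refine (hfb s hs).trans ?_
    gcongr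
    linarith
  · have hg := gap_pos hs
    have h2 : ‖gap s • (e 1 s * K s)‖ ≤ Real.exp (-a * s) * gap s ^ r := by
      rw [norm_smul, norm_mul]
      simp only [hen, Real.norm_eq_abs, abs_of_pos hg]
      calc gap s * (Real.exp (1 * s) * ‖K s‖)
          ≤ gap s * (Real.exp (1 * s) * (Real.exp (-(1 + a) * s) * gap s ^ (1 - τ))) := by
            gcongr; exact hKb s hs
        _ = (Real.exp (1 * s) * Real.exp (-(1 + a) * s)) * (gap s * gap s ^ (1 - τ)) := by ring
        _ = _ := by
            rw [← gap_rpow_add_one hs, ← Real.exp_add, hr]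
            ring_nf
    have h3 : ‖gap s • f s‖ ≤ C * (Real.exp (-a * s) * gap s ^ r) := by
      rw [norm_smul, Real.norm_eq_abs, abs_of_pos hg]
      exact (mul_le_of_le_one_left (norm_nonneg _) (gap_le_one s)).trans (hfb s hs)
    have h4 : gap s • f' s = gap s • (e 1 s * K s) - gap s • f s := by rw [← smul_sub]
    rw [h4]
    refine (norm_sub_le _ _).trans ?_
    linarith
  · have h2 := hF s hs
    have h3 := hR s hs
    have e1 : ((Real.exp s : ℝ) : ℂ) = e 1 s := by rw [← he, one_mul]
    generalize (∫ y in Ioi s, Real.exp (-3 * y) • f y) = I at h2 ⊢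
    simp only [Complex.real_smul]
    rw [e1, hE1, Complex.ofReal_mul, he, hge]
    push_cast
    rw [← h3]
    simp only [hRf, hf, hf']
    simp only [hΦ] at h2
    have a1 := e_add 1 (-2) s
    have a2 := e_add 2 (-1) s
    have a3 := e_add 1 (-4) s
    have a4 := e_add (-2) (-1) s
    norm_num at a1 a2 a3 a4
    linear_combination (-e 1 s) * h2 - K s * a1 - (K s - G s) * a2
      - (b - 3) * h s * a3 + (b - 3) * h s * a4
  · -- If `f` is a multiple of `e^{-s}`, then `h` is constant, hence `K = 0` and `m = 0`.
    by_contra! hcon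
    have hz : ∀ s, 0 < s → h s = d := fun s hs => by
      have h2 := hcon s hs
      rw [hf, hE1] at h2
      exact mul_left_cancel₀ (he0 (-1) s) (h2.trans (mul_comm _ _))
    have hK0 : ∀ s, 0 < s → K s = 0 := fun s hs => by
      have h2 : HasDerivAt h 0 s := (hasDerivAt_const s d).congr_of_eventuallyEq
        (by filter_upwards [Ioi_mem_nhds hs] with t ht using hz t ht)
      have h3 := (hh s hs).unique h2
      exact (mul_eq_zero.1 h3).resolve_left (he0 _ _)
    have h2 : HasDerivAt K 0 1 := (hasDerivAt_const 1 (0 : ℂ)).congr_of_eventuallyEq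
      (by filter_upwards [Ioi_mem_nhds one_pos] with t ht using hK0 t ht)
    have h3 := (hK 1 one_pos).unique h2
    exact momentum_ne_zero b l 1 ((mul_eq_zero.1 (neg_eq_zero.1 h3)).resolve_left (he0 _ _))

/-- The approximate eigenfunction, reflected to the left half-line. Its moment on that side enters
`L` on the right half-line through `q`. -/
theorem exists_left_eigenfunction {b : ℝ} {l : ℂ} (h0 : 0 < l.re) (h1 : l.re < 5 - b) :
    ∃ (v : L2R) (R q : ℂ), (∀ d : ℂ, ∀ c : ℂ, v + d • negExpL + c • posExpL ≠ 0) ∧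
      LMaps b v (l • v - R • negExpL + (4 * (b - 3) * q : ℂ) • posExpL) := by
  obtain ⟨f, f', R, C, a, r, ha, hr, hd, hc', hb, hb', heq, hne⟩ :=
    exists_half_eigenfunction h0 h1
  have hc : ContinuousOn f (Ioi 0) := fun s hs => (hd s hs).continuousAt.continuousWithinAt
  have hneg : MeasurePreserving (fun x : ℝ => -x) volume volume := Measure.measurePreserving_neg _
  set F : ℝ → ℂ := fun x => (Ioi 0).indicator f (-x) with hF
  set F' : ℝ → ℂ := fun x => (Ioi 0).indicator (fun s => -f' s) (-x) with hF'
  have hFm : MemLp F 2 volume := (memLp_indicator_Ioi hc ha hr hb).comp_measurePreserving hneg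
  have hFneg : ∀ x, x < 0 → F x = f (-x) := fun x hx =>
    indicator_of_mem (show -x ∈ Ioi (0 : ℝ) from neg_pos.2 hx) f
  have hFpos : ∀ x, 0 ≤ x → F x = 0 := fun x hx =>
    indicator_of_notMem (show -x ∉ Ioi (0 : ℝ) from fun h => (neg_pos.1 h).not_ge hx) f
  have hF'neg : ∀ x, x < 0 → F' x = -f' (-x) := fun x hx =>
    indicator_of_mem (show -x ∈ Ioi (0 : ℝ) from neg_pos.2 hx) _
  have hF'pos : ∀ x, 0 ≤ x → F' x = 0 := fun x hx =>
    indicator_of_notMem (show -x ∉ Ioi (0 : ℝ) from fun h => (neg_pos.1 h).not_ge hx) _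
  have hgm : MemLp (fun x => (1 - phi x ^ 2) • F' x) 2 volume := by
    have h2 : MemLp ((Ioi 0).indicator fun s => -(gap s • f' s)) 2 volume := by
      refine memLp_indicator_Ioi (C := C) (a := a) (r := r) ?_ ha hr fun s hs => ?_
      · exact (continuous_gap.continuousOn.smul hc').neg
      · rw [norm_neg]
        exact hb' s hs
    refine (h2.comp_measurePreserving hneg).ae_eq (Eventually.of_forall fun x => ?_)
    simp only [Function.comp_apply, one_sub_phi_sq]
    rcases lt_or_ge x 0 with h | h
    · rw [hF'neg x h, abs_of_neg h, indicator_of_mem (show -x ∈ Ioi (0 : ℝ) from neg_pos.2 h),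
        smul_neg]
    · rw [hF'pos x h, smul_zero, indicator_of_notMem
        (show -x ∉ Ioi (0 : ℝ) from fun h' => (neg_pos.1 h').not_ge h)]
  have hFd : ∀ x ∉ ({0} : Set ℝ), HasDerivAt F (F' x) x := by
    intro x hx
    rcases (show x ≠ 0 from hx).lt_or_gt with h | h
    · rw [hF'neg x h]
      have h2 : HasDerivAt (fun y => f (-y)) (-f' (-x)) x := by
        have h3 := (hd (-x) (neg_pos.2 h)).scomp x (hasDerivAt_neg x)
        rwa [neg_one_smul] at h3
      refine h2.congr_of_eventuallyEq ?_
      filter_upwards [Iio_mem_nhds h] with y hy using hFneg y hy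
    · rw [hF'pos x h.le]
      refine (hasDerivAt_const x (0 : ℂ)).congr_of_eventuallyEq ?_
      filter_upwards [Ioi_mem_nhds h] with y hy using hFpos y (le_of_lt hy)
  -- At the peak the weighted function is bounded by a power of `gap` with exponent `r + 1 > 0`.
  have hFc : Continuous fun x => (1 - phi x ^ 2) • F x := by
    refine continuous_iff_continuousAt.2 fun x => ?_
    by_cases hx : x = 0
    · subst hx
      have hr1 : 0 < r + 1 := by linarith
      have hlim : Tendsto (fun x : ℝ => |C| * gap |x| ^ (r + 1)) (𝓝 0) (𝓝 0) := by
        have h2 : Continuous fun x : ℝ => |C| * gap |x| ^ (r + 1) :=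
          continuous_const.mul ((continuous_gap.comp continuous_abs).rpow_const
            fun _ => Or.inr hr1.le)
        have := h2.tendsto 0
        rwa [abs_zero, gap_zero, Real.zero_rpow hr1.ne', mul_zero] at this
      have hz : (1 - phi 0 ^ 2) • F 0 = 0 := by rw [hFpos 0 le_rfl, smul_zero]
      rw [ContinuousAt, hz]
      refine squeeze_zero_norm (fun x => ?_) hlim
      rw [one_sub_phi_sq]
      rcases lt_or_ge x 0 with h | h
      · have hs : 0 < -x := neg_pos.2 h
        have hg := gap_pos hs
        rw [hFneg x h, abs_of_neg h, norm_smul, Real.norm_eq_abs, abs_of_pos hg,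
          gap_rpow_add_one hs]
        have h3 : Real.exp (-a * -x) ≤ 1 := Real.exp_le_one_iff.2 (by nlinarith)
        calc gap (-x) * ‖f (-x)‖
            ≤ gap (-x) * (C * (Real.exp (-a * -x) * gap (-x) ^ r)) := by
              gcongr; exact hb _ hs
          _ ≤ gap (-x) * (|C| * (1 * gap (-x) ^ r)) := by
              gcongr
              exact le_abs_self C
          _ = _ := by ring
      · rw [hFpos x h, smul_zero, norm_zero]
        have : 0 ≤ gap |x| := by
          rcases h.eq_or_lt with h' | h'
          · rw [← h', abs_zero, gap_zero]
          · exact (gap_pos (abs_pos.2 h'.ne')).le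
        positivity
    · have := continuous_phi
      exact (by fun_prop : Continuous fun x => 1 - phi x ^ 2).continuousAt.smul
        (hFd x hx).continuousAt
  have hI : ∀ x : ℝ, x ≤ 0 → ∫ y in Iio x, Real.exp (3 * y) • F y
      = ∫ y in Ioi (-x), Real.exp (-3 * y) • f y := fun x hx => by
    have h2 := integral_comp_neg_Ioi (-x) (fun y => Real.exp (3 * y) • F y)
    rw [neg_neg] at h2
    rw [← integral_Iic_eq_integral_Iio, ← h2]
    refine setIntegral_congr_fun measurableSet_Ioi fun y hy => ?_
    have hy0 : 0 < y := lt_of_le_of_lt (by linarith) hy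
    rw [hFneg (-y) (neg_lt_zero.2 hy0), neg_neg]
    ring_nf
  refine ⟨hFm.toLp, R, ∫ y in Ioi 0, Real.exp (-3 * y) • f y, fun d c hz => ?_, ?_⟩
  · obtain ⟨s, hs, hsne⟩ := hne (-d)
    have h2 : ∀ᵐ x : ℝ, F x + d * negExp x + c * posExp x = 0 := by
      filter_upwards [hFm.coeFn_toLp, Lp.coeFn_add (hFm.toLp + d • negExpL) (c • posExpL),
        Lp.coeFn_add hFm.toLp (d • negExpL), Lp.coeFn_smul d negExpL, Lp.coeFn_smul c posExpL,
        coeFn_negExpL, coeFn_posExpL, Lp.coeFn_zero ℂ 2 (volume : Measure ℝ)] with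
        x e1 e2 e3 e4 e5 e6 e7 e8
      rw [hz, e8, Pi.add_apply, e3, Pi.add_apply, e1, e4, e5, Pi.smul_apply, Pi.smul_apply, e6,
        e7] at e2
      exact e2.symm
    -- Both sides are continuous on the left half-line, so equality holds at every point there.
    have h3 : EqOn (fun x => F x + d * (Real.exp x : ℝ)) (fun _ => 0) (Iio 0) := by
      refine Measure.eqOn_open_of_ae_eq (μ := volume) ?_ isOpen_Iio ?_ continuousOn_const
      · refine (ae_restrict_iff' measurableSet_Iio).2 ?_
        filter_upwards [h2] with x hx hx0
        rw [negExp_of_neg hx0, posExp_of_nonpos (le_of_lt hx0)] at hx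
        simpa using hx
      · refine ContinuousOn.add (fun x hx =>
          (hFd x (ne_of_lt hx)).continuousAt.continuousWithinAt) ?_
        fun_prop
    have h4 := h3 (show -s ∈ Iio (0 : ℝ) from neg_lt_zero.2 hs)
    simp only at h4
    rw [hFneg (-s) (neg_lt_zero.2 hs), neg_neg] at h4
    exact hsne (by linear_combination h4)
  · set q := ∫ y in Ioi 0, Real.exp (-3 * y) • f y with hq
    refine LMaps.of_hasDerivAt (countable_singleton 0) hFm.coeFn_toLp hgm hFd hFc ?_
    filter_upwards [hFm.coeFn_toLp, Lp.coeFn_add (l • hFm.toLp - R • negExpL)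
        ((4 * (b - 3) * q : ℂ) • posExpL), Lp.coeFn_sub (l • hFm.toLp) (R • negExpL),
        Lp.coeFn_smul l hFm.toLp, Lp.coeFn_smul R negExpL,
        Lp.coeFn_smul (4 * (b - 3) * q : ℂ) posExpL,
        coeFn_negExpL, coeFn_posExpL, Measure.ae_ne volume 0] with x e1 e2 e3 e4 e5 e6 e7 e8 hx0
    rw [e2, Pi.add_apply, e3, Pi.sub_apply, e4, e5, e6, Pi.smul_apply, Pi.smul_apply,
      Pi.smul_apply, e1, e7, e8, setIntegral_smul_eq_zero (t := Ioi (max x 0)) _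
        (fun y hy => hFpos y ((le_max_right _ _).trans (le_of_lt hy))),
      hI _ (min_le_right _ _), smul_zero, sub_zero]
    rcases hx0.lt_or_gt with h | h
    · have h2 := heq (-x) (neg_pos.2 h)
      rw [hFneg x h, hF'neg x h, negExp_of_neg h, posExp_of_nonpos h.le, min_eq_left h.le,
        one_sub_phi_sq, abs_of_neg h, phi_of_nonpos h.le, dphi_of_neg h, ← Real.exp_add]
      rw [neg_neg, show -2 * -x = x + x by ring] at h2
      simp only [Complex.real_smul, smul_eq_mul] at h2 ⊢
      push_cast at h2 ⊢
      linear_combination h2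
    · rw [hFpos x h.le, hF'pos x h.le, negExp_of_nonneg h.le, posExp_of_pos h, min_eq_right h.le,
        neg_zero, ← hq]
      simp only [Complex.real_smul, smul_eq_mul]
      push_cast
      ring

theorem IsEigenfunction.of_lMaps {b : ℝ} {l : ℂ} {w : L2R} (hw : w ≠ 0)
    (h : LMaps b w (l • w)) : IsEigenfunction (L b) l w := ⟨hw, h⟩

/-- The open strip `0 < Re λ < 5 - b` consists of eigenvalues. The approximate eigenfunction is
corrected by the two halves of `φ`, which leads to a `2 × 2` linear system; its determinant vanishes
only if `λ` is an eigenvalue of `L` on the span of `φ` and `φ'`, in which case there is nothing to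
correct. -/
theorem exists_isEigenfunction {b : ℝ} {l : ℂ} (h0 : 0 < l.re) (h1 : l.re < 5 - b) :
    ∃ w : L2R, IsEigenfunction (L b) l w := by
  by_cases hD : 1 - l ^ 2 - (b - 3) ^ 2 = 0
  · have hl : l ≠ 0 := fun h => by simp [h] at h0
    refine ⟨l • phiL + (4 - b : ℂ) • dphiL, .of_lMaps (fun h => hl (phi_dphi_eq_zero h).1) ?_⟩
    convert ((lMaps_phiL b).smul l).add ((lMaps_dphiL b).smul (4 - b : ℂ)) using 1
    have h2 : (4 - b : ℂ) * (b - 2) = l ^ 2 := by linear_combination hD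
    rw [smul_add, smul_smul, smul_smul, smul_smul, h2, sq, add_comm]
  · obtain ⟨v, R, q, hne, hv⟩ := exists_left_eigenfunction h0 h1
    set D : ℂ := 1 - l ^ 2 - (b - 3) ^ 2 with hDdef
    -- Cramer's rule for the system formed by `e1` and `e2`.
    set d : ℂ := ((1 + l) * R + (b - 3) * (4 * (b - 3) * q)) / D with hd
    set c : ℂ := ((b - 3) * R + (1 - l) * (4 * (b - 3) * q)) / D with hc
    have e1 : (1 - l) * d - (b - 3) * c = R := by
      rw [hd, hc]; field_simp; rw [hDdef]; ring
    have e2 : (1 + l) * c - (b - 3) * d = 4 * (b - 3) * q := by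
      rw [hd, hc]; field_simp; rw [hDdef]; ring
    refine ⟨v + d • negExpL + c • posExpL, .of_lMaps (hne d c) ?_⟩
    convert (hv.add ((lMaps_negExpL b).smul d)).add ((lMaps_posExpL b).smul c) using 1
    rw [← e1, ← e2]
    push_cast
    module

/-- Away from the eigenvalues of `L` on the span of `φ` and `φ'`, eigenfunctions lie outside that
span. -/
theorem IsEigenfunction.notMem_span {b : ℝ} {l : ℂ} {w : L2R} (hl : l ^ 2 ≠ (b - 2) * (4 - b))
    (hw : IsEigenfunction (L b) l w) : w ∉ Submodule.span ℂ {phiL, dphiL} := by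
  intro hs
  obtain ⟨α, β, rfl⟩ := Submodule.mem_span_pair.1 hs
  have h1 : LMaps b _ (l • (α • phiL + β • dphiL)) := hw.2
  have h2 := h1.unique (((lMaps_phiL b).smul α).add ((lMaps_dphiL b).smul β))
  have h3 : (l * α - (b - 2) * β) • phiL + (l * β - (4 - b) * α) • dphiL = 0 := by
    rw [← sub_eq_zero] at h2
    rw [← h2]
    module
  obtain ⟨h4, h5⟩ := phi_dphi_eq_zero h3
  have hα : (l ^ 2 - (b - 2) * (4 - b)) * α = 0 := by linear_combination l * h4 + (b - 2) * h5
  have hβ : (l ^ 2 - (b - 2) * (4 - b)) * β = 0 := by linear_combination l * h5 + (4 - b) * h4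
  have hα0 := (mul_eq_zero.1 hα).resolve_left (sub_ne_zero.2 hl)
  have hβ0 := (mul_eq_zero.1 hβ).resolve_left (sub_ne_zero.2 hl)
  exact hw.1 (by simp [hα0, hβ0])

theorem IsEigenfunction.solvesEvolution {b : ℝ} {l : ℂ} {w : L2R}
    (hw : IsEigenfunction (L b) l w) :
    SolvesEvolution b (fun t : ℝ => Complex.exp (l * t) • w) := by
  have h1 : LMaps b w (l • w) := hw.2
  refine solvesEvolution_of_lMaps (R := fun t : ℝ => Complex.exp (l * t) • l • w) (by fun_prop)
    fun t => ⟨h1.smul _, ?_⟩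
  have h2 : HasDerivAt (fun t : ℝ => l * (t : ℂ)) l t := by
    simpa using (Complex.ofRealCLM.hasDerivAt (x := t)).const_mul l
  refine (h2.cexp.smul_const w).congr_deriv ?_
  rw [smul_smul]

/-- Modulo the finite-dimensional span of `φ` and `φ'` the solution is `e^{λ t} w`, and `w` has
positive distance from this span. -/
theorem growsExponentially_of_notMem_span {l : ℂ} {w : L2R} (α β : ℝ → ℂ)
    (hw : w ∉ Submodule.span ℂ {phiL, dphiL}) :
    GrowsExponentially l.re
      (fun t : ℝ => Complex.exp (l * t) • w + α t • phiL + β t • dphiL) := by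
  set S := Submodule.span ℂ {phiL, dphiL} with hS
  have : FiniteDimensional ℂ S := FiniteDimensional.span_of_finite ℂ (by simp)
  have hcl : IsClosed (S : Set L2R) := S.closed_of_finiteDimensional
  have hpos : 0 < Metric.infDist w (S : Set L2R) :=
    (hcl.notMem_iff_infDist_pos ⟨0, S.zero_mem⟩).1 hw
  refine ⟨_, hpos, fun t _ => ?_⟩
  have hφ : phiL ∈ S := Submodule.subset_span (by simp)
  have hφ' : dphiL ∈ S := Submodule.subset_span (by simp)
  set y : L2R := -((Complex.exp (l * t))⁻¹ • (α t • phiL + β t • dphiL)) with hy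
  have hyS : y ∈ S := S.neg_mem (S.smul_mem _ (S.add_mem (S.smul_mem _ hφ) (S.smul_mem _ hφ')))
  have h1 : Complex.exp (l * t) • w + α t • phiL + β t • dphiL = Complex.exp (l * t) • (w - y) := by
    rw [hy, sub_neg_eq_add, smul_add, smul_inv_smul₀ (Complex.exp_ne_zero _), add_assoc]
  have h2 := Metric.infDist_le_dist_of_mem (x := w) hyS
  rw [dist_eq_norm] at h2
  simp only [h1, norm_smul, Complex.norm_exp]
  rw [mul_comm, show (l * t).re = l.re * t by simp]
  gcongr

/-! ### Weak integration by parts on the half-line -/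

/-- The domain contains the test functions. -/
theorem domL_dense : Dense (domL : Set L2R) := by
  refine Submodule.dense_iff_topologicalClosure_eq_top.2 ?_
  rw [Submodule.topologicalClosure_eq_top_iff, Submodule.eq_bot_iff]
  intro w hw
  have hloc : LocallyIntegrable w volume := (Lp.memLp w).locallyIntegrable (by norm_num)
  have key := ae_eq_zero_of_integral_contDiff_smul_eq_zero (μ := volume) hloc (fun ψ hψ hc => by
    have hm : MemLp (fun x => (ψ x : ℂ)) 2 volume := (memLp_test hψ hc).ofReal
    have hd : ∀ x ∉ (∅ : Set ℝ), HasDerivAt (fun x => (ψ x : ℂ)) ((deriv ψ x : ℝ) : ℂ) x :=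
      fun x _ => ((hψ.differentiable (by simp)) x).hasDerivAt.ofReal_comp
    have hm' : MemLp (fun x => ((deriv ψ x : ℝ) : ℂ)) 2 volume :=
      ((hψ.continuous_deriv (by simp)).memLp_of_hasCompactSupport hc.deriv).ofReal
    have hcont : Continuous fun x => (1 - phi x ^ 2) • (ψ x : ℂ) := by
      have := continuous_phi
      have := hψ.continuous
      fun_prop
    have h1 : hm.toLp ∈ domL :=
      ⟨_, isWeightedDeriv_toLp countable_empty hm (memLp_weight_smul hm') hd hcont⟩
    have h2 := (Submodule.mem_orthogonal _ _).1 hw _ h1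
    rw [L2.inner_def] at h2
    rw [← h2]
    refine integral_congr_ae ?_
    filter_upwards [hm.coeFn_toLp] with x hx
    rw [hx]
    simp [mul_comm])
  refine Lp.ext ?_
  filter_upwards [key, Lp.coeFn_zero ℂ 2 (volume : Measure ℝ)] with x h1 h2
  rw [h1, h2, Pi.zero_apply]

theorem deriv_smoothTransition_eq_zero {x : ℝ} (hx : x < 0 ∨ 1 < x) :
    deriv Real.smoothTransition x = 0 := by
  rcases hx with h | h
  · have : Real.smoothTransition =ᶠ[𝓝 x] fun _ => 0 := by
      filter_upwards [Iio_mem_nhds h] with y hy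
      exact Real.smoothTransition.zero_of_nonpos (le_of_lt hy)
    rw [this.deriv_eq, deriv_const]
  · have : Real.smoothTransition =ᶠ[𝓝 x] fun _ => 1 := by
      filter_upwards [Ioi_mem_nhds h] with y hy
      exact Real.smoothTransition.one_of_one_le (le_of_lt hy)
    rw [this.deriv_eq, deriv_const]

theorem exists_bound_deriv_smoothTransition :
    ∃ M : ℝ, 0 ≤ M ∧ ∀ x, |deriv Real.smoothTransition x| ≤ M := by
  have hc : Continuous (deriv Real.smoothTransition) :=
    (Real.smoothTransition.contDiff (n := 1)).continuous_deriv le_rfl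
  obtain ⟨M, hM⟩ := (isCompact_Icc (a := (0 : ℝ)) (b := 1)).exists_bound_of_continuousOn
    hc.continuousOn
  refine ⟨max M 0, le_max_right _ _, fun x => ?_⟩
  by_cases hx : x ∈ Icc (0 : ℝ) 1
  · exact (hM x hx).trans (le_max_left _ _)
  · rw [deriv_smoothTransition_eq_zero, abs_zero]
    · exact le_max_right _ _
    · by_contra! h
      exact hx h

/-- A cutoff supported in `[1 / N, N]` and equal to `1` on `[2 / N, N - 1]`. -/
noncomputable def cutoff (N x : ℝ) : ℝ :=
  Real.smoothTransition (N * x - 1) * Real.smoothTransition (N - x)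

/-- The derivative of `cutoff N`. -/
noncomputable def cutoffDeriv (N x : ℝ) : ℝ :=
  N * deriv Real.smoothTransition (N * x - 1) * Real.smoothTransition (N - x)
    - Real.smoothTransition (N * x - 1) * deriv Real.smoothTransition (N - x)

theorem contDiff_cutoff (N : ℝ) : ContDiff ℝ ∞ (cutoff N) := by
  have h := Real.smoothTransition.contDiff (n := (⊤ : ℕ∞))
  exact (h.comp (by fun_prop : ContDiff ℝ ∞ fun x : ℝ => N * x - 1)).mul
    (h.comp (by fun_prop : ContDiff ℝ ∞ fun x : ℝ => N - x))

theorem hasDerivAt_cutoff (N x : ℝ) : HasDerivAt (cutoff N) (cutoffDeriv N x) x := by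
  have h : ∀ y, HasDerivAt Real.smoothTransition (deriv Real.smoothTransition y) y := fun y =>
    ((Real.smoothTransition.contDiff (n := 1)).differentiable one_ne_zero y).hasDerivAt
  have h1 : HasDerivAt (fun x : ℝ => N * x - 1) N x := by
    simpa using ((hasDerivAt_id x).const_mul N).sub_const 1
  have h2 : HasDerivAt (fun x : ℝ => N - x) (-1) x := by
    simpa using (hasDerivAt_id x).const_sub N
  refine (((h _).comp x h1).mul ((h _).comp x h2)).congr_deriv ?_
  simp only [cutoffDeriv, Function.comp_apply]
  ring

theorem cutoff_nonneg (N x : ℝ) : 0 ≤ cutoff N x :=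
  mul_nonneg (Real.smoothTransition.nonneg _) (Real.smoothTransition.nonneg _)

theorem cutoff_le_one (N x : ℝ) : cutoff N x ≤ 1 :=
  mul_le_one₀ (Real.smoothTransition.le_one _) (Real.smoothTransition.nonneg _)
    (Real.smoothTransition.le_one _)

theorem cutoff_eq_zero {N x : ℝ} (hx : N * x ≤ 1 ∨ N ≤ x) : cutoff N x = 0 := by
  rcases hx with h | h
  · rw [cutoff, Real.smoothTransition.zero_of_nonpos (by linarith), zero_mul]
  · rw [cutoff, Real.smoothTransition.zero_of_nonpos (x := N - x) (by linarith), mul_zero]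

theorem cutoff_eq_one {N x : ℝ} (h1 : 2 < N * x) (h2 : x + 1 < N) :
    cutoff N x = 1 ∧ cutoffDeriv N x = 0 := by
  rw [cutoff, cutoffDeriv, Real.smoothTransition.one_of_one_le (by linarith),
    Real.smoothTransition.one_of_one_le (by linarith),
    deriv_smoothTransition_eq_zero (Or.inr (by linarith)),
    deriv_smoothTransition_eq_zero (Or.inr (by linarith))]
  norm_num

theorem eventually_cutoff_eq_one {x : ℝ} (hx : 0 < x) :
    ∀ᶠ n : ℕ in atTop, cutoff (n + 1) x = 1 ∧ cutoffDeriv (n + 1) x = 0 := by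
  have h : Tendsto (fun n : ℕ => (n : ℝ)) atTop atTop := tendsto_natCast_atTop_atTop
  filter_upwards [h.eventually_gt_atTop (2 / x), h.eventually_gt_atTop x] with n h1 h2
  refine cutoff_eq_one ?_ (by linarith)
  rw [div_lt_iff₀ hx] at h1
  nlinarith

theorem gap_le (x : ℝ) : gap x ≤ 2 * x := by
  have := Real.add_one_le_exp (-2 * x)
  rw [gap]
  linarith

/-- The weight `gap` compensates the steep slope of the cutoff near the origin. -/
theorem gap_mul_cutoffDeriv_le {M : ℝ} (hM0 : 0 ≤ M)
    (hM : ∀ x, |deriv Real.smoothTransition x| ≤ M) {N x : ℝ} (hN : 0 < N) (hx : 0 < x) :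
    |gap x * cutoffDeriv N x| ≤ 5 * M := by
  have hg := gap_pos hx
  have hg1 := gap_le_one x
  have hg2 := gap_le x
  have t1 := Real.smoothTransition.nonneg (N * x - 1)
  have t2 := Real.smoothTransition.le_one (N * x - 1)
  have t3 := Real.smoothTransition.nonneg (N - x)
  have t4 := Real.smoothTransition.le_one (N - x)
  have h1 : |gap x * (N * deriv Real.smoothTransition (N * x - 1))| ≤ 4 * M := by
    by_cases h : N * x ≤ 2
    · rw [abs_mul, abs_mul, abs_of_pos hg, abs_of_pos hN]
      calc gap x * (N * |deriv Real.smoothTransition (N * x - 1)|) ≤ (2 * x) * (N * M) := by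
            gcongr; exact hM _
        _ = 2 * (N * x) * M := by ring
        _ ≤ 2 * 2 * M := by gcongr
        _ = 4 * M := by ring
    · rw [deriv_smoothTransition_eq_zero (Or.inr (by linarith)), mul_zero, mul_zero, abs_zero]
      positivity
  have h2 : |gap x * deriv Real.smoothTransition (N - x)| ≤ M := by
    rw [abs_mul, abs_of_pos hg]
    exact (mul_le_of_le_one_left (abs_nonneg _) hg1).trans (hM _)
  have e : gap x * cutoffDeriv N x = gap x * (N * deriv Real.smoothTransition (N * x - 1)) *
      Real.smoothTransition (N - x)
      - gap x * deriv Real.smoothTransition (N - x) * Real.smoothTransition (N * x - 1) := by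
    rw [cutoffDeriv]; ring
  rw [e]
  refine (abs_sub _ _).trans ?_
  rw [abs_mul, abs_mul _ (Real.smoothTransition (N * x - 1)), abs_of_nonneg t1, abs_of_nonneg t3]
  have h3 := mul_le_mul h1 t4 t3 (by positivity)
  have h4 := mul_le_mul h2 t2 t1 (by positivity)
  linarith

/-- The defining identity of the weighted derivative extends from test functions to functions on the
half-line that may be singular at the origin. No boundary term appears, because `1 - φ²` vanishes at
the origin to first order and the pairing of `L²` functions with the cutoffs is dominated. -/
theorem IsWeightedDeriv.integral_Ioi {v w : L2R} (h : IsWeightedDeriv v w) {g g' : ℝ → ℝ}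
    {C a r : ℝ} (ha : 0 < a) (hr : -(1 / 2) < r) (hg : ContDiffOn ℝ ∞ g (Ioi 0))
    (hg' : ∀ s, 0 < s → HasDerivAt g (g' s) s)
    (hb : ∀ s, 0 < s → |g s| ≤ C * (Real.exp (-a * s) * gap s ^ r))
    (hb' : ∀ s, 0 < s → |gap s * g' s| ≤ C * (Real.exp (-a * s) * gap s ^ r)) :
    ∫ x in Ioi 0, g x • w x
      = -∫ x in Ioi 0, (gap x * g' x + 2 * Real.exp (-2 * x) * g x) • v x := by
  obtain ⟨M, hM0, hM⟩ := exists_bound_deriv_smoothTransition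
  set ψ : ℕ → ℝ → ℝ := fun n x => cutoff (n + 1) x * g x with hψ
  have hn0 : ∀ n : ℕ, (0 : ℝ) < n + 1 := fun n => by positivity
  have hψsm : ∀ n, ContDiff ℝ ∞ (ψ n) := fun n => by
    refine contDiff_iff_contDiffAt.2 fun x => ?_
    by_cases hx : 0 < x
    · exact (contDiff_cutoff _).contDiffAt.mul (hg.contDiffAt (Ioi_mem_nhds hx))
    · have hx1 : x < 1 / ((n : ℝ) + 1) := (not_lt.1 hx).trans_lt (by have := hn0 n; positivity)
      have : ψ n =ᶠ[𝓝 x] fun _ => 0 := by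
        filter_upwards [Iio_mem_nhds hx1] with y hy
        rw [hψ]
        simp only
        rw [cutoff_eq_zero, zero_mul]
        left
        have := (lt_div_iff₀ (hn0 n)).1 hy
        linarith
      exact contDiffAt_const.congr_of_eventuallyEq this
  have hψ0 : ∀ n x, x < 0 → ψ n x = 0 := fun n x hx => by
    rw [hψ]
    simp only
    rw [cutoff_eq_zero, zero_mul]
    left
    have := hn0 n
    nlinarith
  have hψc : ∀ n, HasCompactSupport (ψ n) := fun n => by
    refine HasCompactSupport.intro (isCompact_Icc (a := (0 : ℝ)) (b := n + 1)) fun x hx => ?_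
    rcases lt_or_ge x 0 with h' | h'
    · exact hψ0 n x h'
    · rw [hψ]
      simp only
      rw [cutoff_eq_zero, zero_mul]
      right
      by_contra! h2
      exact hx ⟨h', h2.le⟩
  have hψd : ∀ n x, 0 < x →
      deriv (ψ n) x = cutoffDeriv (n + 1) x * g x + cutoff (n + 1) x * g' x := fun n x hx =>
    ((hasDerivAt_cutoff _ x).mul (hg' x hx)).deriv
  have hψd0 : ∀ n x, x < 0 → deriv (ψ n) x = 0 := fun n x hx => by
    have : ψ n =ᶠ[𝓝 x] fun _ => 0 := by
      filter_upwards [Iio_mem_nhds hx] with y hy using hψ0 n y hy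
    rw [this.deriv_eq, deriv_const]
  -- The dominating function for the cutoffs of `g`, of `gap g'`, and of the commutator.
  have hBm : MemLp ((Ioi 0).indicator
      fun s => ((C * (Real.exp (-a * s) * gap s ^ r) : ℝ) : ℂ)) 2 volume := by
    refine memLp_indicator_Ioi (C := |C|) (a := a) (r := r) ?_ ha hr fun s hs => ?_
    · have h1 : ContinuousOn (fun s => gap s ^ r) (Ioi 0) := fun s hs =>
        (hasDerivAt_gap_rpow hs _).continuousAt.continuousWithinAt
      have h2 : Continuous fun s : ℝ => Real.exp (-a * s) := by fun_prop
      exact Complex.continuous_ofReal.comp_continuousOn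
        (continuousOn_const.mul (h2.continuousOn.mul h1))
    · have := gap_pos hs
      rw [Complex.norm_real, Real.norm_eq_abs, abs_mul,
        abs_of_nonneg (a := Real.exp (-a * s) * gap s ^ r) (by positivity)]
  set B : ℝ → ℝ := fun x => ‖(Ioi 0).indicator
      (fun s => ((C * (Real.exp (-a * s) * gap s ^ r) : ℝ) : ℂ)) x‖ with hB
  have hBi : ∀ u : L2R, Integrable fun x => B x * ‖u x‖ := fun u =>
    MemLp.integrable_mul (p := 2) (q := 2) hBm.norm (Lp.memLp u).norm
  have hB0 : ∀ x, 0 ≤ B x := fun x => norm_nonneg _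
  have hBpos : ∀ x, 0 < x → B x = |C * (Real.exp (-a * x) * gap x ^ r)| := fun x hx => by
    rw [hB]
    simp only
    rw [indicator_of_mem (show x ∈ Ioi (0 : ℝ) from hx), Complex.norm_real, Real.norm_eq_abs]
  have hgB : ∀ x, 0 < x → |g x| ≤ B x := fun x hx => by
    rw [hBpos x hx]
    exact (hb x hx).trans (le_abs_self _)
  have hgB' : ∀ x, 0 < x → |gap x * g' x| ≤ B x := fun x hx => by
    rw [hBpos x hx]
    exact (hb' x hx).trans (le_abs_self _)
  have hpp : ∀ x, 0 < x → (1 - phi x ^ 2 = gap x) ∧ 2 * phi x * dphi x = -2 * Real.exp (-2 * x) :=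
    fun x hx => by
      refine ⟨by rw [one_sub_phi_sq, abs_of_pos hx], ?_⟩
      rw [phi_of_nonneg hx.le, dphi_of_pos hx, show -2 * x = -x + -x by ring, Real.exp_add]
      ring
  have t1 : Tendsto (fun n => ∫ x, ψ n x • w x) atTop (𝓝 (∫ x in Ioi 0, g x • w x)) := by
    rw [← integral_indicator measurableSet_Ioi]
    refine tendsto_integral_of_dominated_convergence (fun x => B x * ‖w x‖)
      (fun n => (integrable_smul_of_compact (memLp_test (hψsm n) (hψc n)) w).aestronglyMeasurable)
      (hBi w) (fun n => ?_) ?_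
    · filter_upwards [Measure.ae_ne volume 0] with x hx
      rw [norm_smul]
      gcongr
      rcases hx.lt_or_gt with h' | h'
      · rw [hψ0 n x h', norm_zero]
        exact hB0 x
      · rw [hψ]
        simp only
        rw [norm_mul, Real.norm_eq_abs, Real.norm_eq_abs, abs_of_nonneg (cutoff_nonneg _ _)]
        exact (mul_le_of_le_one_left (abs_nonneg _) (cutoff_le_one _ _)).trans (hgB x h')
    · filter_upwards [Measure.ae_ne volume 0] with x hx
      rcases hx.lt_or_gt with h' | h'
      · rw [indicator_of_notMem (show x ∉ Ioi (0 : ℝ) from not_lt.2 h'.le)]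
        simp only [hψ0 _ x h', zero_smul, tendsto_const_nhds]
      · rw [indicator_of_mem (show x ∈ Ioi (0 : ℝ) from h')]
        refine tendsto_const_nhds.congr' ?_
        filter_upwards [eventually_cutoff_eq_one h'] with n hn
        rw [hψ]
        simp only
        rw [hn.1, one_mul]
  have t2 : Tendsto (fun n => ∫ x, ((1 - phi x ^ 2) * deriv (ψ n) x
      - 2 * phi x * dphi x * ψ n x) • v x) atTop
      (𝓝 (∫ x in Ioi 0, (gap x * g' x + 2 * Real.exp (-2 * x) * g x) • v x)) := by
    rw [← integral_indicator measurableSet_Ioi]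
    refine tendsto_integral_of_dominated_convergence (fun x => (5 * M + 3) * (B x * ‖v x‖))
      (fun n => (integrable_smul_of_compact
        (memLp_weighted_test (hψsm n) (hψc n)) v).aestronglyMeasurable)
      ((hBi v).const_mul _) (fun n => ?_) ?_
    · filter_upwards [Measure.ae_ne volume 0] with x hx
      rw [norm_smul, show (5 * M + 3) * (B x * ‖v x‖) = (5 * M + 3) * B x * ‖v x‖ by ring]
      refine mul_le_mul_of_nonneg_right ?_ (norm_nonneg _)
      rcases hx.lt_or_gt with h' | h'
      · rw [hψ0 n x h', hψd0 n x h', mul_zero, mul_zero, sub_zero, norm_zero]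
        have := hB0 x
        positivity
      · obtain ⟨e1, e2⟩ := hpp x h'
        rw [e1, e2, hψd n x h']
        have e3 : gap x * (cutoffDeriv (n + 1) x * g x + cutoff (n + 1) x * g' x)
            - -2 * Real.exp (-2 * x) * ψ n x = gap x * cutoffDeriv (n + 1) x * g x
            + cutoff (n + 1) x * (gap x * g' x)
            + 2 * (Real.exp (-2 * x) * cutoff (n + 1) x) * g x := by
          rw [hψ]; ring
        have c0 := cutoff_nonneg (n + 1) x
        have c1 := cutoff_le_one (n + 1) x
        have E1 : Real.exp (-2 * x) ≤ 1 := Real.exp_le_one_iff.2 (by linarith)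
        rw [e3, Real.norm_eq_abs]
        refine (abs_add_three _ _ _).trans ?_
        have k1 : |gap x * cutoffDeriv (n + 1) x * g x| ≤ 5 * M * B x := by
          rw [abs_mul]
          exact mul_le_mul (gap_mul_cutoffDeriv_le hM0 hM (hn0 n) h') (hgB x h') (abs_nonneg _)
            (by positivity)
        have k2 : |cutoff (n + 1) x * (gap x * g' x)| ≤ 1 * B x := by
          rw [abs_mul, abs_of_nonneg c0]
          exact mul_le_mul c1 (hgB' x h') (abs_nonneg _) zero_le_one
        have k3 : |2 * (Real.exp (-2 * x) * cutoff (n + 1) x) * g x| ≤ 2 * (1 * 1) * B x := by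
          rw [abs_mul, abs_of_nonneg (by positivity)]
          exact mul_le_mul (by gcongr) (hgB x h') (abs_nonneg _) (by norm_num)
        linarith
    · filter_upwards [Measure.ae_ne volume 0] with x hx
      rcases hx.lt_or_gt with h' | h'
      · rw [indicator_of_notMem (show x ∉ Ioi (0 : ℝ) from not_lt.2 h'.le)]
        simp only [hψ0 _ x h', hψd0 _ x h', mul_zero, sub_zero, zero_smul, tendsto_const_nhds]
      · rw [indicator_of_mem (show x ∈ Ioi (0 : ℝ) from h')]
        refine tendsto_const_nhds.congr' ?_
        filter_upwards [eventually_cutoff_eq_one h'] with n hn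
        obtain ⟨e1, e2⟩ := hpp x h'
        rw [e1, e2, hψd n x h', hψ]
        simp only
        rw [hn.1, hn.2]
        congr 1
        ring
  refine tendsto_nhds_unique t1 (t2.neg.congr fun n => ?_)
  exact (h (ψ n) (hψsm n) (hψc n)).symm

/-! ### Eigenfunctions of the adjoint -/

/-- The function `Γ = e^{-μ s} (1 - e^{-2 s})^k`. With `k = (b - 2 - μ) / 2`, the adjoint
eigenfunction is `Γ'' - Γ` on the right half-line. -/
noncomputable def potential (μ k s : ℝ) : ℝ := Real.exp (-μ * s) * gap s ^ k

/-- The first derivative of `potential`. -/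
noncomputable def potentialDeriv (μ k s : ℝ) : ℝ :=
  -μ * (Real.exp (-μ * s) * gap s ^ k) + 2 * k * (Real.exp (-(μ + 2) * s) * gap s ^ (k - 1))

/-- The second derivative of `potential`. -/
noncomputable def potentialDeriv2 (μ k s : ℝ) : ℝ :=
  μ ^ 2 * (Real.exp (-μ * s) * gap s ^ k)
    - 4 * k * (μ + 1) * (Real.exp (-(μ + 2) * s) * gap s ^ (k - 1))
    + 4 * k * (k - 1) * (Real.exp (-(μ + 4) * s) * gap s ^ (k - 2))

/-- The third derivative of `potential`. -/
noncomputable def potentialDeriv3 (μ k s : ℝ) : ℝ :=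
  -μ ^ 3 * (Real.exp (-μ * s) * gap s ^ k)
    + 2 * k * (3 * μ ^ 2 + 6 * μ + 4) * (Real.exp (-(μ + 2) * s) * gap s ^ (k - 1))
    - 12 * k * (k - 1) * (μ + 2) * (Real.exp (-(μ + 4) * s) * gap s ^ (k - 2))
    + 8 * k * (k - 1) * (k - 2) * (Real.exp (-(μ + 6) * s) * gap s ^ (k - 3))

/-- The profile `Γ'' - Γ` of the adjoint eigenfunction. -/
noncomputable def adjointProfile (μ k s : ℝ) : ℝ := potentialDeriv2 μ k s - potential μ k s

theorem hasDerivAt_exp_mul_gap_rpow (μ k : ℝ) {s : ℝ} (hs : 0 < s) :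
    HasDerivAt (fun s => Real.exp (-μ * s) * gap s ^ k)
      (-μ * (Real.exp (-μ * s) * gap s ^ k)
        + 2 * k * (Real.exp (-(μ + 2) * s) * gap s ^ (k - 1))) s := by
  refine ((hasDerivAt_exp_const_mul (-μ) s).mul (hasDerivAt_gap_rpow hs k)).congr_deriv ?_
  rw [show -(μ + 2) * s = -μ * s + -2 * s by ring, Real.exp_add]
  ring

theorem hasDerivAt_potential (μ k : ℝ) {s : ℝ} (hs : 0 < s) :
    HasDerivAt (potential μ k) (potentialDeriv μ k s) s := hasDerivAt_exp_mul_gap_rpow μ k hs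

theorem hasDerivAt_potentialDeriv (μ k : ℝ) {s : ℝ} (hs : 0 < s) :
    HasDerivAt (potentialDeriv μ k) (potentialDeriv2 μ k s) s := by
  refine (((hasDerivAt_exp_mul_gap_rpow μ k hs).const_mul (-μ)).add
    ((hasDerivAt_exp_mul_gap_rpow (μ + 2) (k - 1) hs).const_mul (2 * k))).congr_deriv ?_
  rw [potentialDeriv2, show μ + 2 + 2 = μ + 4 by ring, show k - 1 - 1 = k - 2 by ring]
  ring

theorem hasDerivAt_potentialDeriv2 (μ k : ℝ) {s : ℝ} (hs : 0 < s) :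
    HasDerivAt (potentialDeriv2 μ k) (potentialDeriv3 μ k s) s := by
  refine ((((hasDerivAt_exp_mul_gap_rpow μ k hs).const_mul (μ ^ 2)).sub
    ((hasDerivAt_exp_mul_gap_rpow (μ + 2) (k - 1) hs).const_mul (4 * k * (μ + 1)))).add
    ((hasDerivAt_exp_mul_gap_rpow (μ + 4) (k - 2) hs).const_mul (4 * k * (k - 1)))).congr_deriv ?_
  rw [potentialDeriv3, show μ + 2 + 2 = μ + 4 by ring, show μ + 4 + 2 = μ + 6 by ring,
    show k - 1 - 1 = k - 2 by ring, show k - 2 - 1 = k - 3 by ring]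
  ring

theorem hasDerivAt_adjointProfile (μ k : ℝ) {s : ℝ} (hs : 0 < s) :
    HasDerivAt (adjointProfile μ k) (potentialDeriv3 μ k s - potentialDeriv μ k s) s :=
  (hasDerivAt_potentialDeriv2 μ k hs).sub (hasDerivAt_potential μ k hs)

/-- The formal adjoint equation, written out on the half-line; the term with `Γ' - Γ` comes from the
nonlocal part of `L`. -/
theorem adjointProfile_eq {b μ k s : ℝ} (hk : b = 2 * k + 2 + μ) (hs : 0 < s) :
    gap s * (potentialDeriv3 μ k s - potentialDeriv μ k s)
      + 2 * Real.exp (-2 * s) * adjointProfile μ k s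
      = -(μ * adjointProfile μ k s + (4 - b) * (Real.exp (-2 * s) * adjointProfile μ k s)
        + 4 * (b - 3) * (Real.exp (-2 * s) * (potentialDeriv μ k s - potential μ k s))) := by
  have h2 : gap s ^ (k - 2) = gap s * gap s ^ (k - 3) := by
    rw [← gap_rpow_add_one hs]; ring_nf
  have h1 : gap s ^ (k - 1) = gap s * (gap s * gap s ^ (k - 3)) := by
    rw [← h2, ← gap_rpow_add_one hs]; ring_nf
  have h0 : gap s ^ k = gap s * (gap s * (gap s * gap s ^ (k - 3))) := by
    rw [← h1, ← gap_rpow_add_one hs]; ring_nf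
  have e1 : Real.exp (-(μ + 2) * s) = Real.exp (-μ * s) * Real.exp (-2 * s) := by
    rw [← Real.exp_add]; ring_nf
  have e2 : Real.exp (-(μ + 4) * s) = Real.exp (-μ * s) * Real.exp (-2 * s) ^ 2 := by
    rw [← Real.exp_nat_mul, ← Real.exp_add]; push_cast; ring_nf
  have e3 : Real.exp (-(μ + 6) * s) = Real.exp (-μ * s) * Real.exp (-2 * s) ^ 3 := by
    rw [← Real.exp_nat_mul, ← Real.exp_add]; push_cast; ring_nf
  rw [adjointProfile, potentialDeriv3, potentialDeriv2, potentialDeriv, potential, h0, h1, h2,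
    e1, e2, e3, show Real.exp (-2 * s) = 1 - gap s by rw [gap]; ring, hk]
  ring

theorem contDiffOn_adjointProfile (μ k : ℝ) : ContDiffOn ℝ ∞ (adjointProfile μ k) (Ioi 0) := by
  have h1 : ∀ c p : ℝ, ContDiffOn ℝ ∞ (fun s => Real.exp (c * s) * gap s ^ p) (Ioi 0) :=
    fun c p s hs => by
      have hg : ContDiff ℝ ∞ gap := by unfold gap; fun_prop
      have he : ContDiff ℝ ∞ fun s : ℝ => Real.exp (c * s) := by fun_prop
      exact (he.contDiffAt.mul (hg.contDiffAt.rpow_const_of_ne (gap_pos hs).ne')).contDiffWithinAt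
  exact (((contDiffOn_const.mul (h1 _ _)).sub (contDiffOn_const.mul (h1 _ _))).add
    (contDiffOn_const.mul (h1 _ _))).sub (h1 _ _)

/-- Both `Γ'' - Γ` and the weighted derivative of this function are of order
`e^{-μ s} gap^{k - 2}`. -/
theorem exists_bound_adjointProfile {μ k : ℝ} (hμ : 0 < μ) :
    ∃ C : ℝ, (∀ s, 0 < s → |adjointProfile μ k s| ≤ C * (Real.exp (-μ * s) * gap s ^ (k - 2))) ∧
      ∀ s, 0 < s → |gap s * (potentialDeriv3 μ k s - potentialDeriv μ k s)|
        ≤ C * (Real.exp (-μ * s) * gap s ^ (k - 2)) := by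
  have hT : ∀ j p : ℝ, 0 ≤ j → k - 2 ≤ p → ∀ s, 0 < s →
      |Real.exp (-(μ + j) * s) * gap s ^ p| ≤ Real.exp (-μ * s) * gap s ^ (k - 2) := by
    intro j p hj hp s hs
    have hg := gap_pos hs
    rw [abs_of_nonneg (by positivity)]
    have := gap_rpow_anti hs hp
    gcongr
    nlinarith
  have hT0 : ∀ p : ℝ, k - 2 ≤ p → ∀ s, 0 < s →
      |Real.exp (-μ * s) * gap s ^ p| ≤ Real.exp (-μ * s) * gap s ^ (k - 2) := by
    intro p hp s hs
    simpa using hT 0 p le_rfl hp s hs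
  have hT3 : ∀ s, 0 < s → |gap s * (Real.exp (-(μ + 6) * s) * gap s ^ (k - 3))|
      ≤ Real.exp (-μ * s) * gap s ^ (k - 2) := by
    intro s hs
    have : gap s * (Real.exp (-(μ + 6) * s) * gap s ^ (k - 3))
        = Real.exp (-(μ + 6) * s) * gap s ^ (k - 2) := by
      rw [show k - 2 = k - 3 + 1 by ring, gap_rpow_add_one hs]; ring
    rw [this]
    exact hT 6 _ (by norm_num) le_rfl s hs
  have key : ∀ c x D : ℝ, |x| ≤ D → |c * x| ≤ |c| * D := fun c x D h => by
    rw [abs_mul]; gcongr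
  have hB : ∀ s, 0 < s → 0 ≤ Real.exp (-μ * s) * gap s ^ (k - 2) := fun s hs => by
    have := gap_pos hs
    positivity
  have hgap : ∀ s, 0 < s → ∀ x D : ℝ, |x| ≤ D → |gap s * x| ≤ D := fun s hs x D h => by
    rw [abs_mul, abs_of_pos (gap_pos hs)]
    exact (mul_le_of_le_one_left (abs_nonneg _) (gap_le_one s)).trans h
  have tri : ∀ x y : ℝ, |x + y| ≤ |x| + |y| := abs_add_le
  have tri' : ∀ x y : ℝ, |x - y| ≤ |x| + |y| := abs_sub
  refine ⟨(|μ ^ 2| + |4 * k * (μ + 1)| + |4 * k * (k - 1)| + 1)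
    + (|-μ ^ 3| + |2 * k * (3 * μ ^ 2 + 6 * μ + 4)| + |12 * k * (k - 1) * (μ + 2)|
      + |8 * k * (k - 1) * (k - 2)| + |-μ| + |2 * k|), fun s hs => ?_, fun s hs => ?_⟩
  all_goals
    have a0 := hT0 k (by linarith) s hs
    have a1 := hT 2 (k - 1) (by norm_num) (by linarith) s hs
    have a2 := hT 4 (k - 2) (by norm_num) le_rfl s hs
    have a3 := hT3 s hs
    have hB := hB s hs
    have hgap := hgap s hs
    generalize Real.exp (-μ * s) * gap s ^ (k - 2) = D at *
  · rw [adjointProfile, potentialDeriv2, potential]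
    refine (tri' _ _).trans ((add_le_add ((tri _ _).trans (add_le_add ((tri' _ _).trans
      (add_le_add (key _ _ D a0) (key _ _ D a1))) (key _ _ D a2))) a0).trans ?_)
    have : 0 ≤ (|-μ ^ 3| + |2 * k * (3 * μ ^ 2 + 6 * μ + 4)| + |12 * k * (k - 1) * (μ + 2)|
      + |8 * k * (k - 1) * (k - 2)| + |-μ| + |2 * k|) * D := by positivity
    linarith
  · have e : gap s * (potentialDeriv3 μ k s - potentialDeriv μ k s) =
        -μ ^ 3 * (gap s * (Real.exp (-μ * s) * gap s ^ k))
        + 2 * k * (3 * μ ^ 2 + 6 * μ + 4) * (gap s * (Real.exp (-(μ + 2) * s) * gap s ^ (k - 1)))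
        - 12 * k * (k - 1) * (μ + 2) * (gap s * (Real.exp (-(μ + 4) * s) * gap s ^ (k - 2)))
        + 8 * k * (k - 1) * (k - 2) * (gap s * (Real.exp (-(μ + 6) * s) * gap s ^ (k - 3)))
        - (-μ * (gap s * (Real.exp (-μ * s) * gap s ^ k))
        + 2 * k * (gap s * (Real.exp (-(μ + 2) * s) * gap s ^ (k - 1)))) := by
      rw [potentialDeriv3, potentialDeriv]; ring
    rw [e]
    refine (tri' _ _).trans ((add_le_add ((tri _ _).trans (add_le_add ((tri' _ _).trans
      (add_le_add ((tri _ _).trans (add_le_add (key _ _ D (hgap _ _ a0)) (key _ _ D (hgap _ _ a1))))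
        (key _ _ D (hgap _ _ a2)))) (key _ _ D a3)))
        ((tri _ _).trans (add_le_add (key _ _ D (hgap _ _ a0)) (key _ _ D (hgap _ _ a1))))).trans
        ?_)
    have : 0 ≤ (|μ ^ 2| + |4 * k * (μ + 1)| + |4 * k * (k - 1)| + 1) * D := by positivity
    linarith

theorem continuous_potential (μ : ℝ) {k : ℝ} (hk : 0 ≤ k) : Continuous (potential μ k) := by
  have h1 : Continuous fun s => gap s ^ k := continuous_gap.rpow_const fun _ => Or.inr hk
  unfold potential
  fun_prop

theorem continuous_potentialDeriv (μ : ℝ) {k : ℝ} (hk : 1 ≤ k) :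
    Continuous (potentialDeriv μ k) := by
  have h1 : Continuous fun s => gap s ^ k :=
    continuous_gap.rpow_const fun _ => Or.inr (by linarith)
  have h2 : Continuous fun s => gap s ^ (k - 1) :=
    continuous_gap.rpow_const fun _ => Or.inr (by linarith)
  unfold potentialDeriv
  fun_prop

theorem potential_zero (μ : ℝ) {k : ℝ} (hk : 1 < k) : potential μ k 0 = 0 := by
  rw [potential, gap_zero, Real.zero_rpow (by linarith), mul_zero]

theorem potentialDeriv_zero (μ : ℝ) {k : ℝ} (hk : 1 < k) : potentialDeriv μ k 0 = 0 := by
  rw [potentialDeriv, gap_zero, Real.zero_rpow (by linarith), Real.zero_rpow (by linarith)]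
  ring

theorem potential_pos (μ k : ℝ) {s : ℝ} (hs : 0 < s) : 0 < potential μ k s :=
  mul_pos (Real.exp_pos _) (Real.rpow_pos_of_pos (gap_pos hs) _)

theorem tendsto_potential {μ : ℝ} (hμ : 0 < μ) (k : ℝ) :
    Tendsto (potential μ k) atTop (𝓝 0) := tendsto_exp_mul_gap_rpow hμ k

theorem tendsto_potentialDeriv {μ : ℝ} (hμ : 0 < μ) (k : ℝ) :
    Tendsto (potentialDeriv μ k) atTop (𝓝 0) := by
  have := ((tendsto_exp_mul_gap_rpow hμ k).const_mul (-μ)).add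
    ((tendsto_exp_mul_gap_rpow (show 0 < μ + 2 by linarith) (k - 1)).const_mul (2 * k))
  rw [mul_zero, mul_zero, add_zero] at this
  exact this

section

variable {μ k : ℝ}

theorem memLp_adjointProfile (hμ : 0 < μ) (hk : 3 / 2 < k) :
    MemLp ((Ioi 0).indicator fun s => (adjointProfile μ k s : ℂ)) 2 volume := by
  obtain ⟨C, hC, -⟩ := exists_bound_adjointProfile (μ := μ) (k := k) hμ
  refine memLp_indicator_Ioi (C := C) (a := μ) (r := k - 2) ?_ hμ (by linarith) fun s hs => ?_
  · exact Complex.continuous_ofReal.comp_continuousOn (contDiffOn_adjointProfile μ k).continuousOn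
  · rw [Complex.norm_real]
    exact hC s hs

/-- `Γ'' - Γ` on the right half-line, as an element of `L²(ℝ)`. -/
noncomputable def adjointL (hμ : 0 < μ) (hk : 3 / 2 < k) : L2R :=
  (memLp_adjointProfile hμ hk).toLp

theorem inner_adjointL (hμ : 0 < μ) (hk : 3 / 2 < k) (u : L2R) :
    inner ℂ (adjointL hμ hk) u = ∫ x in Ioi 0, adjointProfile μ k x • u x := by
  rw [L2.inner_def, ← integral_indicator measurableSet_Ioi]
  refine integral_congr_ae ?_
  filter_upwards [(memLp_adjointProfile hμ hk).coeFn_toLp] with x hx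
  rw [adjointL, hx]
  by_cases h : x ∈ Ioi (0 : ℝ)
  · rw [indicator_of_mem h, indicator_of_mem h]
    simp [mul_comm]
  · rw [indicator_of_notMem h, indicator_of_notMem h, inner_zero_left]

theorem integrable_adjointProfile_smul (hμ : 0 < μ) (hk : 3 / 2 < k) (u : L2R) :
    IntegrableOn (fun x => adjointProfile μ k x • u x) (Ioi 0) := by
  rw [← integrable_indicator_iff measurableSet_Ioi]
  refine (MemLp.integrable_mul (p := 2) (q := 2) (memLp_adjointProfile hμ hk)
    (Lp.memLp u)).congr (Eventually.of_forall fun x => ?_)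
  by_cases h : x ∈ Ioi (0 : ℝ)
  · simp [indicator_of_mem h]
  · simp [indicator_of_notMem h]

/-- A bounded continuous factor may be inserted. -/
theorem integrable_mul_adjointProfile_smul (hμ : 0 < μ) (hk : 3 / 2 < k) {c : ℝ → ℝ}
    (hc : Continuous c) (hc1 : ∀ x, 0 < x → |c x| ≤ 1) (u : L2R) :
    IntegrableOn (fun x => (c x * adjointProfile μ k x) • u x) (Ioi 0) := by
  refine Integrable.mono (integrable_adjointProfile_smul hμ hk u) ?_ ?_
  · have := (integrable_adjointProfile_smul hμ hk u).aestronglyMeasurable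
    refine (hc.aestronglyMeasurable.smul this).congr (Eventually.of_forall fun x => ?_)
    simp [mul_smul]
  · refine (ae_restrict_iff' measurableSet_Ioi).2 (Eventually.of_forall fun x hx => ?_)
    rw [mul_smul, norm_smul]
    exact mul_le_of_le_one_left (norm_nonneg _) (hc1 x hx)

theorem integrableOn_exp_mul_adjointProfile (hμ : 0 < μ) (hk : 3 / 2 < k) {c : ℝ} (hc : c ≤ 0) :
    IntegrableOn (fun x => Real.exp (c * x) * adjointProfile μ k x) (Ioi 0) := by
  obtain ⟨C, hC, -⟩ := exists_bound_adjointProfile (μ := μ) (k := k) hμ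
  have h := (integrableOn_exp_mul_gap_rpow hμ (show -1 < k - 2 by linarith)).const_mul C
  refine h.mono' ?_ ?_
  · exact ((by fun_prop : Continuous fun x : ℝ => Real.exp (c * x)).continuousOn.mul
      (contDiffOn_adjointProfile μ k).continuousOn).aestronglyMeasurable measurableSet_Ioi
  · refine (ae_restrict_iff' measurableSet_Ioi).2 (Eventually.of_forall fun x hx => ?_)
    rw [norm_mul, Real.norm_eq_abs, Real.abs_exp]
    refine (mul_le_of_le_one_left (norm_nonneg _) (Real.exp_le_one_iff.2 ?_)).trans (hC x hx)
    have : 0 < x := hx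
    nlinarith

theorem hasDerivAt_exp_mul_potential_sub {s : ℝ} (hs : 0 < s) :
    HasDerivAt (fun s => Real.exp s * (potentialDeriv μ k s - potential μ k s))
      (Real.exp s * adjointProfile μ k s) s := by
  refine ((Real.hasDerivAt_exp s).mul ((hasDerivAt_potentialDeriv μ k hs).sub
    (hasDerivAt_potential μ k hs))).congr_deriv ?_
  simp only [adjointProfile, Pi.sub_apply]
  ring

/-- The profile is orthogonal to `e^{-x}`, the decaying solution of `u'' = u`. -/
theorem integral_exp_neg_mul_adjointProfile (hμ : 0 < μ) (hk : 3 / 2 < k) :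
    ∫ x in Ioi 0, Real.exp (-1 * x) * adjointProfile μ k x = 0 := by
  have hd : ∀ s ∈ Ioi (0 : ℝ), HasDerivAt
      (fun s => Real.exp (-1 * s) * (potentialDeriv μ k s + potential μ k s))
      (Real.exp (-1 * s) * adjointProfile μ k s) s := fun s hs => by
    refine ((hasDerivAt_exp_const_mul (-1) s).mul ((hasDerivAt_potentialDeriv μ k hs).add
      (hasDerivAt_potential μ k hs))).congr_deriv ?_
    simp only [adjointProfile, Pi.add_apply]
    ring
  have h1 := continuous_potential μ (k := k) (by linarith)
  have h2 := continuous_potentialDeriv μ (k := k) (by linarith)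
  have hlim := (tendsto_exp_neg_mul one_pos).mul
    ((tendsto_potentialDeriv hμ k).add (tendsto_potential hμ k))
  rw [integral_Ioi_of_hasDerivAt_of_tendsto (by fun_prop) hd
    (integrableOn_exp_mul_adjointProfile hμ hk (by norm_num)) hlim,
    potential_zero μ (by linarith), potentialDeriv_zero μ (by linarith)]
  ring

theorem integral_exp_mul_adjointProfile (hμ : 0 < μ) (hk : 3 / 2 < k) {y : ℝ} (hy : 0 < y) :
    ∫ x in (0 : ℝ)..y, Real.exp x * adjointProfile μ k x
      = Real.exp y * (potentialDeriv μ k y - potential μ k y) := by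
  have h1 := continuous_potential μ (k := k) (by linarith)
  have h2 := continuous_potentialDeriv μ (k := k) (by linarith)
  have hi : IntervalIntegrable (fun x => Real.exp x * adjointProfile μ k x) volume 0 y := by
    have h0 : IntervalIntegrable (fun x => Real.exp (0 * x) * adjointProfile μ k x) volume 0 y :=
      (intervalIntegrable_iff_integrableOn_Ioc_of_le hy.le).2
        ((integrableOn_exp_mul_adjointProfile hμ hk le_rfl).mono_set Ioc_subset_Ioi_self)
    have := h0.continuousOn_mul (g := Real.exp) Real.continuous_exp.continuousOn
    simpa using this
  rw [intervalIntegral.integral_eq_sub_of_hasDerivAt_of_le hy.le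
    (f := fun s => Real.exp s * (potentialDeriv μ k s - potential μ k s)) (by fun_prop)
    (fun s hs => hasDerivAt_exp_mul_potential_sub hs.1) hi,
    potential_zero μ (by linarith), potentialDeriv_zero μ (by linarith)]
  ring

/-- The integrand of the pairing of the profile with the nonlocal part of `L`. On `x < y` the factor
`e^{x - 2 y}` is at most `1`, which leaves a product of integrable functions. -/
theorem integrable_kernel_adjointProfile (hμ : 0 < μ) (hk : 3 / 2 < k) (u : L2R) :
    Integrable (fun p : ℝ × ℝ => {p : ℝ × ℝ | p.1 < p.2}.indicator
      (fun p => (Real.exp p.1 * adjointProfile μ k p.1) • Real.exp (-3 * p.2) • u p.2) p)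
      ((volume.restrict (Ioi 0)).prod (volume.restrict (Ioi 0))) := by
  have hg := integrableOn_exp_mul_adjointProfile hμ hk le_rfl
  have hu : IntegrableOn (fun y => phi y * ‖u y‖) (Ioi 0) := (integrable_phi_norm u).integrableOn
  refine (hg.norm.mul_prod hu).mono' ?_ ?_
  · refine AEStronglyMeasurable.indicator ?_ (measurableSet_lt measurable_fst measurable_snd)
    have h1 : AEStronglyMeasurable (fun x => Real.exp x * adjointProfile μ k x)
        (volume.restrict (Ioi 0)) :=
      (Real.continuous_exp.continuousOn.mul
        (contDiffOn_adjointProfile μ k).continuousOn).aestronglyMeasurable measurableSet_Ioi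
    have h2 : AEStronglyMeasurable (fun y => Real.exp (-3 * y) • u y) (volume.restrict (Ioi 0)) :=
      ((by fun_prop : Continuous fun y : ℝ => Real.exp (-3 * y)).aestronglyMeasurable.smul
        (Lp.memLp u).1).restrict
    exact h1.comp_fst.smul h2.comp_snd
  · rw [Measure.prod_restrict]
    refine (ae_restrict_iff' (measurableSet_Ioi.prod measurableSet_Ioi)).2
      (Eventually.of_forall fun p hp => ?_)
    have hy : 0 < p.2 := hp.2
    by_cases h : p ∈ {p : ℝ × ℝ | p.1 < p.2}
    · have h' : p.1 < p.2 := h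
      rw [indicator_of_mem h, norm_smul, norm_smul, norm_mul, norm_mul, Real.norm_eq_abs,
        Real.norm_eq_abs (Real.exp _), Real.norm_eq_abs (Real.exp _), Real.abs_exp, Real.abs_exp,
        Real.abs_exp, phi_of_nonneg hy.le]
      have : Real.exp p.1 * Real.exp (-3 * p.2) ≤ Real.exp (0 * p.1) * Real.exp (-p.2) := by
        rw [← Real.exp_add, ← Real.exp_add, Real.exp_le_exp]; linarith
      calc _ = (Real.exp p.1 * Real.exp (-3 * p.2)) * (‖adjointProfile μ k p.1‖ * ‖u p.2‖) := by
            rw [Real.norm_eq_abs]; ring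
        _ ≤ (Real.exp (0 * p.1) * Real.exp (-p.2)) * (‖adjointProfile μ k p.1‖ * ‖u p.2‖) := by
            gcongr
        _ = _ := by rw [Real.norm_eq_abs]; ring
    · rw [indicator_of_notMem h, norm_zero]
      have := phi_pos p.2
      positivity

/-- The nonlocal part of `L` paired with the profile, with the order of integration exchanged. -/
theorem integral_kernel_adjointProfile (hμ : 0 < μ) (hk : 3 / 2 < k) (u : L2R) :
    IntegrableOn (fun x => (Real.exp x * adjointProfile μ k x) •
        ∫ y in Ioi x, Real.exp (-3 * y) • u y) (Ioi 0) ∧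
      IntegrableOn (fun y =>
        (Real.exp (-2 * y) * (potentialDeriv μ k y - potential μ k y)) • u y) (Ioi 0) ∧
      ∫ x in Ioi 0, (Real.exp x * adjointProfile μ k x) •
          ∫ y in Ioi x, Real.exp (-3 * y) • u y
        = ∫ y in Ioi 0, (Real.exp (-2 * y) * (potentialDeriv μ k y - potential μ k y)) • u y := by
  have h := integrable_kernel_adjointProfile hμ hk u
  have h1 : ∀ x ∈ Ioi (0 : ℝ), ∫ y in Ioi 0, {p : ℝ × ℝ | p.1 < p.2}.indicator
      (fun p => (Real.exp p.1 * adjointProfile μ k p.1) • Real.exp (-3 * p.2) • u p.2) (x, y)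
      = (Real.exp x * adjointProfile μ k x) • ∫ y in Ioi x, Real.exp (-3 * y) • u y := by
    intro x hx
    have hx : 0 < x := hx
    rw [← integral_smul, show Ioi x = Ioi 0 ∩ Ioi x by
      rw [Ioi_inter_Ioi, max_eq_right hx.le], ← setIntegral_indicator measurableSet_Ioi]
    rfl
  have h2 : ∀ y ∈ Ioi (0 : ℝ), ∫ x in Ioi 0, {p : ℝ × ℝ | p.1 < p.2}.indicator
      (fun p => (Real.exp p.1 * adjointProfile μ k p.1) • Real.exp (-3 * p.2) • u p.2) (x, y)
      = (Real.exp (-2 * y) * (potentialDeriv μ k y - potential μ k y)) • u y := by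
    intro y hy
    have e : (Real.exp (-2 * y) * (potentialDeriv μ k y - potential μ k y)) • u y
        = (∫ x in (0 : ℝ)..y, Real.exp x * adjointProfile μ k x) • Real.exp (-3 * y) • u y := by
      rw [integral_exp_mul_adjointProfile hμ hk hy, smul_smul,
        show -2 * y = y + -3 * y by ring, Real.exp_add]
      ring_nf
    rw [e, intervalIntegral.integral_of_le (le_of_lt hy), integral_Ioc_eq_integral_Ioo,
      ← integral_smul_const, ← Ioi_inter_Iio, ← setIntegral_indicator measurableSet_Iio]
    rfl
  refine ⟨?_, ?_, ?_⟩
  · exact h.integral_prod_left.congr ((ae_restrict_iff' measurableSet_Ioi).2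
      (Eventually.of_forall h1))
  · exact h.integral_prod_right.congr ((ae_restrict_iff' measurableSet_Ioi).2
      (Eventually.of_forall h2))
  · rw [← setIntegral_congr_fun measurableSet_Ioi h1, ← setIntegral_congr_fun measurableSet_Ioi h2]
    exact integral_integral_swap h

/-- The pairing with the values of `v` on `x < 0` drops out, because the profile is orthogonal to
`e^{-x}`; on `x > 0` the identity is the formal adjoint equation. -/
theorem inner_adjointL_L {b : ℝ} (hμ : 0 < μ) (hk : 3 / 2 < k) (hb : b = 2 * k + 2 + μ)
    (v : (L b).domain) :
    inner ℂ (adjointL hμ hk) (L b v) = μ * inner ℂ (adjointL hμ hk) (v : L2R) := by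
  obtain ⟨C, hC, hC'⟩ := exists_bound_adjointProfile (μ := μ) (k := k) hμ
  obtain ⟨hN1, hN2, hN⟩ := integral_kernel_adjointProfile hμ hk (v : L2R)
  have hW := (weightedDeriv_spec v).integral_Ioi hμ (r := k - 2) (by linarith)
    (contDiffOn_adjointProfile μ k) (fun s hs => hasDerivAt_adjointProfile μ k hs) hC hC'
  set A : ℂ := ∫ y in Iio 0, Real.exp (3 * y) • (v : L2R) y with hA
  have hE : Continuous fun x : ℝ => Real.exp (-2 * x) := by fun_prop
  have hE1 : ∀ x : ℝ, 0 < x → |Real.exp (-2 * x)| ≤ 1 := fun x hx => by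
    rw [Real.abs_exp, Real.exp_le_one_iff]; linarith
  have iW := integrable_adjointProfile_smul hμ hk (weightedDeriv v)
  have iM := integrable_mul_adjointProfile_smul hμ hk hE hE1 (v : L2R)
  have iG := integrable_adjointProfile_smul hμ hk (v : L2R)
  have iA : IntegrableOn (fun x => (Real.exp (-1 * x) * adjointProfile μ k x) • A) (Ioi 0) :=
    (integrableOn_exp_mul_adjointProfile hμ hk (by norm_num)).smul_const A
  have zA : ∫ x in Ioi 0, (Real.exp (-1 * x) * adjointProfile μ k x) • A = 0 := by
    rw [integral_smul_const, integral_exp_neg_mul_adjointProfile hμ hk, zero_smul]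
  have e1 : ∫ x in Ioi 0, adjointProfile μ k x • (L b v) x
      = ∫ x in Ioi 0, (adjointProfile μ k x • weightedDeriv v x
        + (-(4 - b)) • ((Real.exp (-2 * x) * adjointProfile μ k x) • (v : L2R) x)
        + (4 * (b - 3)) • ((Real.exp (-1 * x) * adjointProfile μ k x) • A
          - (Real.exp x * adjointProfile μ k x) •
            ∫ y in Ioi x, Real.exp (-3 * y) • (v : L2R) y)) := by
    refine setIntegral_congr_ae measurableSet_Ioi ?_
    filter_upwards [L_apply_ae b v] with x hx h0
    have h0 : 0 < x := h0
    rw [hx, QFun_eq, min_eq_right h0.le, max_eq_left h0.le, phi_of_nonneg h0.le, dphi_of_pos h0,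
      ← hA, show -2 * x = -x + -x by ring, Real.exp_add, neg_one_mul]
    module
  have hlin : ∀ {f₁ f₂ f₃ f₄ : ℝ → ℂ} (p q : ℝ), IntegrableOn f₁ (Ioi 0) → IntegrableOn f₂ (Ioi 0) →
      IntegrableOn f₃ (Ioi 0) → IntegrableOn f₄ (Ioi 0) →
      ∫ x in Ioi 0, (f₁ x + p • f₂ x + q • (f₃ x - f₄ x)) = (∫ x in Ioi 0, f₁ x)
        + p • (∫ x in Ioi 0, f₂ x) + q • ((∫ x in Ioi 0, f₃ x) - ∫ x in Ioi 0, f₄ x) := by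
    intro f₁ f₂ f₃ f₄ p q h₁ h₂ h₃ h₄
    have i₂ : IntegrableOn (fun x => p • f₂ x) (Ioi 0) := h₂.smul p
    have i₃ : IntegrableOn (fun x => q • (f₃ x - f₄ x)) (Ioi 0) := (h₃.sub h₄).smul q
    have i₁ : IntegrableOn (fun x => f₁ x + p • f₂ x) (Ioi 0) := h₁.add i₂
    rw [integral_add i₁ i₃, integral_add h₁ i₂, integral_smul, integral_smul, integral_sub h₃ h₄]
  have e2 : ∫ x in Ioi 0, (gap x * (potentialDeriv3 μ k x - potentialDeriv μ k x)
        + 2 * Real.exp (-2 * x) * adjointProfile μ k x) • (v : L2R) x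
      = ∫ x in Ioi 0, ((-μ) • (adjointProfile μ k x • (v : L2R) x)
        + (-(4 - b)) • ((Real.exp (-2 * x) * adjointProfile μ k x) • (v : L2R) x)
        + (4 * (b - 3)) • ((0 : ℂ) - (Real.exp (-2 * x) *
          (potentialDeriv μ k x - potential μ k x)) • (v : L2R) x)) := by
    refine setIntegral_congr_fun measurableSet_Ioi fun x hx => ?_
    rw [adjointProfile_eq hb hx]
    module
  rw [inner_adjointL, inner_adjointL, e1]
  refine (hlin _ _ iW iM iA hN1).trans ?_
  rw [zA, hN, hW, e2]
  refine (congrArg (fun c => -c + _ + _)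
    (hlin _ _ (iG.smul (-μ)) iM integrableOn_zero hN2)).trans ?_
  simp only [Pi.smul_apply, integral_smul, integral_zero]
  rw [← Complex.real_smul]
  module

theorem adjointL_isEigenfunction {b : ℝ} (hμ : 0 < μ) (hk : 3 / 2 < k) (hb : b = 2 * k + 2 + μ)
    (h0 : adjointL hμ hk ≠ 0) : IsEigenfunction (L b).adjoint μ (adjointL hμ hk) := by
  have hd : Dense ((L b).domain : Set L2R) := domL_dense
  have h : ∀ v : (L b).domain, inner ℂ ((μ : ℂ) • adjointL hμ hk) (v : L2R)
      = inner ℂ (adjointL hμ hk) (L b v) := fun v => by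
    rw [inner_adjointL_L hμ hk hb, inner_smul_left, Complex.conj_ofReal]
  have hm : adjointL hμ hk ∈ (L b).adjoint.domain :=
    LinearPMap.mem_adjoint_domain_of_exists _ ⟨_, h⟩
  exact ⟨h0, hm, LinearPMap.adjoint_apply_eq hd ⟨_, hm⟩ h⟩

theorem inner_adjointL_of_lMaps {b : ℝ} (hμ : 0 < μ) (hk : 3 / 2 < k) (hb : b = 2 * k + 2 + μ)
    {v R : L2R} (h : LMaps b v R) :
    inner ℂ (adjointL hμ hk) R = μ * inner ℂ (adjointL hμ hk) v := by
  obtain ⟨hv, rfl⟩ := h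
  exact inner_adjointL_L hμ hk hb ⟨v, hv⟩

/-- The span of `φ` and `φ'` is invariant under `L` with eigenvalues `±√((b - 2)(4 - b))`, so an
eigenfunction of the adjoint for any other eigenvalue annihilates it. -/
theorem inner_adjointL_phi {b : ℝ} (hμ : 0 < μ) (hk : 3 / 2 < k) (hb : b = 2 * k + 2 + μ) :
    inner ℂ (adjointL hμ hk) phiL = 0 ∧ inner ℂ (adjointL hμ hk) dphiL = 0 := by
  have h1 := inner_adjointL_of_lMaps hμ hk hb (lMaps_phiL b)
  have h2 := inner_adjointL_of_lMaps hμ hk hb (lMaps_dphiL b)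
  rw [inner_smul_right] at h1 h2
  have hne : (μ : ℂ) ^ 2 - (b - 2) * (4 - b) ≠ 0 := by
    have : μ ^ 2 - (b - 2) * (4 - b) ≠ 0 := by nlinarith
    exact_mod_cast this
  have hμ' : (μ : ℂ) ≠ 0 := by exact_mod_cast hμ.ne'
  have hp : inner ℂ (adjointL hμ hk) phiL = 0 := by
    refine (mul_eq_zero.1 (?_ : ((μ : ℂ) ^ 2 - (b - 2) * (4 - b)) * _ = 0)).resolve_left hne
    linear_combination (-(μ : ℂ)) * h1 - (4 - b : ℂ) * h2
  refine ⟨hp, ?_⟩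
  rw [hp, mul_zero] at h2
  exact (mul_eq_zero.1 h2.symm).resolve_left hμ'

theorem inner_adjointL_evolution {b : ℝ} (hμ : 0 < μ) (hk : 3 / 2 < k) (hb : b = 2 * k + 2 + μ)
    {z : ℝ → L2R} (hz : SolvesEvolution b z) (t : ℝ) :
    inner ℂ (adjointL hμ hk) (z t) = Real.exp (μ * t) * inner ℂ (adjointL hμ hk) (z 0) := by
  obtain ⟨R, -, hR⟩ := hz.lMaps
  set w := adjointL hμ hk
  have hd : ∀ t : ℝ, HasDerivAt
      (fun t : ℝ => ((Real.exp (-μ * t) : ℝ) : ℂ) * inner ℂ w (z t)) 0 t := by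
    intro t
    have h1 : HasDerivAt (fun t => inner ℂ w (z t)) (inner ℂ w (R t)) t := by
      simpa using (hasDerivAt_const t w).inner ℂ (hR t).2
    refine ((hasDerivAt_exp_const_mul (-μ) t).ofReal_comp.mul h1).congr_deriv ?_
    rw [inner_adjointL_of_lMaps hμ hk hb (hR t).1]
    push_cast
    ring
  have hc := is_const_of_deriv_eq_zero (fun t => (hd t).differentiableAt)
    (fun t => (hd t).deriv) t 0
  simp only [mul_zero, Real.exp_zero, Complex.ofReal_one, one_mul] at hc
  rw [← hc, ← mul_assoc, ← Complex.ofReal_mul, ← Real.exp_add, show μ * t + -μ * t = 0 by ring,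
    Real.exp_zero, Complex.ofReal_one, one_mul]

end

/-! ### Explicit solutions of the evolution equation -/

/-- The function `x ↦ sinh (y - x)` on `(0, y)`, extended by zero. The family of these functions is
invariant under `L` up to transport of the right endpoint `y` and multiples of `φ + φ'`. -/
noncomputable def bump (y x : ℝ) : ℝ := if 0 < x then Real.sinh (max (y - x) 0) else 0

/-- The derivative of `bump` with respect to `y`. -/
noncomputable def bumpDeriv (y x : ℝ) : ℝ := if 0 < x ∧ x < y then Real.cosh (y - x) else 0

theorem measurable_bump (y : ℝ) : Measurable (bump y) :=
  Measurable.ite measurableSet_Ioi (by fun_prop) measurable_const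

theorem measurable_bumpDeriv (y : ℝ) : Measurable (bumpDeriv y) :=
  Measurable.ite measurableSet_Ioo (by fun_prop) measurable_const

theorem bump_of_nonpos {y x : ℝ} (h : x ≤ 0) : bump y x = 0 := if_neg h.not_gt

theorem bump_of_le {y x : ℝ} (h : y ≤ x) : bump y x = 0 := by
  rw [bump, max_eq_right (by linarith), Real.sinh_zero, ite_self]

theorem bump_of_mem {y x : ℝ} (h0 : 0 < x) (h : x ≤ y) : bump y x = Real.sinh (y - x) := by
  rw [bump, if_pos h0, max_eq_left (by linarith)]

theorem bumpDeriv_of_nonpos {y x : ℝ} (h : x ≤ 0) : bumpDeriv y x = 0 :=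
  if_neg fun h' => h'.1.not_ge h

theorem bumpDeriv_of_le {y x : ℝ} (h : y ≤ x) : bumpDeriv y x = 0 :=
  if_neg fun h' => h'.2.not_ge h

theorem bumpDeriv_of_mem {y x : ℝ} (h0 : 0 < x) (h : x < y) :
    bumpDeriv y x = Real.cosh (y - x) := if_pos ⟨h0, h⟩

theorem memLp_box (C Y : ℝ) : MemLp ((Ioo 0 Y).indicator fun _ => C) 2 volume :=
  memLp_indicator_const 2 measurableSet_Ioo C (Or.inr (by simp))

theorem abs_bumpDeriv_le {y Y : ℝ} (h : y ≤ Y) (x : ℝ) :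
    |bumpDeriv y x| ≤ (Ioo 0 Y).indicator (fun _ => Real.cosh Y) x := by
  by_cases h0 : 0 < x ∧ x < y
  · rw [bumpDeriv_of_mem h0.1 h0.2, indicator_of_mem (show x ∈ Ioo 0 Y from
      ⟨h0.1, h0.2.trans_le h⟩), abs_of_pos (Real.cosh_pos _),
      Real.cosh_le_cosh, abs_of_pos (by linarith), abs_of_pos (by linarith)]
    linarith
  · rw [bumpDeriv, if_neg h0, abs_zero]
    exact indicator_nonneg (fun _ _ => (Real.cosh_pos _).le) _

/-- A Lipschitz bound in `y`, with a constant that is square integrable as a function of `x`. -/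
theorem abs_bump_sub_le {y y' Y : ℝ} (h : y ≤ Y) (h' : y' ≤ Y) (x : ℝ) :
    |bump y x - bump y' x| ≤ (Ioo 0 Y).indicator (fun _ => Real.cosh Y) x * |y - y'| := by
  by_cases h0 : x ∈ Ioo 0 Y
  · rw [indicator_of_mem h0, bump, bump, if_pos h0.1, if_pos h0.1]
    have hY : 0 < Y - x := by linarith [h0.2]
    have hx : 0 < x := h0.1
    have key := Convex.norm_image_sub_le_of_norm_hasDerivWithin_le (f := Real.sinh)
      (f' := Real.cosh) (s := Icc 0 (Y - x)) (C := Real.cosh Y)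
      (fun u _ => (Real.hasDerivAt_sinh u).hasDerivWithinAt)
      (fun u hu => by
        rw [Real.norm_eq_abs, abs_of_pos (Real.cosh_pos _), Real.cosh_le_cosh, abs_of_nonneg hu.1,
          abs_of_pos (by linarith)]
        linarith [hu.2]) (convex_Icc _ _) (x := max (y' - x) 0) (y := max (y - x) 0)
      ⟨le_max_right _ _, max_le (by linarith) hY.le⟩
      ⟨le_max_right _ _, max_le (by linarith) hY.le⟩
    refine key.trans (mul_le_mul_of_nonneg_left ?_ (Real.cosh_pos _).le)
    refine (abs_max_sub_max_le_abs _ _ _).trans (le_of_eq ?_)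
    ring_nf
  · rw [indicator_of_notMem h0, zero_mul]
    rw [mem_Ioo, not_and_or, not_lt, not_lt] at h0
    rcases h0 with h0 | h0
    · rw [bump_of_nonpos h0, bump_of_nonpos h0, sub_zero, abs_zero]
    · rw [bump_of_le (h.trans h0), bump_of_le (h'.trans h0), sub_zero, abs_zero]

theorem memLp_bump (y : ℝ) : MemLp (fun x => (bump y x : ℂ)) 2 volume := by
  refine (memLp_box (Real.cosh (max y 0) * |y - min y 0|) (max y 0)).mono
    (Complex.measurable_ofReal.comp (measurable_bump y)).aestronglyMeasurable
    (Eventually.of_forall fun x => ?_)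
  have h := abs_bump_sub_le (le_max_left y 0) ((min_le_left y 0).trans (le_max_left y 0)) x
  have h0 : bump (min y 0) x = 0 := by
    rcases le_or_gt x 0 with hx | hx
    · exact bump_of_nonpos hx
    · exact bump_of_le ((min_le_right y 0).trans hx.le)
  rw [h0, sub_zero] at h
  rw [Complex.norm_real]
  refine h.trans (le_trans (le_of_eq ?_) (le_abs_self _))
  by_cases hx : x ∈ Ioo 0 (max y 0)
  · rw [indicator_of_mem hx, indicator_of_mem hx]
  · rw [indicator_of_notMem hx, indicator_of_notMem hx, zero_mul]

theorem memLp_bumpDeriv (y : ℝ) : MemLp (fun x => (bumpDeriv y x : ℂ)) 2 volume := by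
  refine (memLp_box (Real.cosh y) y).mono
    (Complex.measurable_ofReal.comp (measurable_bumpDeriv y)).aestronglyMeasurable
    (Eventually.of_forall fun x => ?_)
  rw [Complex.norm_real]
  exact (abs_bumpDeriv_le le_rfl x).trans (le_abs_self _)

/-- `bump y` as an element of `L²(ℝ)`. -/
noncomputable def bumpL (y : ℝ) : L2R := (memLp_bump y).toLp

/-- `bumpDeriv y` as an element of `L²(ℝ)`. -/
noncomputable def bumpDerivL (y : ℝ) : L2R := (memLp_bumpDeriv y).toLp

theorem coeFn_bumpL (y : ℝ) : bumpL y =ᵐ[volume] fun x => (bump y x : ℂ) := MemLp.coeFn_toLp _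

theorem coeFn_bumpDerivL (y : ℝ) : bumpDerivL y =ᵐ[volume] fun x => (bumpDeriv y x : ℂ) :=
  MemLp.coeFn_toLp _

theorem norm_sq_eq_integral (u : L2R) : ‖u‖ ^ 2 = ∫ x, ‖u x‖ ^ 2 := by
  have h : ((‖u‖ ^ 2 : ℝ) : ℂ) = ((∫ x, ‖u x‖ ^ 2 : ℝ) : ℂ) := by
    rw [Complex.ofReal_pow, ← integral_complex_ofReal]
    refine (inner_self_eq_norm_sq_to_K (𝕜 := ℂ) u).symm.trans ?_
    rw [L2.inner_def]
    refine integral_congr_ae (Eventually.of_forall fun x => ?_)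
    simp only [inner_self_eq_norm_sq_to_K]
    push_cast
    rfl
  exact_mod_cast h

/-- Dominated convergence in `L²(ℝ)`. -/
theorem tendsto_of_dominated {ι : Type*} {l : Filter ι} [l.IsCountablyGenerated] {F : ι → L2R}
    {G : L2R} {f : ι → ℝ → ℂ} {g : ℝ → ℂ} {B : ℝ → ℝ} (hF : ∀ i, F i =ᵐ[volume] f i)
    (hG : G =ᵐ[volume] g) (hB : MemLp B 2 volume) (hle : ∀ᶠ i in l, ∀ᵐ x, ‖f i x - g x‖ ≤ B x)
    (hlim : ∀ᵐ x, Tendsto (fun i => f i x) l (𝓝 (g x))) : Tendsto F l (𝓝 G) := by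
  have hn : ∀ i, ‖F i - G‖ ^ 2 = ∫ x, ‖f i x - g x‖ ^ 2 := fun i => by
    rw [norm_sq_eq_integral]
    refine integral_congr_ae ?_
    filter_upwards [Lp.coeFn_sub (F i) G, hF i, hG] with x h1 h2 h3
    rw [h1, Pi.sub_apply, h2, h3]
  have hm : ∀ i, AEStronglyMeasurable (fun x => ‖f i x - g x‖ ^ 2) volume := fun i =>
    ((((Lp.memLp (F i)).1.congr (hF i)).sub ((Lp.memLp G).1.congr hG)).norm.pow 2)
  have h : Tendsto (fun i => ‖F i - G‖ ^ 2) l (𝓝 0) := by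
    simp_rw [hn]
    rw [show (0 : ℝ) = ∫ _ : ℝ, (0 : ℝ) by simp]
    refine tendsto_integral_filter_of_dominated_convergence (fun x => B x ^ 2)
      (Eventually.of_forall hm) ?_ ((memLp_two_iff_integrable_sq hB.1).1 hB) ?_
    · filter_upwards [hle] with i hi
      filter_upwards [hi] with x hx
      rw [norm_pow, norm_norm]
      gcongr
    · filter_upwards [hlim] with x hx
      have := ((hx.sub_const (g x)).norm).pow 2
      simpa using this
  rw [tendsto_iff_norm_sub_tendsto_zero]
  have := h.sqrt
  simpa [Real.sqrt_sq] using this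

theorem continuousAt_bumpDeriv {y x : ℝ} (h : x ≠ y) : ContinuousAt (fun y => bumpDeriv y x) y := by
  rcases le_or_gt x 0 with h0 | h0
  · simp only [bumpDeriv_of_nonpos h0]
    exact continuousAt_const
  · rcases h.lt_or_gt with h | h
    · refine ContinuousAt.congr (f := fun y => Real.cosh (y - x)) (by fun_prop) ?_
      filter_upwards [Ioi_mem_nhds h] with y' hy'
      rw [bumpDeriv_of_mem h0 hy']
    · refine ContinuousAt.congr (f := fun _ => (0 : ℝ)) (by fun_prop) ?_
      filter_upwards [Iio_mem_nhds h] with y' hy'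
      rw [bumpDeriv_of_le (le_of_lt hy')]

theorem hasDerivAt_bump {y x : ℝ} (h : x ≠ y) :
    HasDerivAt (fun y => bump y x) (bumpDeriv y x) y := by
  rcases le_or_gt x 0 with h0 | h0
  · simp only [bump_of_nonpos h0, bumpDeriv_of_nonpos h0]
    exact hasDerivAt_const _ _
  · rcases h.lt_or_gt with h | h
    · rw [bumpDeriv_of_mem h0 h]
      have : HasDerivAt (fun y => Real.sinh (y - x)) (Real.cosh (y - x)) y := by
        simpa using ((hasDerivAt_id y).sub_const x).sinh
      refine this.congr_of_eventuallyEq ?_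
      filter_upwards [Ioi_mem_nhds h] with y' hy'
      rw [bump_of_mem h0 (le_of_lt hy')]
    · rw [bumpDeriv_of_le h.le]
      refine (hasDerivAt_const y (0 : ℝ)).congr_of_eventuallyEq ?_
      filter_upwards [Iio_mem_nhds h] with y' hy'
      rw [bump_of_le (le_of_lt hy')]

theorem continuous_bumpDerivL : Continuous bumpDerivL := by
  refine continuous_iff_continuousAt.2 fun y => ?_
  refine tendsto_of_dominated coeFn_bumpDerivL (coeFn_bumpDerivL y)
    (memLp_box (2 * Real.cosh (y + 1)) (y + 1)) ?_ ?_
  · filter_upwards [Iio_mem_nhds (show y < y + 1 by linarith)] with y' hy'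
    refine Eventually.of_forall fun x => ?_
    have h1 := abs_bumpDeriv_le (le_of_lt hy') x
    have h2 := abs_bumpDeriv_le (show y ≤ y + 1 by linarith) x
    rw [← Complex.ofReal_sub, Complex.norm_real]
    refine (norm_sub_le _ _).trans ((add_le_add h1 h2).trans (le_of_eq ?_))
    by_cases hx : x ∈ Ioo 0 (y + 1)
    · simp only [indicator_of_mem hx]; ring
    · simp only [indicator_of_notMem hx]; ring
  · filter_upwards [Measure.ae_ne volume y] with x hx
    exact (Complex.continuous_ofReal.tendsto _).comp (continuousAt_bumpDeriv hx)

theorem hasDerivAt_bumpL (y : ℝ) : HasDerivAt bumpL (bumpDerivL y) y := by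
  rw [hasDerivAt_iff_tendsto_slope]
  refine tendsto_of_dominated (f := fun y' x => ((y' - y)⁻¹ * (bump y' x - bump y x) : ℝ))
    (fun y' => ?_) (coeFn_bumpDerivL y) (memLp_box (2 * Real.cosh (y + 1)) (y + 1)) ?_ ?_
  · rw [slope_def_module]
    filter_upwards [Lp.coeFn_smul (y' - y)⁻¹ (bumpL y' - bumpL y),
      Lp.coeFn_sub (bumpL y') (bumpL y),
      coeFn_bumpL y', coeFn_bumpL y] with x h1 h2 h3 h4
    rw [h1, Pi.smul_apply, h2, Pi.sub_apply, h3, h4, Complex.real_smul, Complex.ofReal_mul,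
      Complex.ofReal_sub]
  · filter_upwards [nhdsWithin_le_nhds (Iio_mem_nhds (show y < y + 1 by linarith)),
      self_mem_nhdsWithin] with y' hy' hne
    refine Eventually.of_forall fun x => ?_
    have hne : y' - y ≠ 0 := sub_ne_zero.2 hne
    have h1 := abs_bump_sub_le (le_of_lt hy') (show y ≤ y + 1 by linarith) x
    have h2 := abs_bumpDeriv_le (show y ≤ y + 1 by linarith) x
    have h3 : |(y' - y)⁻¹ * (bump y' x - bump y x)|
        ≤ (Ioo 0 (y + 1)).indicator (fun _ => Real.cosh (y + 1)) x := by
      rw [abs_mul, abs_inv, inv_mul_le_iff₀ (abs_pos.2 hne), mul_comm]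
      exact h1
    rw [← Complex.ofReal_sub, Complex.norm_real]
    refine (norm_sub_le _ _).trans ((add_le_add h3 h2).trans (le_of_eq ?_))
    by_cases hx : x ∈ Ioo 0 (y + 1)
    · simp only [indicator_of_mem hx]; ring
    · simp only [indicator_of_notMem hx]; ring
  · filter_upwards [Measure.ae_ne volume y] with x hx
    refine (Complex.continuous_ofReal.tendsto _).comp ?_
    have := hasDerivAt_iff_tendsto_slope.1 (hasDerivAt_bump hx)
    refine this.congr fun y' => ?_
    rw [slope_def_module, smul_eq_mul]

/-- The moment `∫ₓ^y e^{-3 r} sinh (y - r) dr`, evaluated. -/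
noncomputable def bumpMoment (y x : ℝ) : ℝ :=
  Real.exp (-3 * y) / 8 + Real.exp (y - 4 * x) / 8 - Real.exp (-y - 2 * x) / 4

theorem integral_exp_smul_bump {y x : ℝ} (h0 : 0 ≤ x) (h : x ≤ y) :
    ∫ r in Ioi x, Real.exp (-3 * r) • (bump y r : ℂ) = (bumpMoment y x : ℂ) := by
  have e : ∀ r, Real.exp (-3 * r) • (bump y r : ℂ) = ((Real.exp (-3 * r) * bump y r : ℝ) : ℂ) :=
    fun r => by rw [Complex.real_smul, Complex.ofReal_mul]
  simp_rw [e]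
  rw [integral_complex_ofReal, Complex.ofReal_inj,
    setIntegral_eq_of_subset_of_forall_sdiff_eq_zero measurableSet_Ioi (s := Ioc x y)
      Ioc_subset_Ioi_self (fun r hr => by
        rw [bump_of_le, mul_zero]
        by_contra! hlt
        exact hr.2 ⟨hr.1, hlt.le⟩),
    setIntegral_congr_fun (g := fun r => Real.exp (-3 * r) * Real.sinh (y - r)) measurableSet_Ioc
      fun r hr => by simp only [bump_of_mem (h0.trans_lt hr.1) hr.2],
    ← intervalIntegral.integral_of_le h, intervalIntegral.integral_eq_sub_of_hasDerivAt
      (f := fun r => -(Real.exp (y - 4 * r) / 8 - Real.exp (-y - 2 * r) / 4)) ?_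
      (Continuous.intervalIntegrable (by fun_prop) _ _)]
  · rw [bumpMoment, show y - 4 * y = -3 * y by ring, show -y - 2 * y = -3 * y by ring]
    ring
  · intro r _
    have h1 : HasDerivAt (fun r => Real.exp (y - 4 * r)) (Real.exp (y - 4 * r) * -4) r := by
      simpa using (((hasDerivAt_id r).const_mul 4).const_sub y).exp
    have h2 : HasDerivAt (fun r => Real.exp (-y - 2 * r)) (Real.exp (-y - 2 * r) * -2) r := by
      simpa using (((hasDerivAt_id r).const_mul 2).const_sub (-y)).exp
    refine ((h1.div_const 8).sub (h2.div_const 4)).neg.congr_deriv ?_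
    rw [Real.sinh_eq, show y - 4 * r = -3 * r + (y - r) by ring, Real.exp_add,
      show -y - 2 * r = -3 * r + -(y - r) by ring, Real.exp_add]
    ring

/-- The first two terms describe the amplification and the transport of the bump, and the last one
its nonlocal influence on the left half-line. On the right half-line the nonlocal part combines with
the local one, as `bumpMoment` consists of exponentials of the same kind. -/
theorem lMaps_bumpL (b : ℝ) {y : ℝ} (hy : 0 < y) :
    LMaps b (bumpL y) ((((b - 2) * Real.exp (-2 * y) : ℝ) : ℂ) • bumpL y
      - ((1 - Real.exp (-2 * y) : ℝ) : ℂ) • bumpDerivL y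
      - ((4 * (b - 3) * bumpMoment y 0 : ℝ) : ℂ) • negExpL) := by
  refine LMaps.of_hasDerivAt (f' := fun x => -(bumpDeriv y x : ℂ)) (s := {0, y})
    ((countable_singleton y).insert 0) (coeFn_bumpL y)
    (memLp_weight_smul (memLp_bumpDeriv y).neg) ?_ ?_ ?_
  · intro x hx
    rw [mem_insert_iff, mem_singleton_iff, not_or] at hx
    rw [← Complex.ofReal_neg]
    refine HasDerivAt.ofReal_comp ?_
    rcases lt_or_gt_of_ne hx.1 with h0 | h0
    · rw [bumpDeriv_of_nonpos h0.le, neg_zero]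
      refine (hasDerivAt_const x (0 : ℝ)).congr_of_eventuallyEq ?_
      filter_upwards [Iio_mem_nhds h0] with x' hx'
      exact bump_of_nonpos (le_of_lt hx')
    · rcases lt_or_gt_of_ne hx.2 with h | h
      · rw [bumpDeriv_of_mem h0 h]
        have : HasDerivAt (fun x => Real.sinh (y - x)) (-Real.cosh (y - x)) x := by
          simpa using ((hasDerivAt_id x).const_sub y).sinh
        refine this.congr_of_eventuallyEq ?_
        filter_upwards [Ioo_mem_nhds h0 h] with x' hx'
        exact bump_of_mem hx'.1 hx'.2.le
      · rw [bumpDeriv_of_le h.le, neg_zero]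
        refine (hasDerivAt_const x (0 : ℝ)).congr_of_eventuallyEq ?_
        filter_upwards [Ioi_mem_nhds h] with x' hx'
        exact bump_of_le (le_of_lt hx')
  · have : (fun x => (1 - phi x ^ 2) • (bump y x : ℂ)) =
        fun x => ((gap (max x 0) * Real.sinh (max (y - x) 0) : ℝ) : ℂ) := by
      funext x
      rw [Complex.real_smul, ← Complex.ofReal_mul, one_sub_phi_sq]
      rcases lt_or_ge 0 x with h | h
      · rw [max_eq_left h.le, abs_of_pos h, bump, if_pos h]
      · rw [max_eq_right h, bump_of_nonpos h, gap_zero, zero_mul, mul_zero]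
    rw [this]
    have := continuous_gap
    fun_prop
  · filter_upwards [Lp.coeFn_sub ((((b - 2) * Real.exp (-2 * y) : ℝ) : ℂ) • bumpL y
        - ((1 - Real.exp (-2 * y) : ℝ) : ℂ) • bumpDerivL y)
        (((4 * (b - 3) * bumpMoment y 0 : ℝ) : ℂ) • negExpL),
      Lp.coeFn_sub ((((b - 2) * Real.exp (-2 * y) : ℝ) : ℂ) • bumpL y)
        (((1 - Real.exp (-2 * y) : ℝ) : ℂ) • bumpDerivL y),
      Lp.coeFn_smul (((b - 2) * Real.exp (-2 * y) : ℝ) : ℂ) (bumpL y),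
      Lp.coeFn_smul ((1 - Real.exp (-2 * y) : ℝ) : ℂ) (bumpDerivL y),
      Lp.coeFn_smul ((4 * (b - 3) * bumpMoment y 0 : ℝ) : ℂ) negExpL,
      coeFn_bumpL y, coeFn_bumpDerivL y, coeFn_negExpL, Measure.ae_ne volume 0,
      Measure.ae_ne volume y] with x h1 h2 h3 h4 h5 h6 h7 h8 h0 hxy
    rw [h1, Pi.sub_apply, h2, Pi.sub_apply, h3, h4, h5, Pi.smul_apply, Pi.smul_apply,
      Pi.smul_apply, h6, h7, h8, setIntegral_smul_eq_zero _ fun r hr => by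
          rw [bump_of_nonpos ((le_of_lt hr).trans (min_le_right _ _)), Complex.ofReal_zero]]
    rcases h0.lt_or_gt with h | h
    · rw [max_eq_right h.le, integral_exp_smul_bump le_rfl hy.le, bump_of_nonpos h.le,
        bumpDeriv_of_nonpos h.le, negExp_of_neg h]
      simp only [Complex.real_smul, smul_eq_mul]
      push_cast
      ring
    · rw [max_eq_left h.le, negExp_of_nonneg h.le]
      rcases hxy.lt_or_gt with h' | h'
      · rw [integral_exp_smul_bump h.le h'.le, bump_of_mem h h'.le, bumpDeriv_of_mem h h',
          phi_of_nonneg h.le, dphi_of_pos h]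
        simp only [Complex.real_smul, smul_eq_mul, smul_zero, mul_zero, zero_sub, sub_zero,
          ← Complex.ofReal_mul, ← Complex.ofReal_neg, ← Complex.ofReal_add, ← Complex.ofReal_sub,
          Complex.ofReal_inj, Complex.ofReal_zero]
        have ex := Real.exp_pos x
        have ey := Real.exp_pos y
        have p1 : Real.exp (-2 * y) = (Real.exp y)⁻¹ ^ 2 := by
          rw [← Real.exp_neg, ← Real.exp_nat_mul]; push_cast; ring_nf
        have p2 : Real.exp (-3 * y) = (Real.exp y)⁻¹ ^ 3 := by
          rw [← Real.exp_neg, ← Real.exp_nat_mul]; push_cast; ring_nf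
        have p3 : Real.exp (y - 4 * x) = Real.exp y * (Real.exp x)⁻¹ ^ 4 := by
          rw [← Real.exp_neg, ← Real.exp_nat_mul, ← Real.exp_add]; push_cast; ring_nf
        have p4 : Real.exp (-y - 2 * x) = (Real.exp y)⁻¹ * (Real.exp x)⁻¹ ^ 2 := by
          rw [← Real.exp_neg, ← Real.exp_neg, ← Real.exp_nat_mul, ← Real.exp_add]
          push_cast; ring_nf
        rw [bumpMoment, Real.sinh_eq, Real.cosh_eq, neg_sub, Real.exp_sub, Real.exp_sub, p1, p2, p3,
          p4, Real.exp_neg]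
        field_simp
        ring
      · rw [bump_of_le h'.le, bumpDeriv_of_le h'.le, setIntegral_smul_eq_zero _ fun r hr => by
          rw [bump_of_le (h'.le.trans (le_of_lt hr)), Complex.ofReal_zero]]
        simp

/-- The right endpoint of the transported bump; it satisfies `y' = -(1 - e^{-2 y})`. -/
noncomputable def endpoint (t : ℝ) : ℝ := Real.log (1 + Real.exp (-2 * t)) / 2

theorem endpoint_pos (t : ℝ) : 0 < endpoint t :=
  div_pos (Real.log_pos (by linarith [Real.exp_pos (-2 * t)])) two_pos

theorem exp_endpoint (t : ℝ) : Real.exp (-2 * endpoint t) = (1 + Real.exp (-2 * t))⁻¹ := by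
  rw [endpoint, show -2 * (Real.log (1 + Real.exp (-2 * t)) / 2)
    = -Real.log (1 + Real.exp (-2 * t)) by ring, Real.exp_neg, Real.exp_log (by positivity)]

theorem hasDerivAt_endpoint (t : ℝ) :
    HasDerivAt endpoint (-(1 - Real.exp (-2 * endpoint t))) t := by
  have h : (0 : ℝ) < 1 + Real.exp (-2 * t) := by positivity
  refine ((((hasDerivAt_exp_const_mul (-2) t).const_add 1).log h.ne').div_const 2).congr_deriv ?_
  rw [exp_endpoint]
  field_simp
  ring

/-- A solution of the evolution equation that is explicit up to a linear system for the components
along `φ` and `φ'`: an amplified bump moves to the left, and the nonlocal term acts on the span of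
`φ` and `φ'` only. -/
theorem exists_solvesEvolution_bump (b : ℝ) : ∃ z : ℝ → L2R, SolvesEvolution b z ∧
    ∃ A a c : ℂ, A ≠ 0 ∧ z 0 = A • bumpL (endpoint 0) + a • phiL + c • dphiL := by
  have hyc : Continuous endpoint :=
    continuous_iff_continuousAt.2 fun t => (hasDerivAt_endpoint t).continuousAt
  -- The amplitude solves `A' = (b - 2) e^{-2 y} A`.
  set A : ℝ → ℝ := fun t => Real.exp ((b - 2) * (t + endpoint t)) with hA
  have hAd : ∀ t, HasDerivAt A ((b - 2) * Real.exp (-2 * endpoint t) * A t) t := fun t => by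
    refine ((((hasDerivAt_id t).add (hasDerivAt_endpoint t)).const_mul (b - 2)).exp).congr_deriv ?_
    simp only [hA, Pi.add_apply, id]
    ring
  have hAc : Continuous A := continuous_iff_continuousAt.2 fun t => (hAd t).continuousAt
  -- The multiple of `negExpL` produced by the bump is split equally between `φ` and `φ'`.
  set F : ℝ → ℂ := fun t => ((-2 * (b - 3) * (A t * bumpMoment (endpoint t) 0) : ℝ) : ℂ) with hF
  have hFc : Continuous F := by
    simp only [hF, bumpMoment]
    fun_prop
  obtain ⟨α, β, hα, hβ⟩ := exists_hasDerivAt_system (b - 2) (4 - b) hFc hFc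
  have hαc : Continuous α := continuous_iff_continuousAt.2 fun t => (hα t).continuousAt
  have hβc : Continuous β := continuous_iff_continuousAt.2 fun t => (hβ t).continuousAt
  have hS : ∀ t, HasDerivAt (fun t => bumpL (endpoint t))
      ((-(1 - Real.exp (-2 * endpoint t))) • bumpDerivL (endpoint t)) t := fun t =>
    (hasDerivAt_bumpL (endpoint t)).scomp t (hasDerivAt_endpoint t)
  have hSc : Continuous fun t => bumpL (endpoint t) :=
    continuous_iff_continuousAt.2 fun t => (hS t).continuousAt
  have hCc : Continuous fun t => bumpDerivL (endpoint t) := continuous_bumpDerivL.comp hyc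
  refine ⟨fun t => (A t : ℂ) • bumpL (endpoint t) + α t • phiL + β t • dphiL,
    solvesEvolution_of_lMaps (R := fun t =>
      (((b - 2) * Real.exp (-2 * endpoint t) * A t : ℝ) : ℂ) • bumpL (endpoint t)
      + ((A t * -(1 - Real.exp (-2 * endpoint t)) : ℝ) : ℂ) • bumpDerivL (endpoint t)
      + ((b - 2) * β t + F t) • phiL + ((4 - b) * α t + F t) • dphiL) (by fun_prop)
      fun t => ⟨?_, ?_⟩, A 0, α 0, β 0, ?_, rfl⟩
  · have h := (((lMaps_bumpL b (endpoint_pos t)).smul (A t : ℂ)).add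
      ((lMaps_phiL b).smul (α t))).add ((lMaps_dphiL b).smul (β t))
    have hn : negExpL = (1 / 2 : ℂ) • (phiL + dphiL) := by
      rw [phiL_eq, dphiL_eq]; module
    convert h using 1
    simp only [hn, hF]
    push_cast
    module
  · have h := (((hAd t).ofReal_comp.smul (hS t)).add ((hα t).smul_const phiL)).add
      ((hβ t).smul_const dphiL)
    refine h.congr_deriv ?_
    rw [RCLike.real_smul_eq_coe_smul (K := ℂ) (-(1 - Real.exp (-2 * endpoint t))),
      RCLike.ofReal_eq_complex_ofReal]
    push_cast
    module
  · exact Complex.ofReal_ne_zero.2 (Real.exp_pos _).ne'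

/-- The bump detects the adjoint eigenfunction: `Γ'' - Γ` is convolved with the fundamental solution
`sinh` of `D² - 1`. -/
theorem inner_adjointL_bumpL {μ k y : ℝ} (hμ : 0 < μ) (hk : 3 / 2 < k) (hy : 0 < y) :
    inner ℂ (adjointL hμ hk) (bumpL y) = (potential μ k y : ℂ) := by
  have h1 := continuous_potential μ (k := k) (by linarith)
  have h2 := continuous_potentialDeriv μ (k := k) (by linarith)
  have hi : IntervalIntegrable (fun x => adjointProfile μ k x * Real.sinh (y - x)) volume 0 y := by
    have h0 : IntervalIntegrable (fun x => Real.exp (0 * x) * adjointProfile μ k x) volume 0 y :=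
      (intervalIntegrable_iff_integrableOn_Ioc_of_le hy.le).2
        ((integrableOn_exp_mul_adjointProfile hμ hk le_rfl).mono_set Ioc_subset_Ioi_self)
    have := h0.mul_continuousOn (g := fun x => Real.sinh (y - x))
      (by fun_prop : Continuous _).continuousOn
    simpa using this
  rw [inner_adjointL]
  have e : ∫ x in Ioi 0, adjointProfile μ k x • bumpL y x
      = ∫ x in Ioi 0, ((adjointProfile μ k x * bump y x : ℝ) : ℂ) := by
    refine integral_congr_ae (ae_restrict_of_ae ?_)
    filter_upwards [coeFn_bumpL y] with x hx
    rw [hx, Complex.real_smul, Complex.ofReal_mul]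
  rw [e, integral_complex_ofReal, Complex.ofReal_inj,
    setIntegral_eq_of_subset_of_forall_sdiff_eq_zero measurableSet_Ioi (s := Ioc 0 y)
      Ioc_subset_Ioi_self (fun r hr => by
        rw [bump_of_le, mul_zero]
        by_contra! hlt
        exact hr.2 ⟨hr.1, hlt.le⟩),
    setIntegral_congr_fun (g := fun x => adjointProfile μ k x * Real.sinh (y - x)) measurableSet_Ioc
      fun r hr => by simp only [bump_of_mem hr.1 hr.2],
    ← intervalIntegral.integral_of_le hy.le,
    intervalIntegral.integral_eq_sub_of_hasDerivAt_of_le hy.le (f := fun s =>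
      potentialDeriv μ k s * Real.sinh (y - s) + potential μ k s * Real.cosh (y - s))
      (by fun_prop) (fun s hs => ?_) hi, potential_zero μ (by linarith),
    potentialDeriv_zero μ (by linarith)]
  · simp
  · have hs1 : HasDerivAt (fun s => Real.sinh (y - s)) (-Real.cosh (y - s)) s := by
      simpa using ((hasDerivAt_id s).const_sub y).sinh
    have hs2 : HasDerivAt (fun s => Real.cosh (y - s)) (-Real.sinh (y - s)) s := by
      simpa using ((hasDerivAt_id s).const_sub y).cosh
    refine (((hasDerivAt_potentialDeriv μ k hs.1).mul hs1).add
      ((hasDerivAt_potential μ k hs.1).mul hs2)).congr_deriv ?_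
    rw [adjointProfile]
    ring

theorem adjointL_ne_zero {μ k : ℝ} (hμ : 0 < μ) (hk : 3 / 2 < k) : adjointL hμ hk ≠ 0 := by
  intro h
  have := inner_adjointL_bumpL hμ hk one_pos
  rw [h, inner_zero_left] at this
  exact (potential_pos μ k one_pos).ne (Complex.ofReal_eq_zero.1 this.symm).symm

theorem SolvesEvolution.smul {b : ℝ} {z : ℝ → L2R} (hz : SolvesEvolution b z) (c : ℂ) :
    SolvesEvolution b fun t => c • z t := by
  obtain ⟨R, hR, h⟩ := hz.lMaps
  exact solvesEvolution_of_lMaps (hR.const_smul c) fun t =>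
    ⟨(h t).1.smul c, (h t).2.const_smul c⟩

theorem SolvesEvolution.continuous {b : ℝ} {z : ℝ → L2R} (hz : SolvesEvolution b z) :
    Continuous z := hz.1.2.continuous

/-- The pairing of an initial value with the adjoint eigenfunction can be prescribed. -/
theorem exists_solvesEvolution_inner_eq {b μ k : ℝ} (hμ : 0 < μ) (hk : 3 / 2 < k)
    (hb : b = 2 * k + 2 + μ) (d : ℂ) :
    ∃ z : ℝ → L2R, SolvesEvolution b z ∧ inner ℂ (adjointL hμ hk) (z 0) = d := by
  obtain ⟨z, hz, A, a, c, hA, h0⟩ := exists_solvesEvolution_bump b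
  have hphi := inner_adjointL_phi hμ hk hb
  have hne : A * potential μ k (endpoint 0) ≠ 0 :=
    mul_ne_zero hA (Complex.ofReal_ne_zero.2 (potential_pos μ k (endpoint_pos 0)).ne')
  have hi : inner ℂ (adjointL hμ hk) (z 0) = A * potential μ k (endpoint 0) := by
    rw [h0, inner_add_right, inner_add_right, inner_smul_right, inner_smul_right, inner_smul_right,
      hphi.1, hphi.2, inner_adjointL_bumpL hμ hk (endpoint_pos 0)]
    ring
  refine ⟨_, hz.smul (d / (A * potential μ k (endpoint 0))), ?_⟩
  rw [inner_smul_right, hi, div_mul_cancel₀ _ hne]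

/-! ### Growing solutions and instability -/

/-- By the Cauchy–Schwarz inequality, a function grows if its component along a fixed vector
does. -/
theorem growsExponentially_of_inner {μ : ℝ} {w : L2R} (hw : w ≠ 0) {v : ℝ → L2R}
    (h : ∀ t, inner ℂ w (v t) = Real.exp (μ * t) * inner ℂ w w) : GrowsExponentially μ v := by
  have hw0 : 0 < ‖w‖ := norm_pos_iff.2 hw
  refine ⟨‖w‖, hw0, fun t _ => ?_⟩
  have h1 := norm_inner_le_norm (𝕜 := ℂ) w (v t)
  rw [h, norm_mul, Complex.norm_real, Real.norm_eq_abs, Real.abs_exp,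
    inner_self_eq_norm_sq_to_K, norm_pow, RCLike.norm_ofReal, abs_of_pos hw0] at h1
  refine le_of_mul_le_mul_left ?_ hw0
  linarith

theorem exists_growing_mode {b : ℝ} {l : ℂ} (h0 : 0 < l.re) (h1 : l.re < 5 - b) :
    (∃ w : L2R, IsEigenfunction (L b) l w) ∧
      (l ^ 2 ≠ (b - 2) * (4 - b) → ∀ w : L2R, IsEigenfunction (L b) l w →
        w ∉ Submodule.span ℂ {phiL, dphiL} ∧
        SolvesEvolution b (fun t : ℝ => Complex.exp (l * t) • w) ∧
        ∃ α β : ℝ → ℂ, SolvesModulation b (fun t => Complex.exp (l * t) • w) α β ∧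
          SolvesLinearization b
            (fun t => Complex.exp (l * t) • w + α t • phiL + β t • dphiL) ∧
          GrowsExponentially l.re
            (fun t => Complex.exp (l * t) • w + α t • phiL + β t • dphiL)) := by
  refine ⟨exists_isEigenfunction h0 h1, fun hl w hw => ?_⟩
  have hn := hw.notMem_span hl
  have hz := hw.solvesEvolution
  obtain ⟨α, β, hm⟩ := exists_solvesModulation b hz.continuous
  exact ⟨hn, hz, α, β, hm, hz.solvesLinearization hm, growsExponentially_of_notMem_span α β hn⟩

theorem exists_growing_adjoint_mode {b μ : ℝ} (h0 : 0 < μ) (h1 : μ < b - 5) :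
    ∃ w : L2R, IsEigenfunction (L b).adjoint μ w ∧
      (∀ z : ℝ → L2R, SolvesEvolution b z →
        ∀ t : ℝ, inner ℂ w (z t) = Real.exp (μ * t) * inner ℂ w (z 0)) ∧
      ∃ r : ℝ → L2R, (∀ t, inner ℂ w (r t) = 0) ∧
        SolvesEvolution b (fun t => Real.exp (μ * t) • w + r t) ∧
        ∃ α β : ℝ → ℂ, SolvesModulation b (fun t => Real.exp (μ * t) • w + r t) α β ∧
          SolvesLinearization b
            (fun t => Real.exp (μ * t) • w + r t + α t • phiL + β t • dphiL) ∧
          GrowsExponentially μ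
            (fun t => Real.exp (μ * t) • w + r t + α t • phiL + β t • dphiL) := by
  obtain ⟨k, hb⟩ : ∃ k, b = 2 * k + 2 + μ := ⟨(b - 2 - μ) / 2, by ring⟩
  have hk : 3 / 2 < k := by linarith
  have hne := adjointL_ne_zero h0 hk
  have hev := fun z hz t => inner_adjointL_evolution (z := z) h0 hk hb hz t
  have hphi := inner_adjointL_phi h0 hk hb
  have heig := adjointL_isEigenfunction h0 hk hb hne
  obtain ⟨z, hz, hz0⟩ := exists_solvesEvolution_inner_eq h0 hk hb
    (inner ℂ (adjointL h0 hk) (adjointL h0 hk))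
  generalize adjointL h0 hk = w at *
  refine ⟨w, heig, hev, fun t => z t - Real.exp (μ * t) • w, fun t => ?_, ?_⟩
  · rw [inner_sub_right, hev z hz, hz0, RCLike.real_smul_eq_coe_smul (K := ℂ), inner_smul_right,
      RCLike.ofReal_eq_complex_ofReal, sub_self]
  · simp only [add_sub_cancel]
    obtain ⟨α, β, hm⟩ := exists_solvesModulation b hz.continuous
    refine ⟨hz, α, β, hm, hz.solvesLinearization hm, growsExponentially_of_inner hne fun t => ?_⟩
    rw [inner_add_right, inner_add_right, inner_smul_right, inner_smul_right, hphi.1, hphi.2,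
      hev z hz, hz0, mul_zero, mul_zero, add_zero, add_zero]

theorem linearlyUnstable (b : ℝ) : LinearlyUnstable b := by
  by_cases hb : b = 4
  · -- `φ` and `φ'` do not grow for `b = 4`, but `1/2` is an eigenvalue off their span.
    obtain ⟨⟨w, hw⟩, h⟩ := exists_growing_mode (b := b) (l := (1 / 2 : ℝ))
      (by rw [Complex.ofReal_re]; norm_num) (by rw [Complex.ofReal_re]; linarith)
    obtain ⟨-, -, α, β, -, hv, hg⟩ := h (by rw [hb]; norm_num) w hw
    exact linearlyUnstable_of_growth (by rw [Complex.ofReal_re]; norm_num) hv hg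
  · obtain ⟨α, β, -, hv, hg⟩ := exists_growing_modulation b
    exact linearlyUnstable_of_growth (abs_pos.2 (sub_ne_zero.2 hb)) hv hg

end BNovikov

theorem mainTheorem2 (b : ℝ) :
    LinearlyUnstable b ∧
    (b ≠ 4 → ∃ α β : ℝ → ℂ, SolvesModulation b (fun _ => 0) α β ∧
      SolvesLinearization b (fun t => α t • phiL + β t • dphiL) ∧
      GrowsExponentially |b - 4| (fun t => α t • phiL + β t • dphiL)) ∧
    (b < 5 → ∀ μ : ℂ, 0 < μ.re → μ.re < 5 - b →
      (∃ w : L2R, IsEigenfunction (L b) μ w) ∧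
      (μ ^ 2 ≠ (b - 2) * (4 - b) → ∀ w : L2R, IsEigenfunction (L b) μ w →
        w ∉ Submodule.span ℂ {phiL, dphiL} ∧
        SolvesEvolution b (fun t : ℝ => Complex.exp (μ * t) • w) ∧
        ∃ α β : ℝ → ℂ, SolvesModulation b (fun t => Complex.exp (μ * t) • w) α β ∧
          SolvesLinearization b
            (fun t => Complex.exp (μ * t) • w + α t • phiL + β t • dphiL) ∧
          GrowsExponentially μ.re
            (fun t => Complex.exp (μ * t) • w + α t • phiL + β t • dphiL))) ∧
    (5 < b → ∀ μ : ℝ, 0 < μ → μ < b - 5 →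
      ∃ w : L2R, IsEigenfunction (L b).adjoint μ w ∧
        (∀ z : ℝ → L2R, SolvesEvolution b z →
          ∀ t : ℝ, inner ℂ w (z t) = Real.exp (μ * t) * inner ℂ w (z 0)) ∧
        ∃ r : ℝ → L2R, (∀ t, inner ℂ w (r t) = 0) ∧
          SolvesEvolution b (fun t => Real.exp (μ * t) • w + r t) ∧
          ∃ α β : ℝ → ℂ, SolvesModulation b (fun t => Real.exp (μ * t) • w + r t) α β ∧
            SolvesLinearization b
              (fun t => Real.exp (μ * t) • w + r t + α t • phiL + β t • dphiL) ∧
            GrowsExponentially μ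
              (fun t => Real.exp (μ * t) • w + r t + α t • phiL + β t • dphiL)) :=
  ⟨linearlyUnstable b, fun _ => exists_growing_modulation b,
    fun _ _ h0 h1 => exists_growing_mode h0 h1, fun _ _ h0 h1 => exists_growing_adjoint_mode h0 h1⟩
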